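/- Let $\Omega\subset\mathbb R^2$ be a bounded polygonal domain with Lipschitz boundary, and let $\alpha_0<\pi$ and $C_1\in\mathbb R$. For a conforming triangulation $\mathcal T_h$ of $\Omega$ let $h$ be the maximal diameter of its elements, let $\mathcal T_h^2$ be the set of elements whose maximum angle exceeds $\alpha_0$, let $X_h\subset H^1(\Omega)$ be the space of functions that are continuous on $\overline\Omega$ and affine on each element, and let $V_h=X_h\cap H^1_0(\Omega)$. A cluster is a simply connected union of (closed) elements of $\mathcal T_h$, at least one of which lies in $\mathcal T_h^2$. There is a constant $C$, depending only on $\Omega,\alpha_0,C_1$, such that the following holds. Let $\mathcal T_h$ be a conforming triangulation of $\Omega$ with clusters $\mathcal C_1,\dots,\mathcal C_N$ ($N\ge 0$) of diameters $r_i=\operatorname{diam}\mathcal C_i$, such that every element of $\mathcal T_h^2$ belongs to some $\mathcal C_i$ and $$\text{(i)}\ \sum_{i=1}^N r_i^2\le C_1h,\qquad \text{(ii)}\ \operatorname{dist}(\mathcal C_i,\mathcal C_j)\ge 2(r_i+r_j)\quad\text{for } i\ne j .$$ Then for every $u\in W^{2,\infty}(\Omega)$ (taken continuous on $\overline\Omega$)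 there is a discrete Dirichlet lift $g_h\in X_h$ such that - $|g_h(p)-u(p)|\le C|u|_{2,\infty}h$ at every vertex $p\in\partial\Omega$ of $\mathcal T_h$; - $g_h(p)=u(p)$ at every vertex $p\in\partial\Omega$ with $\operatorname{dist}(p,\mathcal C_i)\ge 2r_i$ for all $i$; - $g_h=0$ if $u=0$ on $\partial\Omega$; and such that, whenever $f\in L^2(\Omega)$ and $u$ is a weak solution of $-\Delta u=f$, i.e. $\int_\Omega\nabla u\cdot\nabla v\,dx=\int_\Omega fv\,dx$ for all $v\in H^1_0(\Omega)$, the finite element solution $U=U_0+g_h$, $U_0\in V_h$, defined by $\int_\Omega\nabla U\cdot\nabla v_h\,dx=\int_\Omega fv_h\,dx$ for all $v_h\in V_h$, satisfies $$|u-U|_{H^1(\Omega)}\le C\,|u|_{2,\infty}\,h .$$ Here $|u|_{2,\infty}$ is the largest $L^\infty(\Omega)$ norm of a second-order weak derivative of $u$. Thus $O(h)$ convergence holds along every family of such triangulations, and clusters of diameter up to $O(h^{1/2})$ are allowed. -/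

import Mathlib

open MeasureTheory Filter Topology Set
open scoped ENNReal NNReal ContDiff

/-- The plane `ℝ²` with its Euclidean norm. -/
abbrev Plane : Type := EuclideanSpace ℝ (Fin 2)

namespace ClusterFEM

noncomputable section

/-! ### The domain -/

/-- `Ω` has a Lipschitz boundary: near each boundary point, in suitable Cartesian coordinates,
`Ω` is the region strictly above the graph of a Lipschitz function. -/
def HasLipschitzBoundary (Ω : Set Plane) : Prop :=
  ∀ x ∈ frontier Ω, ∃ (R : Plane ≃ₗᵢ[ℝ] Plane) (γ : ℝ → ℝ) (L : ℝ≥0) (ρ : ℝ),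
    0 < ρ ∧ LipschitzWith L γ ∧
      ∀ y ∈ Metric.ball x ρ, y ∈ Ω ↔ γ (R y 0) < R y 1

/-- Bounded polygonal domains with Lipschitz boundary. -/
structure IsPolygonalDomain (Ω : Set Plane) : Prop where
  isOpen : IsOpen Ω
  isConnected : IsConnected Ω
  isBounded : Bornology.IsBounded Ω
  polygonal : ∃ S : Finset (Plane × Plane), frontier Ω = ⋃ e ∈ S, segment ℝ e.1 e.2
  lipschitz : HasLipschitzBoundary Ω

/-! ### Sobolev spaces -/

/-- `C_c^∞(Ω)`. -/
structure IsTestFunction (Ω : Set Plane) (φ : Plane → ℝ) : Prop where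
  contDiff : ContDiff ℝ ∞ φ
  hasCompactSupport : HasCompactSupport φ
  tsupport_subset : tsupport φ ⊆ Ω

/-- `G` is the weak (distributional) gradient of `v` on `Ω`. -/
structure IsWeakGradient (Ω : Set Plane) (v : Plane → ℝ) (G : Plane → Plane) : Prop where
  locallyIntegrableOn : LocallyIntegrableOn v Ω
  locallyIntegrableOn_grad : LocallyIntegrableOn G Ω
  integral_eq : ∀ φ : Plane → ℝ, IsTestFunction Ω φ →
    ∫ x in Ω, v x • gradient φ x = -∫ x in Ω, φ x • G x

/-- Functions in `H¹(Ω)`, together with (a representative of) their weak gradient. Values outside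
the closure of `Ω` carry no meaning. -/
structure H1 (Ω : Set Plane) where
  toFun : Plane → ℝ
  grad : Plane → Plane
  memLp : MemLp toFun 2 (volume.restrict Ω)
  memLp_grad : MemLp grad 2 (volume.restrict Ω)
  isWeakGradient : IsWeakGradient Ω toFun grad

instance (Ω : Set Plane) : CoeFun (H1 Ω) (fun _ => Plane → ℝ) := ⟨H1.toFun⟩

theorem integrableOn_smul_of_isTestFunction {Ω : Set Plane} {F : Type*} [NormedAddCommGroup F]
    [NormedSpace ℝ F] {G : Plane → F} (hG : LocallyIntegrableOn G Ω)
    {φ : Plane → ℝ} (hφ : IsTestFunction Ω φ) : IntegrableOn (fun x => φ x • G x) Ω := by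
  have h1 : IntegrableOn G (tsupport φ) :=
    hG.integrableOn_compact_subset hφ.tsupport_subset hφ.hasCompactSupport
  have h2 : IntegrableOn (fun x => φ x • G x) (tsupport φ) :=
    h1.continuousOn_smul hφ.contDiff.continuous.continuousOn hφ.hasCompactSupport
  have h3 : Integrable (fun x => φ x • G x) := by
    refine (integrableOn_iff_integrable_of_support_subset ?_).1 h2
    intro x hx
    apply subset_tsupport
    intro h0
    exact hx (by simp [h0])
  exact h3.integrableOn

theorem integrableOn_smul_gradient {Ω : Set Plane} {v : Plane → ℝ}
    (hv : LocallyIntegrableOn v Ω) {φ : Plane → ℝ} (hφ : IsTestFunction Ω φ) :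
    IntegrableOn (fun x => v x • gradient φ x) Ω := by
  have hc : Continuous (gradient φ) :=
    (InnerProductSpace.toDual ℝ Plane).symm.continuous.comp
      (hφ.contDiff.continuous_fderiv (by simp))
  have h1 : IntegrableOn v (tsupport φ) :=
    hv.integrableOn_compact_subset hφ.tsupport_subset hφ.hasCompactSupport
  have h2 : IntegrableOn (fun x => v x • gradient φ x) (tsupport φ) :=
    h1.smul_continuousOn hc.continuousOn hφ.hasCompactSupport
  have h3 : Integrable (fun x => v x • gradient φ x) := by
    refine (integrableOn_iff_integrable_of_support_subset ?_).1 h2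
    intro x hx
    by_contra h0
    apply hx
    have h4 : fderiv ℝ φ x = 0 := by
      by_contra h5
      exact h0 (support_fderiv_subset ℝ h5)
    simp [gradient, h4]
  exact h3.integrableOn

theorem IsWeakGradient.add {Ω : Set Plane} {v w : Plane → ℝ} {G H : Plane → Plane}
    (hv : IsWeakGradient Ω v G) (hw : IsWeakGradient Ω w H) :
    IsWeakGradient Ω (fun x => v x + w x) (fun x => G x + H x) where
  locallyIntegrableOn := hv.locallyIntegrableOn.add hw.locallyIntegrableOn
  locallyIntegrableOn_grad := hv.locallyIntegrableOn_grad.add hw.locallyIntegrableOn_grad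
  integral_eq φ hφ := by
    simp only [add_smul, smul_add]
    rw [integral_add (integrableOn_smul_gradient hv.locallyIntegrableOn hφ)
        (integrableOn_smul_gradient hw.locallyIntegrableOn hφ),
      integral_add (integrableOn_smul_of_isTestFunction hv.locallyIntegrableOn_grad hφ)
        (integrableOn_smul_of_isTestFunction hw.locallyIntegrableOn_grad hφ),
      hv.integral_eq φ hφ, hw.integral_eq φ hφ, neg_add]

instance (Ω : Set Plane) : Add (H1 Ω) where
  add v w :=
    { toFun := fun x => v x + w x
      grad := fun x => v.grad x + w.grad x
      memLp := v.memLp.add w.memLp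
      memLp_grad := v.memLp_grad.add w.memLp_grad
      isWeakGradient := v.isWeakGradient.add w.isWeakGradient }

/-- `H¹₀(Ω)`: the closure of `C_c^∞(Ω)` in the `H¹(Ω)` norm. -/
def IsH10 {Ω : Set Plane} (v : H1 Ω) : Prop :=
  ∃ φ : ℕ → Plane → ℝ, (∀ n, IsTestFunction Ω (φ n)) ∧
    Tendsto (fun n => eLpNorm (fun x => φ n x - v x) 2 (volume.restrict Ω)) atTop (𝓝 0) ∧
    Tendsto (fun n => eLpNorm (fun x => gradient (φ n) x - v.grad x) 2 (volume.restrict Ω))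
      atTop (𝓝 0)

/-- `u ∈ W^{2,∞}(Ω)`, represented by its version that is continuous on the closure of `Ω`;
`D2 i` is the weak gradient of `∂ᵢ u`, so that `D2 i x j` is `∂ⱼ∂ᵢ u (x)`. -/
structure IsW2Inf {Ω : Set Plane} (u : H1 Ω) (D2 : Fin 2 → Plane → Plane) : Prop where
  continuousOn : ContinuousOn u (closure Ω)
  memLp : MemLp u ∞ (volume.restrict Ω)
  memLp_grad : MemLp u.grad ∞ (volume.restrict Ω)
  memLp_hess : ∀ i, MemLp (D2 i) ∞ (volume.restrict Ω)
  isWeakGradient : ∀ i, IsWeakGradient Ω (fun x => u.grad x i) (D2 i)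

/-- The seminorm `|u|_{2,∞}`: the largest `L^∞(Ω)` norm of a second derivative. -/
def semiNormW2Inf (Ω : Set Plane) (D2 : Fin 2 → Plane → Plane) : ℝ :=
  ⨆ p : Fin 2 × Fin 2, (eLpNorm (fun x => D2 p.1 x p.2) ∞ (volume.restrict Ω)).toReal

/-- `a(v, w) = ∫_Ω ∇v · ∇w`. -/
def bilin {Ω : Set Plane} (v w : H1 Ω) : ℝ :=
  ∫ x in Ω, inner ℝ (v.grad x) (w.grad x)

/-- The `H¹(Ω)` seminorm `|v - w|₁` of a difference. -/
def semiDistH1 {Ω : Set Plane} (v w : H1 Ω) : ℝ :=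
  √(∫ x in Ω, ‖v.grad x - w.grad x‖ ^ 2)

/-! ### Triangulations and finite element spaces -/

/-- `T` is a conforming triangulation of `Ω`: a finite simplicial complex all of whose maximal
faces are triangles and which fills the closure of `Ω`. -/
structure IsTriangulation (Ω : Set Plane) (T : Geometry.SimplicialComplex ℝ Plane) : Prop where
  finite : T.faces.Finite
  pure : ∀ s ∈ T.faces, ∃ t ∈ T.faces, s ⊆ t ∧ t.card = 3
  space_eq : T.space = closure Ω

/-- The elements (triangles) of the triangulation, each given by its set of three vertices. -/
def elements (T : Geometry.SimplicialComplex ℝ Plane) : Set (Finset Plane) :=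
  {K | K ∈ T.faces ∧ K.card = 3}

/-- The closed triangle with vertex set `K`. -/
def tri (K : Finset Plane) : Set Plane := convexHull ℝ (K : Set Plane)

/-- The mesh size: the maximal diameter of an element. -/
def meshSize (T : Geometry.SimplicialComplex ℝ Plane) : ℝ :=
  sSup ((fun K => Metric.diam (tri K)) '' elements T)

/-- The maximum angle of the triangle with vertex set `K`. -/
def maxAngle (K : Finset Plane) : ℝ :=
  sSup {θ | ∃ p ∈ K, ∃ q ∈ K, ∃ r ∈ K, p ≠ q ∧ q ≠ r ∧ p ≠ r ∧ θ = EuclideanGeometry.angle p q r}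

/-- The elements violating the maximum angle condition with bound `α₀`. -/
def badElements (T : Geometry.SimplicialComplex ℝ Plane) (α₀ : ℝ) : Set (Finset Plane) :=
  {K | K ∈ elements T ∧ α₀ < maxAngle K}

/-- `X_h`: globally continuous functions that are affine on each element. -/
structure IsFEFunction {Ω : Set Plane} (T : Geometry.SimplicialComplex ℝ Plane) (v : H1 Ω) :
    Prop where
  continuousOn : ContinuousOn v (closure Ω)
  affine : ∀ K ∈ elements T, ∃ A : Plane →ᵃ[ℝ] ℝ, ∀ x ∈ tri K, v x = A x

/-- `V_h = X_h ∩ H¹₀(Ω)`. -/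
def IsFEFunction0 {Ω : Set Plane} (T : Geometry.SimplicialComplex ℝ Plane) (v : H1 Ω) : Prop :=
  IsFEFunction T v ∧ IsH10 v

/-- `u` satisfies `-Δu = f` in `Ω` in the weak sense. -/
def IsWeakSolution {Ω : Set Plane} (f : Plane → ℝ) (u : H1 Ω) : Prop :=
  ∀ v : H1 Ω, IsH10 v → bilin u v = ∫ x in Ω, f x * v x

/-- `U` is the finite element solution on `T` with right-hand side `f` and discrete Dirichlet
lift `g`: `U = U₀ + g` with `U₀ ∈ V_h`, and `a(U, v) = (f, v)` for all `v ∈ V_h`. -/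
def IsFEMSolution {Ω : Set Plane} (T : Geometry.SimplicialComplex ℝ Plane) (f : Plane → ℝ)
    (g U : H1 Ω) : Prop :=
  (∃ U₀ : H1 Ω, IsFEFunction0 T U₀ ∧ U = U₀ + g) ∧
    ∀ v : H1 Ω, IsFEFunction0 T v → bilin U v = ∫ x in Ω, f x * v x

/-! ### Clusters -/

/-- The region covered by a set of elements. -/
def region (𝒞 : Set (Finset Plane)) : Set Plane := ⋃ K ∈ 𝒞, tri K

/-- A cluster: a set of elements, at least one of which violates the maximum angle condition,
whose union is simply connected. -/
structure IsCluster (T : Geometry.SimplicialComplex ℝ Plane) (α₀ : ℝ)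
    (𝒞 : Set (Finset Plane)) : Prop where
  subset : 𝒞 ⊆ elements T
  simplyConnected : IsSimplyConnected (region 𝒞)
  exists_bad : ∃ K ∈ 𝒞, K ∈ badElements T α₀

/-- `r_𝒞 = diam 𝒞`. -/
def clusterDiam (𝒞 : Set (Finset Plane)) : ℝ := Metric.diam (region 𝒞)

/-- The cluster condition: every element violating the maximum angle condition belongs to one of
the clusters, `∑ᵢ (diam 𝒞ᵢ)² ≤ C₁ h`, and
`dist (𝒞ᵢ, 𝒞ⱼ) ≥ 2 (diam 𝒞ᵢ + diam 𝒞ⱼ)` for `i ≠ j`. -/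
structure IsClusterFamily (T : Geometry.SimplicialComplex ℝ Plane) (α₀ C₁ : ℝ) {N : ℕ}
    (𝒞 : Fin N → Set (Finset Plane)) : Prop where
  isCluster : ∀ i, IsCluster T α₀ (𝒞 i)
  cover : ∀ K ∈ badElements T α₀, ∃ i, K ∈ 𝒞 i
  sum_le : ∑ i, clusterDiam (𝒞 i) ^ 2 ≤ C₁ * meshSize T
  separated : ∀ i j, i ≠ j → ∀ x ∈ region (𝒞 i), ∀ y ∈ region (𝒞 j),
    2 * (clusterDiam (𝒞 i) + clusterDiam (𝒞 j)) ≤ dist x y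

/-- `g` is admissible discrete Dirichlet data for `u`, up to nodal errors of size at most `ε`:
`g ∈ X_h`; at every boundary vertex `|g - u| ≤ ε`; `g` interpolates `u` at every boundary vertex
whose distance to each cluster is at least twice the diameter of the cluster; and `g = 0` if `u`
has homogeneous boundary values. -/
structure IsBoundaryApprox {Ω : Set Plane} (T : Geometry.SimplicialComplex ℝ Plane) {N : ℕ}
    (𝒞 : Fin N → Set (Finset Plane)) (u : H1 Ω) (ε : ℝ) (g : H1 Ω) : Prop where
  isFEFunction : IsFEFunction T g
  nodal_le : ∀ p ∈ T.vertices, p ∈ frontier Ω → |g p - u p| ≤ ε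
  nodal_eq : ∀ p ∈ T.vertices, p ∈ frontier Ω →
    (∀ i, ∀ x ∈ region (𝒞 i), 2 * clusterDiam (𝒞 i) ≤ dist p x) → g p = u p
  homogeneous : (∀ x ∈ frontier Ω, u x = 0) → ∀ x ∈ closure Ω, g x = 0

end

end ClusterFEM

/-!
By Galerkin orthogonality it suffices to exhibit one finite element function `w` with
`|u - w|₁ ≤ C |u|_{2,∞} h`. Since `Ω` is quasiconvex, `u` is `C^{1,1}` up to the boundary, with
Lipschitz constant of the gradient bounded by `|u|_{2,∞}`. On the ball of radius `2rᵢ` about a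
cluster, `u` is within `O(rᵢ²)` of an affine function, and its gradient within `O(rᵢ)`. Using
cutoffs, `u` is changed into a function `v` that is this affine function on the cluster, agrees with
`u` outside the balls, and still has a Lipschitz gradient with constant `O(|u|_{2,∞})`: the loss of
`rᵢ⁻²` in the second derivatives of the cutoff is compensated by the quality of the approximation.
Take for `w` the nodal interpolant of `v`. On elements satisfying the maximum angle condition the
interpolation error is `O(h)`; elements violating it lie in clusters, where interpolation is exact.
The passage from `u` to `v` costs `∑ rᵢ² · |B(2rᵢ)| = O(∑ rᵢ⁴) = O((∑ rᵢ²)²) = O(h²)` in the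
squared `H¹` seminorm.

If `u = 0` on `∂Ω`, the affine functions must also vanish on `∂Ω` near the cluster, so that
`w ∈ H¹₀(Ω)`. If the boundary near the cluster lies on one line, the Taylor polynomial at a boundary
point does. Otherwise two nonparallel boundary segments at distance `O(rᵢ)` force `∇u = O(rᵢ)`, and
`0` is a good enough approximation.
-/

namespace ClusterFEM

/-! ### Quasiconvexity of Lipschitz domains -/

section PolyPath

variable {E : Type*} [NormedAddCommGroup E] [NormedSpace ℝ E] {S : Set E} {x y z : E} {ℓ ℓ' : ℝ}

/-- `PolyPath S x y ℓ`: there is a polygonal path of length `ℓ` from `x` to `y`, all of whose edges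
lie in `S`. -/
inductive PolyPath (S : Set E) (x : E) : E → ℝ → Prop
  | refl : PolyPath S x x 0
  | step {y z : E} {ℓ : ℝ} : PolyPath S x y ℓ → segment ℝ y z ⊆ S → PolyPath S x z (ℓ + dist y z)

theorem PolyPath.trans (h : PolyPath S x y ℓ) (h' : PolyPath S y z ℓ') :
    PolyPath S x z (ℓ + ℓ') := by
  induction h' with
  | refl => simpa using h
  | step _ hs ih => rw [← add_assoc]; exact ih.step hs

theorem PolyPath.of_segment (h : segment ℝ x y ⊆ S) : PolyPath S x y (dist x y) := by
  simpa using (PolyPath.refl (S := S) (x := x)).step h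

theorem PolyPath.dist_le (h : PolyPath S x y ℓ) : dist x y ≤ ℓ := by
  induction h with
  | refl => simp
  | @step y z ℓ _ _ ih => linarith [dist_triangle x y z]

/-- `S` is quasiconvex with constant `C`: any two of its points are joined within `S` by a polygonal
path at most `C` times longer than the straight segment. -/
def IsQuasiconvex (S : Set E) (C : ℝ) : Prop :=
  ∀ x ∈ S, ∀ y ∈ S, ∃ ℓ ≤ C * dist x y, PolyPath S x y ℓ

/-- `S` is quasiconvex near `x`. Paths are allowed to leave the neighbourhood. -/
def IsQuasiconvexNear (S : Set E) (x : E) : Prop :=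
  ∃ δ > 0, ∃ C : ℝ, ∀ y ∈ S ∩ Metric.ball x δ, ∀ z ∈ S ∩ Metric.ball x δ,
    ∃ ℓ ≤ C * dist y z, PolyPath S y z ℓ

theorem exists_polyPath_of_isPreconnected (hS : IsPreconnected S)
    (hloc : ∀ x ∈ S, IsQuasiconvexNear S x) (hx : x ∈ S) (hy : y ∈ S) :
    ∃ ℓ, PolyPath S x y ℓ := by
  refine hS.induction₂' (fun x y => ∃ ℓ, PolyPath S x y ℓ) (fun x hx => ?_)
    (fun _ _ _ _ _ _ ⟨_, h⟩ ⟨_, h'⟩ => ⟨_, h.trans h'⟩) hx hy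
  obtain ⟨δ, hδ, C, hC⟩ := hloc x hx
  have hx' : x ∈ S ∩ Metric.ball x δ := ⟨hx, Metric.mem_ball_self hδ⟩
  filter_upwards [inter_mem_nhdsWithin S (Metric.ball_mem_nhds x hδ)] with y hy
  obtain ⟨ℓ, -, h⟩ := hC x hx' y hy
  obtain ⟨ℓ', -, h'⟩ := hC y hy x hx'
  exact ⟨⟨ℓ, h⟩, ⟨ℓ', h'⟩⟩

theorem IsQuasiconvexNear.exists_polyPath_length_le (hx : x ∈ closure S)
    (h : IsQuasiconvexNear S x) :
    ∃ δ > 0, ∃ p ∈ S, ∃ D : ℝ, ∀ y ∈ S ∩ Metric.ball x δ,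
      (∃ ℓ ≤ D, PolyPath S y p ℓ) ∧ ∃ ℓ ≤ D, PolyPath S p y ℓ := by
  obtain ⟨δ, hδ, C, hC⟩ := h
  obtain ⟨p, hpS, hp⟩ := Metric.mem_closure_iff.1 hx δ hδ
  have hp' : p ∈ S ∩ Metric.ball x δ := ⟨hpS, by rwa [Metric.mem_ball']⟩
  refine ⟨δ, hδ, p, hpS, |C| * (2 * δ), fun y hy => ?_⟩
  have hyp : dist y p ≤ 2 * δ := by
    linarith [dist_triangle_right y p x, Metric.mem_ball.1 hy.2, Metric.mem_ball.1 hp'.2]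
  have hlen : C * dist y p ≤ |C| * (2 * δ) :=
    mul_le_mul (le_abs_self C) hyp dist_nonneg (abs_nonneg C)
  obtain ⟨ℓ, hℓ, h⟩ := hC y hy p hp'
  obtain ⟨ℓ', hℓ', h'⟩ := hC p hp' y hy
  exact ⟨⟨ℓ, hℓ.trans hlen, h⟩, ⟨ℓ', hℓ'.trans (by rwa [dist_comm]), h'⟩⟩

theorem exists_isQuasiconvex_nhds_prod (hS : IsPreconnected S)
    (hloc : ∀ x ∈ closure S, IsQuasiconvexNear S x) (hx : x ∈ closure S) (hy : y ∈ closure S) :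
    ∃ t ∈ 𝓝 (x, y), ∃ C : ℝ, ∀ p ∈ t ∩ S ×ˢ S, ∃ ℓ ≤ C * dist p.1 p.2, PolyPath S p.1 p.2 ℓ := by
  rcases eq_or_ne x y with rfl | hxy
  · obtain ⟨δ, hδ, C, hC⟩ := hloc x hx
    exact ⟨_, prod_mem_nhds (Metric.ball_mem_nhds x hδ) (Metric.ball_mem_nhds x hδ), C,
      fun p hp => hC p.1 ⟨hp.2.1, hp.1.1⟩ p.2 ⟨hp.2.2, hp.1.2⟩⟩
  · have hd : 0 < dist x y / 3 := div_pos (dist_pos.2 hxy) three_pos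
    obtain ⟨δ, hδ, p, hp, D, hD⟩ := (hloc x hx).exists_polyPath_length_le hx
    obtain ⟨δ', hδ', q, hq, D', hD'⟩ := (hloc y hy).exists_polyPath_length_le hy
    obtain ⟨ℓ, hℓ⟩ := exists_polyPath_of_isPreconnected hS
      (fun x hx => hloc x (subset_closure hx)) hp hq
    refine ⟨_, prod_mem_nhds (Metric.ball_mem_nhds x (lt_min hδ hd))
      (Metric.ball_mem_nhds y (lt_min hδ' hd)), |D + ℓ + D'| / (dist x y / 3), ?_⟩
    rintro ⟨v, w⟩ ⟨⟨hv, hw⟩, hvS, hwS⟩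
    rw [Metric.mem_ball, lt_min_iff] at hv hw
    obtain ⟨ℓ₁, hℓ₁, h₁⟩ := (hD v ⟨hvS, hv.1⟩).1
    obtain ⟨ℓ₂, hℓ₂, h₂⟩ := (hD' w ⟨hwS, hw.1⟩).2
    refine ⟨_, ?_, (h₁.trans hℓ).trans h₂⟩
    have hvw : dist x y / 3 ≤ dist v w := by
      linarith [dist_triangle_left x y v, dist_triangle v w y]
    calc ℓ₁ + ℓ + ℓ₂ ≤ |D + ℓ + D'| := le_trans (by linarith) (le_abs_self _)
      _ = |D + ℓ + D'| / (dist x y / 3) * (dist x y / 3) := (div_mul_cancel₀ _ hd.ne').symm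
      _ ≤ |D + ℓ + D'| / (dist x y / 3) * dist v w := by gcongr

theorem exists_isQuasiconvex (hcpt : IsCompact (closure S)) (hS : IsPreconnected S)
    (hloc : ∀ x ∈ closure S, IsQuasiconvexNear S x) : ∃ C, 0 ≤ C ∧ IsQuasiconvex S C := by
  obtain ⟨C, hC0, hC⟩ : ∃ C : ℝ, 0 ≤ C ∧ ∀ p ∈ closure S ×ˢ closure S ∩ S ×ˢ S,
      ∃ ℓ ≤ C * dist p.1 p.2, PolyPath S p.1 p.2 ℓ := by
    refine (hcpt.prod hcpt).induction_on
      (p := fun t => ∃ C : ℝ, 0 ≤ C ∧ ∀ p ∈ t ∩ S ×ˢ S,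
        ∃ ℓ ≤ C * dist p.1 p.2, PolyPath S p.1 p.2 ℓ) ⟨0, le_rfl, by simp⟩
      (fun s t hst ⟨C, hC0, hC⟩ => ⟨C, hC0, fun p hp => hC p ⟨hst hp.1, hp.2⟩⟩)
      (fun s t ⟨C, hC0, hC⟩ ⟨C', _, hC'⟩ => ?_) fun p hp => ?_
    · refine ⟨max C C', le_max_of_le_left hC0, fun p hp => ?_⟩
      rcases hp.1 with hs | ht
      · obtain ⟨ℓ, hℓ, h⟩ := hC p ⟨hs, hp.2⟩
        exact ⟨ℓ, hℓ.trans (by gcongr; exact le_max_left _ _), h⟩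
      · obtain ⟨ℓ, hℓ, h⟩ := hC' p ⟨ht, hp.2⟩
        exact ⟨ℓ, hℓ.trans (by gcongr; exact le_max_right _ _), h⟩
    · obtain ⟨t, ht, C, hC⟩ := exists_isQuasiconvex_nhds_prod hS hloc hp.1 hp.2
      refine ⟨t, mem_nhdsWithin_of_mem_nhds ht, |C|, abs_nonneg C, fun q hq => ?_⟩
      obtain ⟨ℓ, hℓ, h⟩ := hC q hq
      exact ⟨ℓ, hℓ.trans (by gcongr; exact le_abs_self C), h⟩
  exact ⟨C, hC0, fun x hx y hy =>
    hC (x, y) ⟨⟨subset_closure hx, subset_closure hy⟩, hx, hy⟩⟩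

end PolyPath

section HeightFunction

variable {E : Type*} [NormedAddCommGroup E] [NormedSpace ℝ E] {S : Set E} {x y z n : E}
  {Γ : E → ℝ} {L s ρ : ℝ}

/-- `Γ` measures the height above a Lipschitz graph, with `n` as the upward unit vector: in
coordinates with `n` vertical, `Γ (x, t) = t - γ x`, and `convexComb` is all that is used of the
Lipschitz bound `L` for `γ`. -/
structure IsHeightFunction (Γ : E → ℝ) (n : E) (L : ℝ) : Prop where
  continuous : Continuous Γ
  norm_eq_one : ‖n‖ = 1
  nonneg : 0 ≤ L
  add_smul : ∀ x s, Γ (x + s • n) = Γ x + s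
  convexComb : ∀ x y : E, ∀ a b : ℝ, 0 ≤ a → 0 ≤ b → a + b = 1 →
    a * Γ x + b * Γ y ≤ Γ (a • x + b • y) + L * dist x y

theorem IsHeightFunction.segment_up_subset (hΓ : IsHeightFunction Γ n L) (hs : 0 ≤ s)
    (hx : 0 < Γ x) : segment ℝ x (x + s • n) ⊆ {y | 0 < Γ y} := by
  rw [segment_eq_image']
  rintro _ ⟨t, ht, rfl⟩
  simp only [add_sub_cancel_left, smul_smul, mem_ofPred_eq, hΓ.add_smul]
  linarith [mul_nonneg ht.1 hs]

theorem IsHeightFunction.segment_across_subset (hΓ : IsHeightFunction Γ n L) (hx : 0 < Γ x)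
    (hy : 0 < Γ y) :
    segment ℝ (x + (L * dist x y) • n) (y + (L * dist x y) • n) ⊆ {z | 0 < Γ z} := by
  rintro _ ⟨a, b, ha, hb, hab, rfl⟩
  set s := L * dist x y
  have hsplit : a • (x + s • n) + b • (y + s • n) = (a • x + b • y) + s • n := by
    calc a • (x + s • n) + b • (y + s • n) = (a • x + b • y) + (a + b) • s • n := by module
      _ = _ := by rw [hab, one_smul]
  have hpos : 0 < a * Γ x + b * Γ y := by
    rcases ha.eq_or_lt with rfl | ha'
    · rw [zero_add] at hab; simpa [hab] using hy
    · linarith [mul_pos ha' hx, mul_nonneg hb hy.le]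
  rw [hsplit, mem_ofPred_eq, hΓ.add_smul]
  linarith [hΓ.convexComb x y a b ha hb hab]

theorem IsHeightFunction.mem_of_mem_interior_closure (hΓ : IsHeightFunction Γ n L) (hρ : 0 < ρ)
    (hS : ∀ y ∈ Metric.ball x ρ, y ∈ S ↔ 0 < Γ y) (hx : x ∈ interior (closure S)) : x ∈ S := by
  by_contra hxS
  have hx0 : Γ x ≤ 0 := not_lt.1 fun h => hxS ((hS x (Metric.mem_ball_self hρ)).2 h)
  have hlim : Tendsto (fun t : ℝ => x + (-t) • n) (𝓝[>] 0) (𝓝 x) := by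
    have : Continuous fun t : ℝ => x + (-t) • n := by fun_prop
    simpa using (this.tendsto 0).mono_left nhdsWithin_le_nhds
  have hev := hlim.eventually
    (inter_mem (mem_interior_iff_mem_nhds.1 hx) (Metric.ball_mem_nhds x hρ))
  obtain ⟨t, ⟨htS, htρ⟩, ht0 : 0 < t⟩ := (hev.and self_mem_nhdsWithin).exists
  have hbelow : Γ (x + (-t) • n) < 0 := by rw [hΓ.add_smul]; linarith
  obtain ⟨z, ⟨hz, hzρ⟩, hzS⟩ := mem_closure_iff.1 htS _
    ((isOpen_lt hΓ.continuous continuous_const).inter Metric.isOpen_ball) ⟨hbelow, htρ⟩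
  exact lt_asymm hz ((hS z hzρ).1 hzS)

/-- The path goes up, across and down; rising by `L * dist y z` clears the graph between `y` and
`z`. -/
theorem IsHeightFunction.isQuasiconvexNear (hΓ : IsHeightFunction Γ n L) (hρ : 0 < ρ)
    (hS : ∀ y ∈ Metric.ball x ρ, y ∈ S ↔ 0 < Γ y) : IsQuasiconvexNear S x := by
  have hL := hΓ.nonneg
  set δ := ρ / (1 + 2 * L)
  have hδ : 0 < δ := by positivity
  have hδρ : δ + 2 * L * δ = ρ := by simp only [δ]; field_simp
  refine ⟨δ, hδ, 2 * L + 1, fun y hy z hz => ?_⟩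
  have hball : Metric.ball x δ ⊆ Metric.ball x ρ :=
    Metric.ball_subset_ball (by linarith [mul_nonneg hL hδ.le])
  have hpos : ∀ w ∈ S ∩ Metric.ball x δ, 0 < Γ w := fun w hw => (hS w (hball hw.2)).1 hw.1
  set s := L * dist y z
  have hs : 0 ≤ s := mul_nonneg hL dist_nonneg
  have hsδ : s ≤ 2 * L * δ := by
    have hyz : dist y z ≤ 2 * δ := by
      linarith [dist_triangle_right y z x, Metric.mem_ball.1 hy.2, Metric.mem_ball.1 hz.2]
    linarith [mul_le_mul_of_nonneg_left hyz hL]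
  have hrise : ∀ w : E, dist w (w + s • n) = s := fun w => by
    rw [dist_self_add_right, norm_smul, hΓ.norm_eq_one, mul_one, Real.norm_of_nonneg hs]
  have hup : ∀ w ∈ Metric.ball x δ, w + s • n ∈ Metric.ball x ρ := fun w hw => by
    have hw : dist w x < δ := hw
    rw [Metric.mem_ball]
    linarith [dist_triangle_left (w + s • n) x w, hrise w]
  have hseg : ∀ v ∈ Metric.ball x ρ, ∀ w ∈ Metric.ball x ρ,
      segment ℝ v w ⊆ {p | 0 < Γ p} → segment ℝ v w ⊆ S := fun v hv w hw h p hp =>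
    (hS p ((convex_ball x ρ).segment_subset hv hw hp)).2 (h hp)
  have hvert : ∀ w ∈ S ∩ Metric.ball x δ, segment ℝ w (w + s • n) ⊆ S := fun w hw =>
    hseg w (hball hw.2) _ (hup w hw.2) (hΓ.segment_up_subset hs (hpos w hw))
  have hacross : segment ℝ (y + s • n) (z + s • n) ⊆ S := hseg _ (hup y hy.2) _ (hup z hz.2)
    (hΓ.segment_across_subset (hpos y hy) (hpos z hz))
  refine ⟨_, ?_, ((PolyPath.of_segment (hvert y hy)).trans (.of_segment hacross)).trans
    (.of_segment (segment_symm ℝ z (z + s • n) ▸ hvert z hz))⟩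
  rw [hrise, dist_add_right, dist_comm (z + s • n), hrise]
  linarith

end HeightFunction

theorem HasLipschitzBoundary.exists_isHeightFunction {Ω : Set Plane} (hΩ : HasLipschitzBoundary Ω)
    {x : Plane} (hx : x ∈ frontier Ω) :
    ∃ (Γ : Plane → ℝ) (n : Plane) (L ρ : ℝ), 0 < ρ ∧ IsHeightFunction Γ n L ∧
      ∀ y ∈ Metric.ball x ρ, y ∈ Ω ↔ 0 < Γ y := by
  obtain ⟨R, γ, L, ρ, hρ, hγ, h⟩ := hΩ x hx
  have hcont (i : Fin 2) : Continuous fun y => R y i :=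
    (EuclideanSpace.proj (𝕜 := ℝ) i).continuous.comp R.continuous
  have hcoord (y z : Plane) : |R y 0 - R z 0| ≤ dist y z := by
    simpa [dist_eq_norm, ← R.norm_map (y - z)] using PiLp.norm_apply_le (R y - R z) 0
  have hγ' (y z : Plane) : γ (R y 0) ≤ γ (R z 0) + L * dist y z := by
    have hyz := mul_le_mul_of_nonneg_left (hcoord y z) L.coe_nonneg
    have := hγ.dist_le_mul (R y 0) (R z 0)
    rw [Real.dist_eq, Real.dist_eq] at this
    linarith [le_abs_self (γ (R y 0) - γ (R z 0))]
  refine ⟨fun y => R y 1 - γ (R y 0), R.symm (EuclideanSpace.single 1 1), L, ρ, hρ,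
    ⟨(hcont 1).sub (hγ.continuous.comp (hcont 0)), by simp, L.coe_nonneg,
      fun y s => by simp [add_sub_right_comm], fun y z a b ha hb hab => ?_⟩,
    fun y hy => by rw [h y hy, sub_pos]⟩
  set p := a • y + b • z with hp
  have hpyz : dist y p + dist p z = dist y z :=
    dist_add_dist_of_mem_segment ⟨a, b, ha, hb, hab, rfl⟩
  have hpy : γ (R p 0) ≤ γ (R y 0) + L * dist y z := (hγ' p y).trans <| by
    gcongr; linarith [dist_comm p y, dist_nonneg (x := p) (y := z)]
  have hpz : γ (R p 0) ≤ γ (R z 0) + L * dist y z := (hγ' p z).trans <| by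
    gcongr; linarith [dist_nonneg (x := y) (y := p)]
  have hp1 : R p 1 = a * R y 1 + b * R z 1 := by simp [hp]
  have hcomb := add_le_add (mul_le_mul_of_nonneg_left hpy ha) (mul_le_mul_of_nonneg_left hpz hb)
  linear_combination hcomb + (L * dist y z - γ (R p 0)) * hab - hp1

theorem interior_closure_subset {Ω : Set Plane} (hΩ : HasLipschitzBoundary Ω) :
    interior (closure Ω) ⊆ Ω := by
  intro x hx
  by_contra hxΩ
  have hfr : x ∈ frontier Ω := ⟨interior_subset hx, fun h => hxΩ (interior_subset h)⟩
  obtain ⟨Γ, n, L, ρ, hρ, hΓ, h⟩ := hΩ.exists_isHeightFunction hfr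
  exact hxΩ (hΓ.mem_of_mem_interior_closure hρ h hx)

theorem IsPolygonalDomain.exists_isQuasiconvex {Ω : Set Plane} (hΩ : IsPolygonalDomain Ω) :
    ∃ C, 0 ≤ C ∧ IsQuasiconvex Ω C := by
  refine ClusterFEM.exists_isQuasiconvex hΩ.isBounded.isCompact_closure
    hΩ.isConnected.isPreconnected fun x hx => ?_
  by_cases hxΩ : x ∈ Ω
  · obtain ⟨δ, hδ, hsub⟩ := Metric.isOpen_iff.1 hΩ.isOpen x hxΩ
    exact ⟨δ, hδ, 1, fun y hy z hz => ⟨dist y z, by simp,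
      .of_segment (((convex_ball x δ).segment_subset hy.2 hz.2).trans hsub)⟩⟩
  · have hfr : x ∈ frontier Ω := hΩ.isOpen.frontier_eq ▸ ⟨hx, hxΩ⟩
    obtain ⟨Γ, n, L, ρ, hρ, hΓ, h⟩ := hΩ.lipschitz.exists_isHeightFunction hfr
    exact hΓ.isQuasiconvexNear hρ h

/-! ### Mollification -/

/-- Bump functions shrinking to the origin. -/
noncomputable def bumpSeq (E : Type*) [NormedAddCommGroup E] (n : ℕ) : ContDiffBump (0 : E) where
  rIn := 1 / ((n : ℝ) + 1)
  rOut := 2 / ((n : ℝ) + 1)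
  rIn_pos := by positivity
  rIn_lt_rOut := by gcongr; norm_num

theorem tendsto_bumpSeq_rOut {E : Type*} [NormedAddCommGroup E] :
    Tendsto (fun n => (bumpSeq E n).rOut) atTop (𝓝 0) := by
  simpa [bumpSeq, div_eq_mul_inv] using
    (tendsto_one_div_add_atTop_nhds_zero_nat (𝕜 := ℝ)).const_mul 2

theorem eventually_closedBall_rOut_subset {E : Type*} [NormedAddCommGroup E] {U S : Set E}
    (hU : IsOpen U) (hS : IsCompact S) (hSU : S ⊆ U) :
    ∀ᶠ n in atTop, ∀ x ∈ S, Metric.closedBall x (bumpSeq E n).rOut ⊆ U := by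
  obtain ⟨δ, hδ, hsub⟩ := hS.exists_cthickening_subset_open hU hSU
  filter_upwards [(tendsto_bumpSeq_rOut (E := E)).eventually_lt_const hδ] with n hn x hx
  exact ((Metric.closedBall_subset_closedBall hn.le).trans
    (Metric.closedBall_subset_cthickening hx δ)).trans hsub

section Mollify

variable {E : Type*} [NormedAddCommGroup E] [InnerProductSpace ℝ E] [FiniteDimensional ℝ E]
  [MeasurableSpace E] [BorelSpace E] {F : Type*} [NormedAddCommGroup F] [NormedSpace ℝ F]

/-- The standard mollifier `φₙ`, supported in the ball of radius `2 / (n + 1)`. -/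
noncomputable def mollifier (n : ℕ) : E → ℝ := (bumpSeq E n).normed volume

/-- The mollification `φₙ ⋆ w`. -/
noncomputable def mollify (n : ℕ) (w : E → F) : E → F :=
  convolution (mollifier n) w (ContinuousLinearMap.lsmul ℝ ℝ) volume

theorem mollify_apply (n : ℕ) (w : E → F) (x : E) :
    mollify n w x = ∫ z, mollifier n (x - z) • w z := by
  simp [mollify, convolution_eq_swap]

theorem integrable_mollifier (n : ℕ) : Integrable (mollifier n : E → ℝ) :=
  (bumpSeq E n).integrable_normed

theorem contDiff_mollifier (n : ℕ) : ContDiff ℝ ∞ (mollifier n : E → ℝ) :=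
  (bumpSeq E n).contDiff_normed

theorem hasCompactSupport_mollifier (n : ℕ) : HasCompactSupport (mollifier n : E → ℝ) :=
  (bumpSeq E n).hasCompactSupport_normed

theorem support_mollify_subset (n : ℕ) (w : E → F) :
    Function.support (mollify n w) ⊆ Metric.cthickening (bumpSeq E n).rOut (tsupport w) := by
  intro x hx
  obtain ⟨z, hz⟩ : ∃ z, mollifier n (x - z) • w z ≠ 0 := by
    by_contra! h
    exact hx (by simp [mollify_apply, h])
  have hxz : x - z ∈ Function.support (mollifier n) := left_ne_zero_of_smul hz
  rw [mollifier, (bumpSeq E n).support_normed_eq, mem_ball_zero_iff, ← dist_eq_norm] at hxz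
  exact Metric.mem_cthickening_of_dist_le x z _ _ (subset_tsupport w (right_ne_zero_of_smul hz))
    hxz.le

theorem norm_mollify_le (n : ℕ) {w : E → F} {M : ℝ} (hM : ∀ᵐ z, ‖w z‖ ≤ M) (x : E) :
    ‖mollify n w x‖ ≤ M := by
  have hnonneg : ∀ z, 0 ≤ (mollifier n : E → ℝ) (x - z) := fun z => (bumpSeq E n).nonneg_normed _
  calc ‖mollify n w x‖ = ‖∫ z, mollifier n (x - z) • w z‖ := by rw [mollify_apply]
    _ ≤ ∫ z, mollifier n (x - z) * M := by
      refine norm_integral_le_of_norm_le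
        (((integrable_mollifier n).comp_sub_left x).mul_const M) ?_
      filter_upwards [hM] with z hz
      rw [norm_smul, Real.norm_of_nonneg (hnonneg z)]
      exact mul_le_mul_of_nonneg_left hz (hnonneg z)
    _ = M := by
      rw [integral_mul_const, integral_sub_left_eq_self (mollifier n) volume x, mollifier,
        (bumpSeq E n).integral_normed, one_mul]

theorem ae_tendsto_mollify [CompleteSpace F] {w : E → F} (hw : LocallyIntegrable w) :
    ∀ᵐ x, Tendsto (fun n => mollify n w x) atTop (𝓝 (w x)) := by
  refine ContDiffBump.ae_convolution_tendsto_right_of_locallyIntegrable (K := 2)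
    tendsto_bumpSeq_rOut (Eventually.of_forall fun n => le_of_eq ?_) hw
  simp only [bumpSeq]
  ring

theorem tendsto_mollify_of_continuousAt [CompleteSpace F] {w : E → F}
    (hw : AEStronglyMeasurable w) {x : E} (hx : ContinuousAt w x) :
    Tendsto (fun n => mollify n w x) atTop (𝓝 (w x)) :=
  ContDiffBump.convolution_tendsto_right tendsto_bumpSeq_rOut (Eventually.of_forall fun _ => hw)
    (hx.tendsto.comp tendsto_snd) tendsto_const_nhds

theorem contDiff_mollify (n : ℕ) {w : E → F} (hw : LocallyIntegrable w) :
    ContDiff ℝ ∞ (mollify n w) :=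
  (hasCompactSupport_mollifier n).contDiff_convolution_left _ (contDiff_mollifier n) hw

theorem mollify_apply_comp [CompleteSpace F] (n : ℕ) {F' : Type*} [NormedAddCommGroup F']
    [NormedSpace ℝ F'] [CompleteSpace F'] (T : F →L[ℝ] F') {w : E → F} (hw : LocallyIntegrable w)
    (x : E) : mollify n (fun z => T (w z)) x = T (mollify n w x) := by
  have hint : Integrable fun z => mollifier n (x - z) • w z := by
    have := ((hasCompactSupport_mollifier n).convolutionExists_left
      (ContinuousLinearMap.lsmul ℝ ℝ : ℝ →L[ℝ] F →L[ℝ] F) (contDiff_mollifier n).continuous hw) x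
    simpa using this.integrable.comp_sub_left x
  simpa [mollify_apply] using T.integral_comp_comm hint

theorem gradient_mollifier_sub (n : ℕ) (x z : E) :
    gradient (fun z => mollifier n (x - z)) z = -gradient (mollifier n) (x - z) := by
  have hφ : HasFDerivAt (mollifier n : E → ℝ) (fderiv ℝ (mollifier n) (x - z)) (x - z) :=
    ((contDiff_mollifier (E := E) n).differentiable (by simp) (x - z)).hasFDerivAt
  have hsub : HasFDerivAt (fun z => x - z) (-ContinuousLinearMap.id ℝ E) z := by
    simpa using (hasFDerivAt_id z).const_sub x
  have hcomp : fderiv ℝ (fun z => mollifier n (x - z)) z = -fderiv ℝ (mollifier n) (x - z) := by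
    rw [show (fun z => mollifier n (x - z)) = mollifier n ∘ (x - ·) from rfl,
      (hφ.comp z hsub).fderiv]
    simp
  simp only [gradient, hcomp, map_neg]

theorem hasGradientAt_mollify (n : ℕ) {w : E → ℝ} (hw : LocallyIntegrable w) (x : E) :
    HasGradientAt (mollify n w) (∫ z, w z • gradient (mollifier n) (x - z)) x := by
  set L := ContinuousLinearMap.precompL E (ContinuousLinearMap.lsmul ℝ ℝ : ℝ →L[ℝ] ℝ →L[ℝ] ℝ)
  have hφ : ContDiff ℝ 1 (mollifier n : E → ℝ) := (contDiff_mollifier n).of_le (by simp)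
  have hcont : Continuous (fderiv ℝ (mollifier n : E → ℝ)) := hφ.continuous_fderiv (by simp)
  have hcs : HasCompactSupport (fderiv ℝ (mollifier n : E → ℝ)) :=
    (hasCompactSupport_mollifier n).fderiv (𝕜 := ℝ)
  have hconv : Integrable fun z => L (fderiv ℝ (mollifier n) (x - z)) (w z) := by
    simpa using ((hcs.convolutionExists_left L hcont hw) x).integrable.comp_sub_left x
  have hint : Integrable fun z => w z • gradient (mollifier n) (x - z) :=
    hw.integrable_smul_right_of_hasCompactSupport
      (((InnerProductSpace.toDual ℝ E).symm.continuous.comp hcont).comp (continuous_sub_left x))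
      ((hcs.comp_left (map_zero (InnerProductSpace.toDual ℝ E).symm)).comp_homeomorph
        (Homeomorph.subLeft x))
  have hfderiv := (hasCompactSupport_mollifier n).hasFDerivAt_convolution_left
    (ContinuousLinearMap.lsmul ℝ ℝ) hφ hw x
  rw [hasGradientAt_iff_hasFDerivAt]
  refine hfderiv.congr_fderiv ?_
  ext v
  rw [convolution_eq_swap, ContinuousLinearMap.integral_apply hconv,
    InnerProductSpace.toDual_apply_apply, real_inner_comm, ← integral_inner hint]
  congr 1 with z
  rw [inner_smul_right, gradient, real_inner_comm, InnerProductSpace.toDual_symm_apply]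
  simp [L, mul_comm]

end Mollify

theorem isTestFunction_mollifier_sub {Ω : Set Plane} (n : ℕ) {x : Plane}
    (hx : Metric.closedBall x (bumpSeq Plane n).rOut ⊆ Ω) :
    IsTestFunction Ω (fun z => mollifier n (x - z)) := by
  have hsupp : tsupport (fun z => mollifier n (x - z)) ⊆
      Metric.closedBall x (bumpSeq Plane n).rOut := by
    refine closure_minimal (fun z hz => ?_) Metric.isClosed_closedBall
    have hz : x - z ∈ Function.support ((bumpSeq Plane n).normed volume) := hz
    rw [(bumpSeq Plane n).support_normed_eq, mem_ball_zero_iff, ← dist_eq_norm, dist_comm] at hz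
    exact hz.le
  exact ⟨(contDiff_mollifier n).comp (contDiff_const.sub contDiff_id),
    .of_support_subset_isCompact (isCompact_closedBall x _) ((subset_tsupport _).trans hsupp),
    hsupp.trans hx⟩

theorem IsWeakGradient.hasGradientAt_mollify {Ω : Set Plane} (ho : IsOpen Ω) {w : Plane → ℝ}
    {H : Plane → Plane} (hw : IsWeakGradient Ω w H) (hint : IntegrableOn w Ω) (n : ℕ) {x : Plane}
    (hx : Metric.closedBall x (bumpSeq Plane n).rOut ⊆ Ω) :
    HasGradientAt (mollify n (Ω.indicator w)) (mollify n (Ω.indicator H) x) x := by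
  have hφ := isTestFunction_mollifier_sub n hx
  convert ClusterFEM.hasGradientAt_mollify n
    ((integrable_indicator_iff ho.measurableSet).2 hint).locallyIntegrable x using 1
  calc mollify n (Ω.indicator H) x = ∫ z in Ω, mollifier n (x - z) • H z := by
        rw [mollify_apply, ← integral_indicator ho.measurableSet]
        simp only [indicator_smul]
    _ = -∫ z in Ω, w z • gradient (fun z => mollifier n (x - z)) z := by
        rw [hw.integral_eq _ hφ, neg_neg]
    _ = ∫ z in Ω, w z • gradient (mollifier n) (x - z) := by
        simp only [gradient_mollifier_sub, smul_neg, integral_neg, neg_neg]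
    _ = ∫ z, Ω.indicator w z • gradient (mollifier n) (x - z) := by
        rw [← integral_indicator ho.measurableSet]
        simp only [indicator_smul_left]

/-! ### `W^{2,∞}` functions as Whitney jets -/

section Jet

variable {E : Type*} [NormedAddCommGroup E] [InnerProductSpace ℝ E] {S : Set E} {f : E → ℝ}
  {G : E → E} {L M : ℝ} {x y : E}

/-- `(f, G)` is a first-order Whitney jet on `S` with constant `L`: the function `f` behaves as if
it had the `L`-Lipschitz gradient `G`. -/
structure IsJet (S : Set E) (f : E → ℝ) (G : E → E) (L : ℝ) : Prop where
  taylor : ∀ x ∈ S, ∀ y ∈ S, |f y - f x - inner ℝ (G x) (y - x)| ≤ L * dist x y ^ 2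
  lipschitz : ∀ x ∈ S, ∀ y ∈ S, ‖G y - G x‖ ≤ L * dist x y

theorem abs_sub_sub_inner_le_of_hasGradientAt [CompleteSpace E] {p : E}
    (hf : ∀ z ∈ segment ℝ x y, HasGradientAt f (G z) z)
    (hG : ∀ z ∈ segment ℝ x y, ‖G z - p‖ ≤ M) :
    |f y - f x - inner ℝ p (y - x)| ≤ M * dist x y := by
  have h := Convex.norm_image_sub_le_of_norm_hasFDerivWithin_le' (𝕜 := ℝ) (f := f)
    (φ := InnerProductSpace.toDual ℝ E p)
    (fun z hz => (hasGradientAt_iff_hasFDerivAt.1 (hf z hz)).hasFDerivWithinAt)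
    (fun z hz => by rw [← map_sub, LinearIsometryEquiv.norm_map]; exact hG z hz)
    (convex_segment x y) (left_mem_segment ℝ x y) (right_mem_segment ℝ x y)
  rwa [Real.norm_eq_abs, InnerProductSpace.toDual_apply_apply, ← dist_eq_norm y x,
    dist_comm] at h

theorem isJet_of_hasGradientAt [CompleteSpace E] (hS : Convex ℝ S) (hL : 0 ≤ L)
    (hf : ∀ x ∈ S, HasGradientAt f (G x) x)
    (hG : ∀ x ∈ S, ∀ y ∈ S, ‖G y - G x‖ ≤ L * dist x y) : IsJet S f G L := by
  refine ⟨fun x hx y hy => ?_, hG⟩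
  have hseg := hS.segment_subset hx hy
  rw [sq, ← mul_assoc]
  refine abs_sub_sub_inner_le_of_hasGradientAt (fun z hz => hf z (hseg hz)) fun z hz => ?_
  refine (hG x hx z (hseg hz)).trans ?_
  gcongr
  linarith [dist_add_dist_of_mem_segment hz, dist_nonneg (x := z) (y := y)]

theorem IsJet.of_tendsto {f' : ℕ → E → ℝ} {G' : ℕ → E → E}
    (h : ∀ᶠ n in atTop, IsJet S (f' n) (G' n) L)
    (hf : ∀ x ∈ S, Tendsto (fun n => f' n x) atTop (𝓝 (f x)))
    (hG : ∀ x ∈ S, Tendsto (fun n => G' n x) atTop (𝓝 (G x))) : IsJet S f G L where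
  taylor x hx y hy := le_of_tendsto
    (((hf y hy).sub (hf x hx)).sub ((hG x hx).inner tendsto_const_nhds)).abs
    (h.mono fun _ h => h.taylor x hx y hy)
  lipschitz x hx y hy := le_of_tendsto ((hG y hy).sub (hG x hx)).norm
    (h.mono fun _ h => h.lipschitz x hx y hy)

theorem IsJet.congr_grad {G' : E → E} (h : IsJet S f G L) (hG : EqOn G G' S) : IsJet S f G' L where
  taylor x hx y hy := by rw [← hG hx]; exact h.taylor x hx y hy
  lipschitz x hx y hy := by rw [← hG hx, ← hG hy]; exact h.lipschitz x hx y hy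

theorem IsJet.extend_closure (h : IsJet S f G L) (hf : ContinuousOn f (closure S))
    (hG : Continuous G) : IsJet (closure S) f G L := by
  have hprod : closure (S ×ˢ S) = closure S ×ˢ closure S := closure_prod_eq
  have hf₁ : ContinuousOn (fun p : E × E => f p.1) (closure (S ×ˢ S)) :=
    hprod ▸ hf.comp continuous_fst.continuousOn fun p hp => hp.1
  have hf₂ : ContinuousOn (fun p : E × E => f p.2) (closure (S ×ˢ S)) :=
    hprod ▸ hf.comp continuous_snd.continuousOn fun p hp => hp.2
  constructor <;> intro x hx y hy <;>
    have hxy : (x, y) ∈ closure (S ×ˢ S) := hprod ▸ ⟨hx, hy⟩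
  · exact le_on_closure (f := fun p : E × E => |f p.2 - f p.1 - inner ℝ (G p.1) (p.2 - p.1)|)
      (g := fun p : E × E => L * dist p.1 p.2 ^ 2)
      (fun p hp => h.taylor p.1 hp.1 p.2 hp.2) ((hf₂.sub hf₁).sub (by fun_prop)).abs
      (by fun_prop) hxy
  · exact le_on_closure (f := fun p : E × E => ‖G p.2 - G p.1‖)
      (g := fun p : E × E => L * dist p.1 p.2)
      (fun p hp => h.lipschitz p.1 hp.1 p.2 hp.2) (by fun_prop) (by fun_prop)
      hxy

theorem PolyPath.isJet_estimates {ℓ : ℝ} (h : PolyPath S x y ℓ) (hL : 0 ≤ L)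
    (hseg : ∀ a b, segment ℝ a b ⊆ S → IsJet (segment ℝ a b) f G L) :
    ‖G y - G x‖ ≤ L * ℓ ∧ |f y - f x - inner ℝ (G x) (y - x)| ≤ L * ℓ ^ 2 := by
  induction h with
  | refl => simp
  | @step y z ℓ hp hs ih =>
    have hyz := hseg y z hs
    have hy := left_mem_segment ℝ y z
    have hz := right_mem_segment ℝ y z
    have hℓ : 0 ≤ ℓ := dist_nonneg.trans hp.dist_le
    constructor
    · linarith [norm_sub_le_norm_sub_add_norm_sub (G z) (G y) (G x), hyz.lipschitz y hy z hz, ih.1]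
    · have hsplit : f z - f x - inner ℝ (G x) (z - x) = (f z - f y - inner ℝ (G y) (z - y)) +
          (f y - f x - inner ℝ (G x) (y - x)) + inner ℝ (G y - G x) (z - y) := by
        rw [← sub_add_sub_cancel z y x, inner_add_right, inner_sub_left]; ring
      have hcross : |inner ℝ (G y - G x) (z - y)| ≤ L * ℓ * dist y z := by
        refine (abs_real_inner_le_norm _ _).trans ?_
        rw [← dist_eq_norm z y, dist_comm z y]
        exact mul_le_mul_of_nonneg_right ih.1 dist_nonneg
      have hnonneg : 0 ≤ L * ℓ * dist y z := by positivity
      rw [hsplit]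
      linarith [abs_add_three (f z - f y - inner ℝ (G y) (z - y))
        (f y - f x - inner ℝ (G x) (y - x)) (inner ℝ (G y - G x) (z - y)),
        hyz.taylor y hy z hz, ih.2]

theorem IsQuasiconvex.isJet {C : ℝ} (hS : IsQuasiconvex S C) (hL : 0 ≤ L)
    (hseg : ∀ a b, segment ℝ a b ⊆ S → IsJet (segment ℝ a b) f G L) :
    IsJet S f G ((|C| + C ^ 2) * L) := by
  constructor <;> intro x hx y hy <;> obtain ⟨ℓ, hℓ, h⟩ := hS x hx y hy
  · have hℓ₀ : 0 ≤ ℓ := dist_nonneg.trans h.dist_le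
    calc _ ≤ L * ℓ ^ 2 := (h.isJet_estimates hL hseg).2
      _ ≤ L * (C * dist x y) ^ 2 := by gcongr
      _ = C ^ 2 * L * dist x y ^ 2 := by ring
      _ ≤ _ := by gcongr; linarith [abs_nonneg C]
  · calc _ ≤ L * ℓ := (h.isJet_estimates hL hseg).1
      _ ≤ L * (|C| * dist x y) := by gcongr; exact hℓ.trans (by gcongr; exact le_abs_self C)
      _ = |C| * L * dist x y := by ring
      _ ≤ _ := by gcongr; linarith [sq_nonneg C]

end Jet

theorem exists_tendsto_of_eventually_dist_le {X F : Type*} [PseudoMetricSpace X]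
    [PseudoMetricSpace F] [CompleteSpace F] {g : ℕ → X → F} {D U : Set X} {K : ℝ} {x : X}
    (hU : U ∈ 𝓝 x) (hg : ∀ y ∈ U, ∀ᶠ n in atTop, dist (g n x) (g n y) ≤ K * dist x y)
    (hD : Dense D) (hcauchy : ∀ y ∈ D, CauchySeq fun n => g n y) :
    ∃ l, Tendsto (fun n => g n x) atTop (𝓝 l) := by
  refine cauchySeq_tendsto_of_complete (Metric.cauchySeq_iff.2 fun ε hε => ?_)
  have hnear : ∀ᶠ y in 𝓝 x, K * dist x y < ε / 3 := by
    have : Continuous fun y => K * dist x y := by fun_prop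
    exact (this.tendsto x).eventually_lt_const (by simpa using by positivity)
  obtain ⟨y, hyD, hy, hyU⟩ := hD.inter_nhds_nonempty (inter_mem hnear hU)
  obtain ⟨N₁, hN₁⟩ := Metric.cauchySeq_iff.1 (hcauchy y hyD) (ε / 3) (by positivity)
  obtain ⟨N₂, hN₂⟩ := eventually_atTop.1 (hg y hyU)
  refine ⟨max N₁ N₂, fun m hm n hn => ?_⟩
  have hmn := hN₁ m (le_of_max_le_left hm) n (le_of_max_le_left hn)
  have hm' := hN₂ m (le_of_max_le_right hm)
  have hn' := hN₂ n (le_of_max_le_right hn)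
  have hy' : K * dist x y < ε / 3 := hy
  linarith [dist_triangle4_right (g m x) (g n x) (g m y) (g n y)]

theorem norm_le_abs_add_abs (x : Plane) : ‖x‖ ≤ |x 0| + |x 1| := by
  rw [EuclideanSpace.norm_eq, Fin.sum_univ_two, Real.sqrt_le_left (by positivity)]
  simp only [Real.norm_eq_abs]
  linarith [mul_nonneg (abs_nonneg (x 0)) (abs_nonneg (x 1))]

section W2Inf

variable {Ω : Set Plane} {u : H1 Ω} {D2 : Fin 2 → Plane → Plane}

theorem semiNormW2Inf_nonneg (Ω : Set Plane) (D2 : Fin 2 → Plane → Plane) :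
    0 ≤ semiNormW2Inf Ω D2 :=
  Real.iSup_nonneg fun _ => ENNReal.toReal_nonneg

theorem IsW2Inf.ae_abs_hess_le (hu : IsW2Inf u D2) (i j : Fin 2) :
    ∀ᵐ x ∂volume.restrict Ω, |D2 i x j| ≤ semiNormW2Inf Ω D2 := by
  have hfin : eLpNorm (fun x => D2 i x j) ∞ (volume.restrict Ω) ≠ ⊤ :=
    ((eLpNorm_mono (f := fun x => D2 i x j) fun x => PiLp.norm_apply_le (D2 i x) j).trans_lt
      (hu.memLp_hess i).2).ne
  have hle : (eLpNorm (fun x => D2 i x j) ∞ (volume.restrict Ω)).toReal ≤ semiNormW2Inf Ω D2 :=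
    le_ciSup (f := fun p : Fin 2 × Fin 2 =>
      (eLpNorm (fun x => D2 p.1 x p.2) ∞ (volume.restrict Ω)).toReal)
      (Set.finite_range _).bddAbove (i, j)
  filter_upwards [ae_le_eLpNormEssSup (f := fun x => D2 i x j) (μ := volume.restrict Ω)] with x hx
  rw [← eLpNorm_exponent_top] at hx
  simpa using (ENNReal.toReal_mono hfin hx).trans hle

theorem IsW2Inf.ae_norm_indicator_hess_le (hu : IsW2Inf u D2) (ho : IsOpen Ω) (i : Fin 2) :
    ∀ᵐ x, ‖Ω.indicator (D2 i) x‖ ≤ 2 * semiNormW2Inf Ω D2 := by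
  have h (j : Fin 2) := (ae_restrict_iff' ho.measurableSet).1 (hu.ae_abs_hess_le i j)
  filter_upwards [h 0, h 1] with x h0 h1
  by_cases hx : x ∈ Ω
  · rw [indicator_of_mem hx]
    linarith [norm_le_abs_add_abs (D2 i x), h0 hx, h1 hx]
  · simp [hx, semiNormW2Inf_nonneg]

theorem H1.integrableOn (hb : Bornology.IsBounded Ω) (u : H1 Ω) : IntegrableOn u Ω :=
  have : IsFiniteMeasure (volume.restrict Ω) := ⟨by simpa using hb.measure_lt_top⟩
  u.memLp.integrable one_le_two

theorem H1.integrableOn_grad (hb : Bornology.IsBounded Ω) (u : H1 Ω) : IntegrableOn u.grad Ω :=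
  have : IsFiniteMeasure (volume.restrict Ω) := ⟨by simpa using hb.measure_lt_top⟩
  u.memLp_grad.integrable one_le_two

theorem IsW2Inf.eventually_isJet_mollify (hu : IsW2Inf u D2) (ho : IsOpen Ω)
    (hb : Bornology.IsBounded Ω) {S : Set Plane} (hS : IsCompact S) (hconv : Convex ℝ S)
    (hSΩ : S ⊆ Ω) :
    ∀ᶠ n in atTop, IsJet S (mollify n (Ω.indicator u)) (mollify n (Ω.indicator u.grad))
      (4 * semiNormW2Inf Ω D2) := by
  set M := semiNormW2Inf Ω D2
  have hM : 0 ≤ M := semiNormW2Inf_nonneg Ω D2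
  have hgrad : LocallyIntegrable (Ω.indicator u.grad) :=
    ((integrable_indicator_iff ho.measurableSet).2 (u.integrableOn_grad hb)).locallyIntegrable
  have hcoord (n : ℕ) (x : Plane) (i : Fin 2) : mollify n (Ω.indicator u.grad) x i =
      mollify n (Ω.indicator fun x => u.grad x i) x := by
    refine (mollify_apply_comp n (EuclideanSpace.proj (𝕜 := ℝ) i) hgrad x).symm.trans ?_
    congr 1 with z
    by_cases hz : z ∈ Ω <;> simp [hz]
  filter_upwards [eventually_closedBall_rOut_subset ho hS hSΩ] with n hn
  refine isJet_of_hasGradientAt hconv (by positivity) (fun x hx =>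
    u.isWeakGradient.hasGradientAt_mollify ho (u.integrableOn hb) n (hn x hx)) fun x hx y hy => ?_
  have hcoord_le (i : Fin 2) : |(mollify n (Ω.indicator u.grad) y -
      mollify n (Ω.indicator u.grad) x) i| ≤ 2 * M * dist x y := by
    have hseg := hconv.segment_subset hx hy
    have := abs_sub_sub_inner_le_of_hasGradientAt (M := 2 * M) (p := 0)
      (fun z hz => (hu.isWeakGradient i).hasGradientAt_mollify ho
        ((EuclideanSpace.proj (𝕜 := ℝ) i).integrable_comp (u.integrableOn_grad hb)) n
        (hn z (hseg hz)))
      (fun z _ => by simpa using norm_mollify_le n (hu.ae_norm_indicator_hess_le ho i) z)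
    simpa [hcoord] using this
  linarith [norm_le_abs_add_abs (mollify n (Ω.indicator u.grad) y -
    mollify n (Ω.indicator u.grad) x), hcoord_le 0, hcoord_le 1]

theorem isCompact_segment (x y : Plane) : IsCompact (segment ℝ x y) := by
  rw [← convexHull_pair]; exact (Set.toFinite _).isCompact_convexHull ℝ

/-- The gradient is the pointwise limit of the mollified gradients, which are locally
equi-Lipschitz and converge almost everywhere. -/
theorem IsW2Inf.exists_isJet_of_convex (hu : IsW2Inf u D2) (ho : IsOpen Ω)
    (hb : Bornology.IsBounded Ω) :
    ∃ G : Plane → Plane, (∀ᵐ x ∂volume.restrict Ω, u.grad x = G x) ∧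
      ∀ S ⊆ Ω, IsCompact S → Convex ℝ S → IsJet S u G (4 * semiNormW2Inf Ω D2) := by
  set g : ℕ → Plane → Plane := fun n => mollify n (Ω.indicator u.grad)
  have hint := (integrable_indicator_iff ho.measurableSet).2 (u.integrableOn hb)
  have hae : ∀ᵐ x, Tendsto (fun n => g n x) atTop (𝓝 (Ω.indicator u.grad x)) :=
    ae_tendsto_mollify
      ((integrable_indicator_iff ho.measurableSet).2 (u.integrableOn_grad hb)).locallyIntegrable
  have hlim : ∀ x ∈ Ω, ∃ l, Tendsto (fun n => g n x) atTop (𝓝 l) := fun x hx => by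
    obtain ⟨ρ, hρ, hball⟩ := Metric.isOpen_iff.1 ho x hx
    refine exists_tendsto_of_eventually_dist_le (K := 4 * semiNormW2Inf Ω D2)
      (Metric.ball_mem_nhds x hρ) (fun y hy => ?_) (Measure.dense_of_ae hae)
      fun y hy => Tendsto.cauchySeq hy
    have hseg : segment ℝ x y ⊆ Ω :=
      ((convex_ball x ρ).segment_subset (Metric.mem_ball_self hρ) hy).trans hball
    filter_upwards [hu.eventually_isJet_mollify ho hb (isCompact_segment x y)
      (convex_segment x y) hseg] with n hn
    rw [dist_eq_norm, norm_sub_rev]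
    exact hn.lipschitz x (left_mem_segment ℝ x y) y (right_mem_segment ℝ x y)
  choose! G hG using hlim
  refine ⟨G, ?_, fun S hSΩ hS hconv => IsJet.of_tendsto
    (hu.eventually_isJet_mollify ho hb hS hconv hSΩ) (fun x hx => ?_) fun x hx => hG x (hSΩ hx)⟩
  · rw [ae_restrict_iff' ho.measurableSet]
    filter_upwards [hae] with x hx hxΩ
    rw [indicator_of_mem hxΩ] at hx
    exact tendsto_nhds_unique hx (hG x hxΩ)
  · have hxΩ := hSΩ hx
    have hcont : ContinuousAt (Ω.indicator u) x :=
      (hu.continuousOn.mono subset_closure).continuousAt (ho.mem_nhds hxΩ) |>.congr <| by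
        filter_upwards [ho.mem_nhds hxΩ] with y hy
        rw [indicator_of_mem hy]
    simpa [hxΩ] using tendsto_mollify_of_continuousAt hint.aestronglyMeasurable hcont

theorem IsW2Inf.exists_isJet {C : ℝ} (hu : IsW2Inf u D2) (ho : IsOpen Ω)
    (hb : Bornology.IsBounded Ω) (hC : IsQuasiconvex Ω C) :
    ∃ G : Plane → Plane, (∀ᵐ x ∂volume.restrict Ω, u.grad x = G x) ∧
      IsJet (closure Ω) u G ((|C| + C ^ 2) * (4 * semiNormW2Inf Ω D2)) := by
  have hM := semiNormW2Inf_nonneg Ω D2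
  obtain ⟨G, hGae, hG⟩ := hu.exists_isJet_of_convex ho hb
  have hjet := hC.isJet (by positivity) fun a b hab =>
    hG _ hab (isCompact_segment a b) (convex_segment a b)
  have hLip : LipschitzOnWith (Real.toNNReal ((|C| + C ^ 2) * (4 * semiNormW2Inf Ω D2))) G Ω :=
    LipschitzOnWith.of_dist_le_mul fun x hx y hy => by
      rw [Real.coe_toNNReal _ (by positivity), dist_eq_norm, norm_sub_rev]
      exact hjet.lipschitz x hx y hy
  obtain ⟨G', hG', heq⟩ := hLip.extend_finite_dimension
  refine ⟨G', ?_, (hjet.congr_grad heq).extend_closure hu.continuousOn hG'.continuous⟩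
  rw [ae_restrict_iff' ho.measurableSet] at hGae ⊢
  filter_upwards [hGae] with x hx hxΩ
  rw [hx hxΩ, heq hxΩ]

end W2Inf

/-! ### Lipschitz functions in `H¹` and `H¹₀` -/

section Gradient

variable {E : Type*} [NormedAddCommGroup E] [InnerProductSpace ℝ E]

theorem norm_gradient_le_of_lipschitz [CompleteSpace E] {v : E → ℝ} {K : ℝ≥0}
    (hv : LipschitzWith K v) (x : E) : ‖gradient v x‖ ≤ K := by
  rw [gradient, LinearIsometryEquiv.norm_map]
  exact norm_fderiv_le_of_lipschitz ℝ hv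

theorem gradient_add_const [CompleteSpace E] (v : E → ℝ) (c : ℝ) (x : E) :
    gradient (fun y => v y + c) x = gradient v x := by
  simp [gradient]

theorem gradient_eq_zero_of_notMem_tsupport [CompleteSpace E] {v : E → ℝ} {x : E}
    (hx : x ∉ tsupport v) : gradient v x = 0 :=
  (notMem_tsupport_iff_eventuallyEq.1 hx).gradient_eq.trans (gradient_const x 0)

/-- At a zero of `v`, a minimum of `|v|`, differentiability of `|v|` forces `v` to be flat. -/
theorem gradient_eq_zero_of_differentiableAt_abs [CompleteSpace E] {v : E → ℝ} {x : E}
    (hx : v x = 0) (hd : DifferentiableAt ℝ (fun y => |v y|) x) : gradient v x = 0 := by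
  have hmin : IsLocalMin (fun y => |v y|) x := Eventually.of_forall fun y => by simp [hx]
  have habs : HasFDerivAt (fun y => |v y|) (0 : E →L[ℝ] ℝ) x :=
    hmin.fderiv_eq_zero ▸ hd.hasFDerivAt
  have hv : HasFDerivAt v (0 : E →L[ℝ] ℝ) x := by
    rw [hasFDerivAt_iff_isLittleO] at habs ⊢
    simpa [hx] using habs
  simp [gradient, hv.fderiv]

variable [FiniteDimensional ℝ E] [MeasurableSpace E] [BorelSpace E]

theorem stronglyMeasurable_gradient (v : E → ℝ) : StronglyMeasurable (gradient v) :=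
  ((InnerProductSpace.toDual ℝ E).symm.continuous.measurable.comp
    (measurable_fderiv ℝ v)).stronglyMeasurable

theorem locallyIntegrable_gradient {v : E → ℝ} {K : ℝ≥0} (hv : LipschitzWith K v) :
    LocallyIntegrable (gradient v) :=
  (memLp_top_of_bound (stronglyMeasurable_gradient v).aestronglyMeasurable K
    (Eventually.of_forall (norm_gradient_le_of_lipschitz hv))).locallyIntegrable le_top

theorem ae_gradient_eq_zero_of_eq_zero {v : E → ℝ} {K : ℝ≥0} (hv : LipschitzWith K v) :
    ∀ᵐ x, v x = 0 → gradient v x = 0 := by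
  have habs : LipschitzWith (1 * K) fun x => |v x| :=
    (lipschitzWith_one_norm (E := ℝ)).comp hv
  filter_upwards [habs.ae_differentiableAt (μ := volume)] with x hd hx
  exact gradient_eq_zero_of_differentiableAt_abs hx hd

theorem integral_smul_gradient_of_lipschitz {v φ : E → ℝ} {K D : ℝ≥0} (hv : LipschitzWith K v)
    (hφ : LipschitzWith D φ) (hc : HasCompactSupport φ) :
    ∫ x, v x • gradient φ x = -∫ x, φ x • gradient v x := by
  have hint_φ : Integrable fun x => φ x • gradient v x :=
    (locallyIntegrable_gradient hv).integrable_smul_left_of_hasCompactSupport hφ.continuous hc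
  have hint_v : Integrable fun x => v x • gradient φ x := by
    refine (integrableOn_iff_integrable_of_support_subset fun x hx => ?_).1
      (((locallyIntegrable_gradient hφ).integrableOn_isCompact hc).continuousOn_smul
        hv.continuous.continuousOn hc)
    by_contra h
    simp [gradient_eq_zero_of_notMem_tsupport h] at hx
  have inner_smul_gradient : ∀ {f g : E → ℝ} {c x : E}, DifferentiableAt ℝ g x →
      inner ℝ c (f x • gradient g x) = lineDeriv ℝ g x c * f x := fun hx => by
    rw [hx.lineDeriv_eq_fderiv, inner_smul_right, real_inner_comm, inner_gradient_left, mul_comm]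
  refine ext_inner_left ℝ fun c => ?_
  rw [inner_neg_right, ← integral_inner hint_v, ← integral_inner hint_φ]
  calc ∫ x, inner ℝ c (v x • gradient φ x)
      = ∫ x, -(lineDeriv ℝ φ x (-c) * v x) := by
        refine integral_congr_ae ?_
        filter_upwards [hφ.ae_differentiableAt (μ := volume)] with x hx
        rw [inner_smul_gradient hx, lineDeriv_neg, neg_mul, neg_neg]
    _ = -∫ x, lineDeriv ℝ v x c * φ x := by
        rw [integral_neg, hv.integral_lineDeriv_mul_eq hφ hc]
    _ = -∫ x, inner ℝ c (φ x • gradient v x) := by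
        congr 1
        refine integral_congr_ae ?_
        filter_upwards [hv.ae_differentiableAt (μ := volume)] with x hx
        rw [inner_smul_gradient hx]

end Gradient

theorem isWeakGradient_of_lipschitz (Ω : Set Plane) {v : Plane → ℝ} {K : ℝ≥0}
    (hv : LipschitzWith K v) : IsWeakGradient Ω v (gradient v) where
  locallyIntegrableOn := hv.continuous.locallyIntegrable.locallyIntegrableOn Ω
  locallyIntegrableOn_grad := (locallyIntegrable_gradient hv).locallyIntegrableOn Ω
  integral_eq φ hφ := by
    have houtside : ∀ x, x ∉ Ω → φ x = 0 ∧ gradient φ x = 0 := fun x hx =>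
      ⟨image_eq_zero_of_notMem_tsupport fun h => hx (hφ.tsupport_subset h),
        gradient_eq_zero_of_notMem_tsupport fun h => hx (hφ.tsupport_subset h)⟩
    rw [setIntegral_eq_integral_of_forall_compl_eq_zero fun x hx => by simp [houtside x hx],
      setIntegral_eq_integral_of_forall_compl_eq_zero fun x hx => by simp [houtside x hx]]
    obtain ⟨D, hD⟩ := ContDiff.lipschitzWith_of_hasCompactSupport hφ.hasCompactSupport
      hφ.contDiff (by simp)
    exact integral_smul_gradient_of_lipschitz hv hD hφ.hasCompactSupport

theorem isFiniteMeasure_restrict_of_isBounded {Ω : Set Plane} (hb : Bornology.IsBounded Ω) :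
    IsFiniteMeasure (volume.restrict Ω) :=
  ⟨by simpa using hb.measure_lt_top⟩

/-- The `H¹(Ω)` function given by a Lipschitz function and its almost everywhere defined
gradient. -/
noncomputable def H1.ofLipschitz {Ω : Set Plane} (ho : IsOpen Ω) (hb : Bornology.IsBounded Ω)
    {v : Plane → ℝ} {K : ℝ≥0} (hv : LipschitzWith K v) : H1 Ω where
  toFun := v
  grad := gradient v
  memLp := by
    have := isFiniteMeasure_restrict_of_isBounded hb
    obtain ⟨B, hB⟩ := (hb.isCompact_closure.image hv.continuous).isBounded.exists_norm_le
    exact MemLp.of_bound hv.continuous.aestronglyMeasurable B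
      (ae_restrict_of_forall_mem ho.measurableSet fun x hx =>
        hB _ (mem_image_of_mem v (subset_closure hx)))
  memLp_grad := by
    have := isFiniteMeasure_restrict_of_isBounded hb
    exact MemLp.of_bound (stronglyMeasurable_gradient v).aestronglyMeasurable K
      (Eventually.of_forall (norm_gradient_le_of_lipschitz hv))
  isWeakGradient := isWeakGradient_of_lipschitz Ω hv

theorem tendsto_eLpNorm_zero_of_bounded {α F : Type*} [MeasurableSpace α] {μ : Measure α}
    [IsFiniteMeasure μ] [NormedAddCommGroup F] {p : ℝ≥0∞} (hp : p ≠ 0) (hp' : p ≠ ⊤)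
    {f : ℕ → α → F} {B : ℝ} (hf : ∀ n, AEStronglyMeasurable (f n) μ)
    (hB : ∀ n, ∀ᵐ x ∂μ, ‖f n x‖ ≤ B) (hlim : ∀ᵐ x ∂μ, Tendsto (f · x) atTop (𝓝 0)) :
    Tendsto (fun n => eLpNorm (f n) p μ) atTop (𝓝 0) := by
  have hq : 0 < p.toReal := ENNReal.toReal_pos hp hp'
  have hint : Tendsto (fun n => ∫⁻ x, ‖f n x‖ₑ ^ p.toReal ∂μ) atTop (𝓝 (∫⁻ _, 0 ∂μ)) := by
    refine tendsto_lintegral_of_dominated_convergence' (fun _ => ENNReal.ofReal B ^ p.toReal)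
      (fun n => (hf n).enorm.pow_const _) (fun n => ?_) ?_ ?_
    · filter_upwards [hB n] with x hx
      rw [← ofReal_norm]
      gcongr
    · simp [ENNReal.mul_eq_top, measure_ne_top, hq.le]
    · filter_upwards [hlim] with x hx
      have hpow := ((ENNReal.continuous_rpow_const (y := p.toReal)).tendsto _).comp hx.enorm
      simpa [Function.comp_def, hq] using hpow
  have hroot := ((ENNReal.continuous_rpow_const (y := 1 / p.toReal)).tendsto _).comp hint
  simp only [lintegral_zero, ENNReal.zero_rpow_of_pos (one_div_pos.2 hq)] at hroot
  exact hroot.congr fun n => (eLpNorm_eq_lintegral_rpow_enorm_toReal hp hp').symm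

theorem IsH10.congr {Ω : Set Plane} {v w : H1 Ω} (hv : IsH10 v)
    (hvw : v =ᵐ[volume.restrict Ω] w) (hgrad : v.grad =ᵐ[volume.restrict Ω] w.grad) :
    IsH10 w := by
  obtain ⟨φ, hφ, hφv, hφg⟩ := hv
  refine ⟨φ, hφ, hφv.congr fun n => eLpNorm_congr_ae ?_, hφg.congr fun n => eLpNorm_congr_ae ?_⟩
  · filter_upwards [hvw] with x hx using by rw [hx]
  · filter_upwards [hgrad] with x hx using by rw [hx]

theorem tendsto_eLpNorm_sub_of_le {α F : Type*} [MeasurableSpace α] {μ : Measure α}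
    [NormedAddCommGroup F] {p : ℝ≥0∞} (hp : 1 ≤ p) {f g : ℕ → α → F} {l : α → F} {ε : ℕ → ℝ≥0∞}
    (hf : ∀ n, AEStronglyMeasurable (f n) μ) (hg : ∀ n, AEStronglyMeasurable (g n) μ)
    (hl : AEStronglyMeasurable l μ) (hε : Tendsto ε atTop (𝓝 0))
    (hfg : ∀ n, eLpNorm (fun x => f n x - g n x) p μ ≤ ε n)
    (hgl : Tendsto (fun n => eLpNorm (fun x => g n x - l x) p μ) atTop (𝓝 0)) :
    Tendsto (fun n => eLpNorm (fun x => f n x - l x) p μ) atTop (𝓝 0) := by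
  have hsum : Tendsto (fun n => ε n + eLpNorm (fun x => g n x - l x) p μ) atTop (𝓝 0) := by
    simpa using hε.add hgl
  refine tendsto_of_tendsto_of_tendsto_of_le_of_le tendsto_const_nhds hsum (fun _ => zero_le)
    fun n => ?_
  calc eLpNorm (fun x => f n x - l x) p μ
      = eLpNorm ((fun x => f n x - g n x) + fun x => g n x - l x) p μ := by
        congr 1; ext x; simp
    _ ≤ ε n + eLpNorm (fun x => g n x - l x) p μ :=
        (eLpNorm_add_le ((hf n).sub (hg n)) ((hg n).sub hl) hp).trans
          (add_le_add_left (hfg n) _)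

theorem continuous_gradient_of_isTestFunction {Ω : Set Plane} {φ : Plane → ℝ}
    (hφ : IsTestFunction Ω φ) : Continuous (gradient φ) :=
  (InnerProductSpace.toDual ℝ Plane).symm.continuous.comp
    (hφ.contDiff.continuous_fderiv (by simp))

theorem isH10_of_tendsto {Ω : Set Plane} {v : H1 Ω} {w : ℕ → H1 Ω} (hw : ∀ n, IsH10 (w n))
    (hwv : Tendsto (fun n => eLpNorm (fun x => w n x - v x) 2 (volume.restrict Ω)) atTop (𝓝 0))
    (hgrad : Tendsto (fun n => eLpNorm (fun x => (w n).grad x - v.grad x) 2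
      (volume.restrict Ω)) atTop (𝓝 0)) : IsH10 v := by
  have hnear : ∀ n : ℕ, ∃ φ, IsTestFunction Ω φ ∧
      eLpNorm (fun x => φ x - w n x) 2 (volume.restrict Ω) ≤ (n : ℝ≥0∞)⁻¹ ∧
      eLpNorm (fun x => gradient φ x - (w n).grad x) 2 (volume.restrict Ω) ≤ (n : ℝ≥0∞)⁻¹ := by
    intro n
    obtain ⟨φ, hφ, hφw, hφg⟩ := hw n
    have hpos : 0 < (n : ℝ≥0∞)⁻¹ := by simp
    obtain ⟨k, hk, hk'⟩ :=
      ((hφw.eventually_le_const hpos).and (hφg.eventually_le_const hpos)).exists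
    exact ⟨φ k, hφ k, hk, hk'⟩
  choose φ hφ hφw hφg using hnear
  exact ⟨φ, hφ,
    tendsto_eLpNorm_sub_of_le one_le_two
      (fun n => (hφ n).contDiff.continuous.aestronglyMeasurable) (fun n => (w n).memLp.1)
      v.memLp.1 ENNReal.tendsto_inv_nat_nhds_zero hφw hwv,
    tendsto_eLpNorm_sub_of_le one_le_two
      (fun n => (continuous_gradient_of_isTestFunction (hφ n)).aestronglyMeasurable)
      (fun n => (w n).memLp_grad.1) v.memLp_grad.1 ENNReal.tendsto_inv_nat_nhds_zero hφg hgrad⟩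

theorem isTestFunction_mollify {Ω : Set Plane} {w : Plane → ℝ} (hw : LocallyIntegrable w)
    (hc : HasCompactSupport w) {n : ℕ}
    (hn : Metric.cthickening (bumpSeq Plane n).rOut (tsupport w) ⊆ Ω) :
    IsTestFunction Ω (mollify n w) where
  contDiff := contDiff_mollify n hw
  hasCompactSupport :=
    HasCompactSupport.of_support_subset_isCompact hc.isCompact.cthickening
      (support_mollify_subset n w)
  tsupport_subset :=
    (closure_minimal (support_mollify_subset n w) Metric.isClosed_cthickening).trans hn

theorem gradient_mollify {w : Plane → ℝ} {K : ℝ≥0} (hw : LipschitzWith K w)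
    (hc : HasCompactSupport w) (n : ℕ) : gradient (mollify n w) = mollify n (gradient w) := by
  ext1 x
  have h := (isWeakGradient_of_lipschitz univ hw).hasGradientAt_mollify isOpen_univ
    (integrableOn_univ.2 (hw.continuous.integrable_of_hasCompactSupport hc)) n
    (subset_univ (Metric.closedBall x _))
  simpa using h.gradient

theorem isH10_ofLipschitz_of_tsupport_subset {Ω : Set Plane} (ho : IsOpen Ω)
    (hb : Bornology.IsBounded Ω) {w : Plane → ℝ} {K : ℝ≥0} (hw : LipschitzWith K w)
    (hs : tsupport w ⊆ Ω) : IsH10 (H1.ofLipschitz ho hb hw) := by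
  have := isFiniteMeasure_restrict_of_isBounded hb
  have hc : HasCompactSupport w :=
    Metric.isCompact_of_isClosed_isBounded (isClosed_tsupport _) (hb.subset hs)
  have hint : LocallyIntegrable w := hw.continuous.locallyIntegrable
  obtain ⟨B, hB⟩ := hc.exists_bound_of_continuous hw.continuous
  have hlimit : ∀ {F : Type} [NormedAddCommGroup F] [NormedSpace ℝ F] [CompleteSpace F]
      {f : Plane → F} {M : ℝ}, LocallyIntegrable f → (∀ x, ‖f x‖ ≤ M) →
      Tendsto (fun n => eLpNorm (fun x => mollify n f x - f x) 2 (volume.restrict Ω))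
        atTop (𝓝 0) := fun hf hM =>
    tendsto_eLpNorm_zero_of_bounded two_ne_zero ENNReal.ofNat_ne_top
      (fun n => (contDiff_mollify n hf).continuous.aestronglyMeasurable.sub
        hf.aestronglyMeasurable.restrict)
      (fun n => Eventually.of_forall fun x => norm_sub_le_of_le
        (norm_mollify_le n (Eventually.of_forall hM) x) (hM x))
      (ae_restrict_of_ae ((ae_tendsto_mollify hf).mono fun x hx => tendsto_sub_nhds_zero_iff.2 hx))
  obtain ⟨δ, hδ, hsub⟩ := hc.isCompact.exists_cthickening_subset_open ho hs
  obtain ⟨N, hN⟩ := eventually_atTop.1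
    ((tendsto_bumpSeq_rOut (E := Plane)).eventually_lt_const hδ)
  refine ⟨fun n => mollify (n + N) w, fun n => isTestFunction_mollify hint hc
    ((Metric.cthickening_mono (hN _ le_add_self).le _).trans hsub),
    (tendsto_add_atTop_iff_nat N).2 (hlimit hint hB), ?_⟩
  simp only [gradient_mollify hw hc]
  exact (tendsto_add_atTop_iff_nat N).2
    (hlimit (locallyIntegrable_gradient hw) (norm_gradient_le_of_lipschitz hw))

/-- Soft thresholding at height `δ`: it moves `t` towards `0` by `δ`, stopping at `0`. Applied to a
Lipschitz function it pushes the support away from the zero set. -/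
noncomputable def softThreshold (δ t : ℝ) : ℝ := t - max (-δ) (min δ t)

theorem lipschitzWith_softThreshold (δ : ℝ) : LipschitzWith 2 (softThreshold δ) := by
  have hclamp : LipschitzWith 1 fun t : ℝ => max (-δ) (min δ t) :=
    (LipschitzWith.id.const_min δ).const_max (-δ)
  exact one_add_one_eq_two (R := ℝ≥0) ▸ LipschitzWith.id.sub hclamp

theorem softThreshold_of_abs_le {δ t : ℝ} (h : |t| ≤ δ) : softThreshold δ t = 0 := by
  rw [abs_le] at h
  simp [softThreshold, min_eq_right h.2, max_eq_right h.1]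

theorem softThreshold_of_le {δ t : ℝ} (hδ : 0 ≤ δ) (h : δ ≤ t) :
    softThreshold δ t = t + -δ := by
  simp [softThreshold, min_eq_left h, max_eq_right (neg_le_self hδ), sub_eq_add_neg]

theorem softThreshold_of_le_neg {δ t : ℝ} (hδ : 0 ≤ δ) (h : t ≤ -δ) :
    softThreshold δ t = t + δ := by
  simp [softThreshold, min_eq_right (h.trans (neg_le_self hδ)), max_eq_left h]

theorem abs_softThreshold_sub_le {δ : ℝ} (hδ : 0 ≤ δ) (t : ℝ) : |softThreshold δ t - t| ≤ δ := by
  simp only [softThreshold, sub_sub_cancel_left, abs_neg, abs_le]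
  exact ⟨le_max_left _ _, max_le (neg_le_self hδ) (min_le_left _ _)⟩

theorem tsupport_softThreshold_comp_subset {X : Type*} [TopologicalSpace X] {w : X → ℝ}
    (hw : Continuous w) (δ : ℝ) : tsupport (fun x => softThreshold δ (w x)) ⊆ {x | δ ≤ |w x|} := by
  refine closure_minimal (fun x hx => ?_) (isClosed_le continuous_const hw.abs)
  by_contra h
  exact hx (softThreshold_of_abs_le (not_le.1 h).le)

theorem gradient_softThreshold_comp {E : Type*} [NormedAddCommGroup E] [InnerProductSpace ℝ E]
    [CompleteSpace E] {w : E → ℝ} (hw : Continuous w) {δ : ℝ} (hδ : 0 ≤ δ) {x : E}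
    (hx : δ < |w x|) : gradient (fun y => softThreshold δ (w y)) x = gradient w x := by
  rcases lt_abs.1 hx with h | h
  · have hev : (fun y => softThreshold δ (w y)) =ᶠ[𝓝 x] fun y => w y + -δ := by
      filter_upwards [hw.continuousAt.eventually_const_lt h] with y hy
      exact softThreshold_of_le hδ hy.le
    rw [hev.gradient_eq, gradient_add_const]
  · have hev : (fun y => softThreshold δ (w y)) =ᶠ[𝓝 x] fun y => w y + δ := by
      filter_upwards [hw.continuousAt.eventually_lt_const (lt_neg_of_lt_neg h)] with y hy
      exact softThreshold_of_le_neg hδ hy.le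
    rw [hev.gradient_eq, gradient_add_const]

theorem isH10_ofLipschitz_of_eq_zero_compl {Ω : Set Plane} (ho : IsOpen Ω)
    (hb : Bornology.IsBounded Ω) {w : Plane → ℝ} {K : ℝ≥0} (hw : LipschitzWith K w)
    (h0 : ∀ x ∉ Ω, w x = 0) : IsH10 (H1.ofLipschitz ho hb hw) := by
  have := isFiniteMeasure_restrict_of_isBounded hb
  set δ : ℕ → ℝ := fun k => 1 / ((k : ℝ) + 1)
  have hδ : ∀ k, 0 < δ k := fun k => by positivity
  have hδ_le : ∀ k, δ k ≤ 1 := fun k => div_le_one_of_le₀ (by simp) (by positivity)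
  have hδ_lim : Tendsto δ atTop (𝓝 0) := tendsto_one_div_add_atTop_nhds_zero_nat
  have hlip : ∀ k, LipschitzWith (2 * K) fun x => softThreshold (δ k) (w x) := fun k =>
    (lipschitzWith_softThreshold (δ k)).comp hw
  have hts := fun k => tsupport_softThreshold_comp_subset hw.continuous (δ k)
  have hsub : ∀ k, tsupport (fun x => softThreshold (δ k) (w x)) ⊆ Ω := fun k x hx => by
    by_contra hxΩ
    have hle : δ k ≤ |w x| := hts k hx
    rw [h0 x hxΩ, abs_zero] at hle
    exact (hδ k).not_ge hle
  refine isH10_of_tendsto (w := fun k => H1.ofLipschitz ho hb (hlip k))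
    (fun k => isH10_ofLipschitz_of_tsupport_subset ho hb (hlip k) (hsub k)) ?_ ?_
  · refine tendsto_eLpNorm_zero_of_bounded (B := 1) two_ne_zero ENNReal.ofNat_ne_top
      (fun k => ((hlip k).continuous.sub hw.continuous).aestronglyMeasurable)
      (fun k => Eventually.of_forall fun x =>
        (abs_softThreshold_sub_le (hδ k).le (w x)).trans (hδ_le k))
      (Eventually.of_forall fun x => ?_)
    exact squeeze_zero_norm (fun k => abs_softThreshold_sub_le (hδ k).le (w x)) hδ_lim
  · refine tendsto_eLpNorm_zero_of_bounded (B := (2 * K : ℝ≥0) + K) two_ne_zero ENNReal.ofNat_ne_top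
      (fun k => ((stronglyMeasurable_gradient _).sub
        (stronglyMeasurable_gradient w)).aestronglyMeasurable)
      (fun k => Eventually.of_forall fun x => norm_sub_le_of_le
        (norm_gradient_le_of_lipschitz (hlip k) x) (norm_gradient_le_of_lipschitz hw x)) ?_
    filter_upwards [ae_restrict_of_ae (ae_gradient_eq_zero_of_eq_zero hw)] with x hx
    refine tendsto_sub_nhds_zero_iff.2 (tendsto_const_nhds.congr' ?_)
    rcases eq_or_ne (w x) 0 with hwx | hwx
    · filter_upwards with k
      refine (hx hwx).trans (gradient_eq_zero_of_notMem_tsupport fun hxs => ?_).symm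
      have hle : δ k ≤ |w x| := hts k hxs
      rw [hwx, abs_zero] at hle
      exact (hδ k).not_ge hle
    · filter_upwards [hδ_lim.eventually_lt_const (abs_pos.2 hwx)] with k hk
      exact (gradient_softThreshold_comp hw.continuous (hδ k).le hk).symm

section Frontier

variable {E : Type*} [NormedAddCommGroup E] [NormedSpace ℝ E]

theorem exists_mem_frontier_of_isPreconnected {X : Type*} [TopologicalSpace X] {P S : Set X}
    (hP : IsPreconnected P) {x y : X} (hxP : x ∈ P) (hx : x ∈ S) (hyP : y ∈ P) (hy : y ∉ S) :
    ∃ z ∈ P, z ∈ frontier S := by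
  by_contra! h
  have hcover : P ⊆ interior S ∪ (closure S)ᶜ := fun z hz => by
    by_contra! hz'
    rw [mem_union, not_or, notMem_compl_iff] at hz'
    exact h z hz ⟨hz'.2, hz'.1⟩
  have hdisj : Disjoint (interior S) (closure S)ᶜ :=
    disjoint_compl_right.mono_left (interior_subset.trans subset_closure)
  rcases hP.subset_or_subset isOpen_interior isClosed_closure.isOpen_compl hdisj hcover
    with hin | hout
  · exact hy (interior_subset (hin hyP))
  · exact hout hxP (subset_closure hx)

theorem exists_mem_segment_frontier {S : Set E} {x y : E} (hx : x ∈ S) (hy : y ∉ S) :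
    ∃ z ∈ segment ℝ x y, z ∈ frontier S :=
  exists_mem_frontier_of_isPreconnected (convex_segment x y).isPreconnected
    (left_mem_segment ℝ x y) hx (right_mem_segment ℝ x y) hy

theorem lipschitzWith_indicator {S : Set E} {v : E → ℝ} {K : ℝ≥0} (hv : LipschitzWith K v)
    (h0 : ∀ x ∈ frontier S, v x = 0) : LipschitzWith K (S.indicator v) := by
  have hmix : ∀ x ∈ S, ∀ y, y ∉ S → |v x| ≤ K * dist x y := by
    intro x hx y hy
    obtain ⟨z, hz, hzf⟩ := exists_mem_segment_frontier hx hy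
    calc |v x| = dist (v x) (v z) := by rw [Real.dist_eq, h0 z hzf, sub_zero]
      _ ≤ K * dist x z := hv.dist_le_mul x z
      _ ≤ K * dist x y := by
        gcongr
        linarith [dist_add_dist_of_mem_segment hz, dist_nonneg (x := z) (y := y)]
  refine LipschitzWith.of_dist_le_mul fun x y => ?_
  by_cases hx : x ∈ S <;> by_cases hy : y ∈ S
  · simpa [hx, hy] using hv.dist_le_mul x y
  · simpa [hx, hy, Real.dist_eq] using hmix x hx y hy
  · rw [dist_comm x y]; simpa [hx, hy, Real.dist_eq] using hmix y hy x hx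
  · simpa [hx, hy] using mul_nonneg K.coe_nonneg dist_nonneg

end Frontier

theorem isH10_ofLipschitz {Ω : Set Plane} (ho : IsOpen Ω) (hb : Bornology.IsBounded Ω)
    {v : Plane → ℝ} {K : ℝ≥0} (hv : LipschitzWith K v) (h0 : ∀ x ∈ frontier Ω, v x = 0) :
    IsH10 (H1.ofLipschitz ho hb hv) := by
  have hind : IsH10 (H1.ofLipschitz ho hb (lipschitzWith_indicator hv h0)) :=
    isH10_ofLipschitz_of_eq_zero_compl ho hb _ fun x hx => indicator_of_notMem hx v
  refine hind.congr (ae_restrict_of_forall_mem ho.measurableSet fun x hx => indicator_of_mem hx v)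
    (ae_restrict_of_forall_mem ho.measurableSet fun x hx => ?_)
  exact ((eqOn_indicator (s := Ω) (f := v)).eventuallyEq_of_mem (ho.mem_nhds hx)).gradient_eq

/-! ### Affine functions and barycentric coordinates -/

section AffineGradient

variable {E : Type*} [NormedAddCommGroup E] [InnerProductSpace ℝ E] [FiniteDimensional ℝ E]

/-- The constant gradient of an affine function. -/
noncomputable def affGrad (A : E →ᵃ[ℝ] ℝ) : E :=
  (InnerProductSpace.toDual ℝ E).symm (LinearMap.toContinuousLinearMap A.linear)

theorem affine_sub_eq (A : E →ᵃ[ℝ] ℝ) (x y : E) : A y - A x = inner ℝ (affGrad A) (y - x) := by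
  rw [affGrad, InnerProductSpace.toDual_symm_apply]
  simpa using (A.linearMap_vsub y x).symm

theorem hasGradientAt_affine (A : E →ᵃ[ℝ] ℝ) (x : E) : HasGradientAt A (affGrad A) x := by
  rw [hasGradientAt_iff_isLittleO]
  simp [affine_sub_eq]

theorem abs_affine_sub_le (A : E →ᵃ[ℝ] ℝ) (x y : E) : |A y - A x| ≤ ‖affGrad A‖ * dist x y := by
  rw [affine_sub_eq, dist_comm, dist_eq_norm]
  exact abs_real_inner_le_norm _ _

end AffineGradient

section FullSimplex

variable {E : Type*} [AddCommGroup E] [Module ℝ E]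

theorem affine_eqOn_convexHull {A B : E →ᵃ[ℝ] ℝ} {s : Set E} (h : EqOn A B s) :
    EqOn A B (convexHull ℝ s) :=
  (AffineMap.eqOn_affineSpan h).mono (convexHull_subset_affineSpan s)

/-- `K` is the vertex set of a nondegenerate simplex of full dimension. -/
structure IsFullSimplex (K : Finset E) : Prop where
  affineIndependent : AffineIndependent ℝ ((↑) : K → E)
  affineSpan_eq_top : affineSpan ℝ (K : Set E) = ⊤

/-- The vertices of a full-dimensional simplex as an affine basis. -/
noncomputable def IsFullSimplex.basis {K : Finset E} (hK : IsFullSimplex K) :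
    AffineBasis K ℝ E where
  toFun := (↑)
  ind' := hK.affineIndependent
  tot' := by rw [Subtype.range_coe]; exact hK.affineSpan_eq_top

open Classical in
/-- The barycentric coordinate of the vertex `p` in the simplex `K`. It is `0` if `p` is not a
vertex of `K`, so that coordinates with respect to neighbouring simplices agree on the common
face. -/
noncomputable def bary (K : Finset E) (p : E) : E →ᵃ[ℝ] ℝ :=
  if h : IsFullSimplex K ∧ p ∈ K then h.1.basis.coord ⟨p, h.2⟩ else 0

/-- The affine function with the vertex values of `v` on the simplex `K`. -/
noncomputable def nodalAffine (K : Finset E) (v : E → ℝ) : E →ᵃ[ℝ] ℝ := ∑ p ∈ K, v p • bary K p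

theorem nodalAffine_apply (K : Finset E) (v : E → ℝ) (x : E) :
    nodalAffine K v x = ∑ p ∈ K, v p * bary K p x := by
  let eval : (E →ᵃ[ℝ] ℝ) →+ ℝ := AddMonoidHom.mk' (fun A => A x) fun _ _ => rfl
  exact map_sum eval (fun p => v p • bary K p) K

namespace IsFullSimplex

variable {K : Finset E} (hK : IsFullSimplex K) {p q : E}

include hK

theorem bary_eq (hp : p ∈ K) : bary K p = hK.basis.coord ⟨p, hp⟩ := by
  rw [bary, dif_pos ⟨hK, hp⟩]

theorem bary_self (hp : p ∈ K) : bary K p p = 1 := by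
  rw [hK.bary_eq hp]
  exact hK.basis.coord_apply_eq ⟨p, hp⟩

theorem bary_ne (hp : p ∈ K) (hqp : q ≠ p) : bary K q p = 0 := by
  by_cases hq : q ∈ K
  · rw [hK.bary_eq hq]
    exact hK.basis.coord_apply_ne (i := ⟨q, hq⟩) (j := ⟨p, hp⟩) fun h =>
      hqp (congrArg Subtype.val h)
  · simp [bary, hq]

theorem mem_convexHull_iff {x : E} :
    x ∈ convexHull ℝ (K : Set E) ↔ ∀ p ∈ K, 0 ≤ bary K p x := by
  have hrange : (K : Set E) = range hK.basis := by
    ext p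
    exact ⟨fun hp => ⟨⟨p, hp⟩, rfl⟩, fun ⟨q, hq⟩ => hq ▸ q.2⟩
  rw [hrange, hK.basis.convexHull_eq_nonneg_coord]
  exact ⟨fun hx p hp => by rw [hK.bary_eq hp]; exact hx ⟨p, hp⟩,
    fun hx p => by rw [← hK.bary_eq p.2]; exact hx p p.2⟩

theorem nodalAffine_vertex (v : E → ℝ) (hp : p ∈ K) : nodalAffine K v p = v p := by
  rw [nodalAffine_apply, Finset.sum_eq_single_of_mem p hp fun q _ hqp => by
    rw [hK.bary_ne hp hqp, mul_zero], hK.bary_self hp, mul_one]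

theorem eq_nodalAffine {A : E →ᵃ[ℝ] ℝ} {v : E → ℝ} (hA : ∀ p ∈ K, A p = v p) :
    A = nodalAffine K v := by
  refine AffineMap.ext_on hK.affineSpan_eq_top fun p hp => ?_
  rw [hA p hp, hK.nodalAffine_vertex v hp]

end IsFullSimplex

end FullSimplex

/-! ### Nodal interpolation on a triangulation -/

section Triangulation

variable {Ω : Set Plane} {T : Geometry.SimplicialComplex ℝ Plane} {K K' : Finset Plane}
  {p x : Plane} {v : Plane → ℝ}

theorem isClosed_tri (K : Finset Plane) : IsClosed (tri K) :=
  (K.finite_toSet.isCompact_convexHull ℝ).isClosed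

theorem vertex_mem_tri (hp : p ∈ K) : p ∈ tri K :=
  subset_convexHull ℝ _ hp

theorem isFullSimplex_of_mem_elements (hK : K ∈ elements T) : IsFullSimplex K := by
  have hind := T.indep hK.1
  refine ⟨hind, ?_⟩
  have hspan := hind.affineSpan_eq_top_iff_card_eq_finrank_add_one.2 (by simp [hK.2])
  rwa [Subtype.range_coe] at hspan

theorem mem_vertices_of_mem_element (hK : K ∈ elements T) (hp : p ∈ K) : p ∈ T.vertices :=
  T.down_closed hK.1 (Finset.singleton_subset_iff.2 hp) (Finset.singleton_nonempty p)

theorem eqOn_inter_tri (hK : K ∈ elements T) (hK' : K' ∈ elements T) {A B : Plane →ᵃ[ℝ] ℝ}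
    (h : ∀ p ∈ K, p ∈ K' → A p = B p) : EqOn A B (tri K ∩ tri K') :=
  (affine_eqOn_convexHull fun p hp => h p hp.1 hp.2).mono (T.inter_subset_convexHull hK.1 hK'.1)

theorem bary_eqOn_inter_tri (hK : K ∈ elements T) (hK' : K' ∈ elements T) (p : Plane) :
    EqOn (bary K p) (bary K' p) (tri K ∩ tri K') := by
  refine eqOn_inter_tri hK hK' fun q hq hq' => ?_
  rcases eq_or_ne p q with rfl | hpq
  · rw [(isFullSimplex_of_mem_elements hK).bary_self hq,
      (isFullSimplex_of_mem_elements hK').bary_self hq']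
  · rw [(isFullSimplex_of_mem_elements hK).bary_ne hq hpq,
      (isFullSimplex_of_mem_elements hK').bary_ne hq' hpq]

namespace IsTriangulation

variable (hT : IsTriangulation Ω T)

include hT

theorem finite_elements : (elements T).Finite :=
  hT.finite.subset fun _ hK => hK.1

theorem closure_eq : closure Ω = ⋃ K ∈ elements T, tri K := by
  ext x
  rw [← hT.space_eq, Geometry.SimplicialComplex.mem_space_iff, mem_iUnion₂]
  constructor
  · rintro ⟨s, hs, hx⟩
    obtain ⟨t, ht, hst, hc⟩ := hT.pure s hs
    exact ⟨t, ⟨ht, hc⟩, convexHull_mono (Finset.coe_subset.2 hst) hx⟩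
  · rintro ⟨K, hK, hx⟩
    exact ⟨K, hK.1, hx⟩

theorem tri_subset (hK : K ∈ elements T) : tri K ⊆ closure Ω := by
  rw [hT.closure_eq]; exact subset_biUnion_of_mem hK

theorem exists_mem_tri (hx : x ∈ closure Ω) : ∃ K ∈ elements T, x ∈ tri K := by
  simpa [hT.closure_eq] using hx

theorem exists_element_of_vertex (hp : p ∈ T.vertices) : ∃ K ∈ elements T, p ∈ K := by
  obtain ⟨t, ht, hst, hc⟩ := hT.pure {p} hp
  exact ⟨t, ⟨ht, hc⟩, hst (Finset.mem_singleton_self p)⟩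

theorem ae_mem_interior_tri :
    ∀ᵐ x ∂volume.restrict Ω, ∃ K ∈ elements T, x ∈ interior (tri K) := by
  have hfrontier : ∀ᵐ x, ∀ K ∈ elements T, x ∉ frontier (tri K) :=
    (ae_ball_iff hT.finite_elements.countable).2 fun K _ => measure_eq_zero_iff_ae_notMem.1
      ((convex_convexHull ℝ (K : Set Plane)).addHaar_frontier volume)
  refine ae_restrict_of_ae_restrict_of_subset subset_closure ?_
  rw [ae_restrict_iff' isClosed_closure.measurableSet]
  filter_upwards [hfrontier] with x hx hxc
  obtain ⟨K, hK, hxK⟩ := hT.exists_mem_tri hxc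
  exact ⟨K, hK, by_contra fun hi => hx K hK ⟨subset_closure hxK, hi⟩⟩

end IsTriangulation

open Classical in
/-- The piecewise affine nodal interpolant of `v`, extended by `0` outside the triangulation. -/
noncomputable def interp (T : Geometry.SimplicialComplex ℝ Plane) (v : Plane → ℝ) (x : Plane) : ℝ :=
  if h : ∃ K ∈ elements T, x ∈ tri K then nodalAffine h.choose v x else 0

theorem interp_eq (hK : K ∈ elements T) (hx : x ∈ tri K) :
    interp T v x = nodalAffine K v x := by
  have h : ∃ K ∈ elements T, x ∈ tri K := ⟨K, hK, hx⟩
  rw [interp, dif_pos h]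
  refine eqOn_inter_tri h.choose_spec.1 hK (fun p hp hp' => ?_) ⟨h.choose_spec.2, hx⟩
  rw [(isFullSimplex_of_mem_elements h.choose_spec.1).nodalAffine_vertex v hp,
    (isFullSimplex_of_mem_elements hK).nodalAffine_vertex v hp']

end Triangulation

section FiniteClosedCover

variable {E F : Type*} [NormedAddCommGroup E] [NormedSpace ℝ E] [PseudoMetricSpace F]
  {f : E → F} {L : ℝ≥0} {ι : Type*} [Finite ι] {s : ι → Set E}

theorem dist_le_of_segment_subset_iUnion (hs : ∀ i, IsClosed (s i))
    (hf : ∀ i, LipschitzOnWith L f (s i)) {a b : E} (hab : segment ℝ a b ⊆ ⋃ i, s i) :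
    dist (f a) (f b) ≤ L * dist a b := by
  let γ : ℝ → E := fun t => AffineMap.lineMap a b t
  have hγ : Continuous γ := AffineMap.lineMap_continuous
  have hγs : ∀ t ∈ Icc (0 : ℝ) 1, ∃ i, γ t ∈ s i := fun t ht =>
    mem_iUnion.1 (hab (segment_eq_image_lineMap ℝ a b ▸ mem_image_of_mem _ ht))
  have hcont : ContinuousOn (f ∘ γ) (Icc 0 1) :=
    ((locallyFinite_of_finite s).continuousOn_iUnion hs fun i => (hf i).continuousOn).comp
      hγ.continuousOn fun t ht => mem_iUnion.2 (hγs t ht)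
  have hslope : ∀ t ∈ Ico (0 : ℝ) 1, ∀ r, L * dist a b < r →
      ∃ᶠ z in 𝓝[>] t, slope (fun t => dist (f (γ t)) (f a)) t z < r := by
    intro t ht r hr
    obtain ⟨i, hi⟩ : ∃ i, ∃ᶠ z in 𝓝[>] t, γ z ∈ s i := by
      by_contra! hnone
      obtain ⟨z, hz, hz'⟩ := ((eventually_all.2 hnone).and (Ioo_mem_nhdsGT ht.2)).exists
      obtain ⟨i, hi⟩ := hγs z ⟨ht.1.trans hz'.1.le, hz'.2.le⟩
      exact hz i hi
    have hti : γ t ∈ s i :=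
      (hs i).mem_of_frequently_of_tendsto hi (hγ.continuousWithinAt (s := Ioi t) (x := t))
    refine (hi.and_eventually self_mem_nhdsWithin).mono fun z hz => lt_of_le_of_lt ?_ hr
    have hzt : 0 < z - t := sub_pos.2 hz.2
    rw [slope_def_field, div_le_iff₀ hzt]
    calc dist (f (γ z)) (f a) - dist (f (γ t)) (f a) ≤ dist (f (γ z)) (f (γ t)) := by
          linarith [dist_triangle (f (γ z)) (f (γ t)) (f a)]
      _ ≤ L * dist (γ z) (γ t) := (hf i).dist_le_mul _ hz.1 _ hti
      _ = L * dist a b * (z - t) := by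
          rw [dist_lineMap_lineMap, Real.dist_eq, abs_of_pos hzt]; ring
  have hderiv : ∀ t, HasDerivAt (fun t => L * dist a b * t) (L * dist a b) t := fun t => by
    simpa using (hasDerivAt_id t).const_mul (L * dist a b)
  have hbound := image_le_of_liminf_slope_right_le_deriv_boundary
    (continuous_dist.comp_continuousOn (hcont.prodMk continuousOn_const))
    (B := fun t => L * dist a b * t) (by simp [γ]) (by fun_prop)
    (fun t _ => (hderiv t).hasDerivWithinAt) hslope (right_mem_Icc.2 zero_le_one)
  simpa [γ, dist_comm (f b)] using hbound

theorem PolyPath.dist_map_le {S : Set E} {x y : E} {ℓ : ℝ} (h : PolyPath S x y ℓ)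
    (hseg : ∀ a b, segment ℝ a b ⊆ S → dist (f a) (f b) ≤ L * dist a b) :
    dist (f x) (f y) ≤ L * ℓ := by
  induction h with
  | refl => simp
  | @step y z ℓ _ hs ih => linarith [dist_triangle (f x) (f y) (f z), hseg y z hs]

theorem IsQuasiconvex.lipschitzOnWith_of_subset_iUnion {S : Set E} {C : ℝ≥0}
    (hS : IsQuasiconvex S C) (hs : ∀ i, IsClosed (s i)) (hf : ∀ i, LipschitzOnWith L f (s i))
    (hcover : S ⊆ ⋃ i, s i) : LipschitzOnWith (L * C) f S := by
  refine LipschitzOnWith.of_dist_le_mul fun x hx y hy => ?_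
  obtain ⟨ℓ, hℓ, hpath⟩ := hS x hx y hy
  calc dist (f x) (f y) ≤ L * ℓ := hpath.dist_map_le fun a b hab =>
        dist_le_of_segment_subset_iUnion hs hf (hab.trans hcover)
    _ ≤ L * (C * dist x y) := by gcongr
    _ = ↑(L * C) * dist x y := by push_cast; ring

end FiniteClosedCover

section Interpolant

variable {Ω : Set Plane} {T : Geometry.SimplicialComplex ℝ Plane} {K : Finset Plane}
  {p x : Plane} {v : Plane → ℝ}

theorem continuous_affine (A : Plane →ᵃ[ℝ] ℝ) : Continuous A :=
  A.continuous_of_finiteDimensional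

theorem IsTriangulation.exists_lipschitzWith_interp (hT : IsTriangulation Ω T) {C : ℝ≥0}
    (hΩ : IsQuasiconvex Ω C) (v : Plane → ℝ) :
    ∃ (w : Plane → ℝ) (L : ℝ≥0), LipschitzWith L w ∧ EqOn w (interp T v) (closure Ω) := by
  have : Finite (elements T) := hT.finite_elements
  have hcover : closure Ω = ⋃ K : elements T, tri K.1 := by rw [hT.closure_eq, biUnion_eq_iUnion]
  have hclosed : ∀ K : elements T, IsClosed (tri K.1) := fun K => isClosed_tri K.1
  obtain ⟨L, hL⟩ := (finite_range fun K : elements T => ‖affGrad (nodalAffine K.1 v)‖₊).bddAbove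
  have hLip : ∀ K : elements T, LipschitzOnWith L (interp T v) (tri K.1) := fun K =>
    LipschitzOnWith.of_dist_le_mul fun x hx y hy => by
      rw [interp_eq K.2 hx, interp_eq K.2 hy, dist_comm, Real.dist_eq]
      refine (abs_affine_sub_le _ x y).trans ?_
      gcongr
      exact hL (mem_range_self K)
  have hcont : ContinuousOn (interp T v) (closure Ω) := hcover ▸
    (locallyFinite_of_finite _).continuousOn_iUnion hclosed fun K => (hLip K).continuousOn
  obtain ⟨w, hw, heq⟩ := (hΩ.lipschitzOnWith_of_subset_iUnion hclosed hLip
    (hcover ▸ subset_closure)).extend_real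
  exact ⟨w, _, hw, (heq.of_subset_closure hcont hw.continuous.continuousOn subset_closure
    subset_rfl).symm⟩

/-- `w ∈ X_h` is the piecewise affine interpolant of the values of `v` at the vertices of `T`. -/
structure IsNodalInterpolant (T : Geometry.SimplicialComplex ℝ Plane) (v : Plane → ℝ)
    (w : H1 Ω) : Prop where
  continuousOn : ContinuousOn w (closure Ω)
  eqOn : ∀ K ∈ elements T, EqOn w (nodalAffine K v) (tri K)
  grad_eq : ∀ K ∈ elements T, ∀ x ∈ interior (tri K), w.grad x = affGrad (nodalAffine K v)

theorem IsNodalInterpolant.isFEFunction {w : H1 Ω} (hw : IsNodalInterpolant T v w) :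
    IsFEFunction T w :=
  ⟨hw.continuousOn, fun K hK => ⟨_, hw.eqOn K hK⟩⟩

theorem IsNodalInterpolant.apply_vertex {w : H1 Ω} (hw : IsNodalInterpolant T v w)
    (hT : IsTriangulation Ω T) (hp : p ∈ T.vertices) : w p = v p := by
  obtain ⟨K, hK, hpK⟩ := hT.exists_element_of_vertex hp
  exact (hw.eqOn K hK (vertex_mem_tri hpK)).trans
    ((isFullSimplex_of_mem_elements hK).nodalAffine_vertex v hpK)

theorem bary_lineMap (K : Finset Plane) (q p x : Plane) (t : ℝ) :
    bary K q (AffineMap.lineMap p x t) = (1 - t) * bary K q p + t * bary K q x := by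
  rw [AffineMap.apply_lineMap, AffineMap.lineMap_apply_module, smul_eq_mul, smul_eq_mul]

theorem bary_pos_of_lineMap_mem_tri {K' : Finset Plane} {t : ℝ} (hK : K ∈ elements T)
    (hK' : K' ∈ elements T) (hp : p ∈ K) (hx : x ∈ tri K) (hpos : 0 < bary K p x)
    (ht : t ∈ Ioo (0 : ℝ) 1) (hy : AffineMap.lineMap p x t ∈ tri K') :
    p ∈ K' ∧ 0 < bary K' p x := by
  have hyK : AffineMap.lineMap p x t ∈ tri K := (convex_convexHull ℝ (K : Set Plane)).lineMap_mem
    (vertex_mem_tri hp) hx (Ioo_subset_Icc_self ht)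
  have hbary := bary_eqOn_inter_tri hK hK' p ⟨hyK, hy⟩
  rw [bary_lineMap, bary_lineMap, (isFullSimplex_of_mem_elements hK).bary_self hp] at hbary
  have htx : 0 < t * bary K p x := mul_pos ht.1 hpos
  have hpK' : p ∈ K' := by
    by_contra hpK'
    have hzero : ∀ z, bary K' p z = 0 := fun z => by simp [bary, hpK']
    rw [hzero, hzero] at hbary
    linarith [ht.2]
  refine ⟨hpK', pos_of_mul_pos_right (a := t) ?_ ht.1.le⟩
  rw [(isFullSimplex_of_mem_elements hK').bary_self hpK'] at hbary
  linarith

/-- The open star of an interior vertex lies in the domain: for `y` on the segment from the vertex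
`p` to `x`, close to `p`, the elements near `y` all contain `p`, and homothety at `p` carries a
neighbourhood of `y` covered by them to a neighbourhood of `x`. -/
theorem mem_of_bary_pos (ho : IsOpen Ω) (hΩ : HasLipschitzBoundary Ω) (hT : IsTriangulation Ω T)
    (hK : K ∈ elements T) (hp : p ∈ K) (hpΩ : p ∈ Ω) (hx : x ∈ tri K) (hpos : 0 < bary K p x) :
    x ∈ Ω := by
  let y (z : Plane) (t : ℝ) : Plane := AffineMap.lineMap p z t
  obtain ⟨t, ht, hyΩ⟩ : ∃ t ∈ Ioo (0 : ℝ) 1, y x t ∈ Ω := by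
    have hy : Tendsto (y x) (𝓝[>] 0) (𝓝 p) :=
      (AffineMap.lineMap_continuous.tendsto' _ _ (AffineMap.lineMap_apply_zero p x)).mono_left
        nhdsWithin_le_nhds
    have hnear : ∀ᶠ t in 𝓝[>] (0 : ℝ), t ∈ Ioo (0 : ℝ) 1 := Ioo_mem_nhdsGT zero_lt_one
    exact (hnear.and (hy.eventually (ho.mem_nhds hpΩ))).exists
  have hy : Continuous fun z => y z t := by
    simp only [y, AffineMap.lineMap_apply_module]
    fun_prop
  refine interior_closure_subset hΩ (mem_interior_iff_mem_nhds.2 ?_)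
  have hlocal : ∀ᶠ z in 𝓝 x, ∀ K' ∈ elements T, y z t ∈ tri K' → p ∈ K' ∧ 0 < bary K' p z := by
    refine (eventually_all_finite hT.finite_elements).2 fun K' hK' => ?_
    by_cases hyK' : y x t ∈ tri K'
    · obtain ⟨hpK', hposK'⟩ := bary_pos_of_lineMap_mem_tri hK hK' hp hx hpos ht hyK'
      filter_upwards [(continuous_affine (bary K' p)).continuousAt.eventually_const_lt hposK']
        with z hz _ using ⟨hpK', hz⟩
    · filter_upwards [hy.continuousAt.eventually ((isClosed_tri K').isOpen_compl.mem_nhds hyK')]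
        with z hz hz' using absurd hz' hz
  filter_upwards [hlocal, hy.continuousAt.eventually (ho.mem_nhds hyΩ)] with z hz hzΩ
  obtain ⟨K', hK', hzK'⟩ := hT.exists_mem_tri (subset_closure hzΩ)
  obtain ⟨hpK', hpz⟩ := hz K' hK' hzK'
  have hsimplex := isFullSimplex_of_mem_elements hK'
  refine hT.tri_subset hK' (hsimplex.mem_convexHull_iff.2 fun q hq => ?_)
  rcases eq_or_ne q p with rfl | hqp
  · exact hpz.le
  · have hqy := hsimplex.mem_convexHull_iff.1 hzK' q hq
    rw [bary_lineMap, hsimplex.bary_ne hpK' hqp, mul_zero, zero_add] at hqy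
    exact nonneg_of_mul_nonneg_right hqy ht.1

theorem interp_eq_zero_of_mem_frontier (ho : IsOpen Ω) (hΩ : HasLipschitzBoundary Ω)
    (hT : IsTriangulation Ω T) (hv : ∀ p ∈ T.vertices, p ∈ frontier Ω → v p = 0)
    (hx : x ∈ frontier Ω) : interp T v x = 0 := by
  obtain ⟨K, hK, hxK⟩ := hT.exists_mem_tri hx.1
  rw [interp_eq hK hxK, nodalAffine_apply]
  refine Finset.sum_eq_zero fun p hp => ?_
  rcases ((isFullSimplex_of_mem_elements hK).mem_convexHull_iff.1 hxK p hp).eq_or_lt with h | h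
  · rw [← h, mul_zero]
  · have hpf : p ∈ frontier Ω := by
      rw [ho.frontier_eq] at hx ⊢
      exact ⟨hT.tri_subset hK (vertex_mem_tri hp), fun hpΩ =>
        hx.2 (mem_of_bary_pos ho hΩ hT hK hp hpΩ hxK h)⟩
    rw [hv p (mem_vertices_of_mem_element hK hp) hpf, zero_mul]

theorem exists_isNodalInterpolant (ho : IsOpen Ω) (hb : Bornology.IsBounded Ω)
    (hΩ : HasLipschitzBoundary Ω) {C : ℝ≥0} (hC : IsQuasiconvex Ω C) (hT : IsTriangulation Ω T)
    (v : Plane → ℝ) :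
    ∃ w : H1 Ω, IsNodalInterpolant T v w ∧
      ((∀ p ∈ T.vertices, p ∈ frontier Ω → v p = 0) → IsH10 w) := by
  obtain ⟨w, L, hw, heq⟩ := hT.exists_lipschitzWith_interp hC v
  have hval : ∀ K ∈ elements T, EqOn w (nodalAffine K v) (tri K) := fun K hK x hx => by
    rw [heq (hT.tri_subset hK hx), interp_eq hK hx]
  refine ⟨H1.ofLipschitz ho hb hw, ⟨hw.continuous.continuousOn, hval, fun K hK x hx => ?_⟩,
    fun hv => isH10_ofLipschitz ho hb hw fun x hx => ?_⟩
  · have hev : w =ᶠ[𝓝 x] nodalAffine K v :=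
      eventually_of_mem (mem_interior_iff_mem_nhds.1 hx) (hval K hK)
    exact hev.gradient_eq.trans (hasGradientAt_affine _ x).gradient
  · rw [heq (frontier_subset_closure hx), interp_eq_zero_of_mem_frontier ho hΩ hT hv hx]

end Interpolant

/-! ### The maximum angle condition -/

section Area

open Module

variable {E : Type*} [NormedAddCommGroup E] [InnerProductSpace ℝ E] [Fact (finrank ℝ E = 2)]
  (o : Orientation ℝ E (Fin 2))

theorem norm_mul_abs_areaForm_le (d a b : E) :
    ‖d‖ * |o.areaForm a b| ≤ |inner ℝ d a| * ‖b‖ + |inner ℝ d b| * ‖a‖ := by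
  rcases eq_or_ne d 0 with rfl | hd
  · simp
  refine le_of_mul_le_mul_left ?_ (norm_pos_iff.2 hd)
  calc ‖d‖ * (‖d‖ * |o.areaForm a b|)
      = |inner ℝ d a * o.areaForm d b - o.areaForm d a * inner ℝ d b| := by
        rw [o.inner_mul_areaForm_sub, abs_mul, abs_of_nonneg (sq_nonneg ‖d‖)]; ring
    _ ≤ |inner ℝ d a| * (‖d‖ * ‖b‖) + ‖d‖ * ‖a‖ * |inner ℝ d b| := by
        refine (abs_sub _ _).trans ?_
        rw [abs_mul, abs_mul]
        gcongr <;> exact o.abs_areaForm_le _ _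
    _ = ‖d‖ * (|inner ℝ d a| * ‖b‖ + |inner ℝ d b| * ‖a‖) := by ring

theorem abs_areaForm_eq_norm_mul_sin (a b : E) :
    |o.areaForm a b| = ‖a‖ * ‖b‖ * Real.sin (InnerProductGeometry.angle a b) := by
  rw [← abs_of_nonneg (mul_nonneg (mul_nonneg (norm_nonneg a) (norm_nonneg b))
    (InnerProductGeometry.sin_angle_nonneg a b)), ← sq_eq_sq_iff_abs_eq_abs, mul_pow, mul_pow,
    Real.sin_sq, eq_sub_of_add_eq' (o.inner_sq_add_areaForm_sq a b),
    ← InnerProductGeometry.cos_angle_mul_norm_mul_norm a b]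
  ring

include o in
theorem norm_mul_sin_angle_le {d a b : E} {e : ℝ} (ha₀ : a ≠ 0) (hb₀ : b ≠ 0)
    (ha : |inner ℝ d a| ≤ e * ‖a‖) (hb : |inner ℝ d b| ≤ e * ‖b‖) :
    ‖d‖ * Real.sin (InnerProductGeometry.angle a b) ≤ 2 * e := by
  have hab : 0 < ‖a‖ * ‖b‖ := mul_pos (norm_pos_iff.2 ha₀) (norm_pos_iff.2 hb₀)
  refine le_of_mul_le_mul_left ?_ hab
  calc _ = ‖d‖ * |o.areaForm a b| := by rw [abs_areaForm_eq_norm_mul_sin]; ring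
    _ ≤ e * ‖a‖ * ‖b‖ + e * ‖b‖ * ‖a‖ := (norm_mul_abs_areaForm_le o d a b).trans (by gcongr)
    _ = _ := by ring

end Area

theorem exists_angle_eq_maxAngle {K : Finset Plane} (hK : K.card = 3) :
    ∃ p ∈ K, ∃ q ∈ K, ∃ r ∈ K, p ≠ q ∧ r ≠ q ∧ EuclideanGeometry.angle p q r = maxAngle K ∧
      Real.pi / 3 ≤ maxAngle K := by
  classical
  obtain ⟨a, b, c, hab, hac, hbc, rfl⟩ := Finset.card_eq_three.1 hK
  set K : Finset Plane := {a, b, c} with hKdef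
  have ha : a ∈ K := by simp [hKdef]
  have hb : b ∈ K := by simp [hKdef]
  have hc : c ∈ K := by simp [hKdef]
  let S : Set ℝ := {θ | ∃ p ∈ K, ∃ q ∈ K, ∃ r ∈ K, p ≠ q ∧ q ≠ r ∧ p ≠ r ∧
    θ = EuclideanGeometry.angle p q r}
  have hfin : S.Finite := by
    refine (((K ×ˢ K ×ˢ K).finite_toSet).image
      fun t => EuclideanGeometry.angle t.1 t.2.1 t.2.2).subset ?_
    rintro θ ⟨p, hp, q, hq, r, hr, -, -, -, rfl⟩
    exact ⟨(p, q, r), by simp [hp, hq, hr], rfl⟩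
  have hb_mem : EuclideanGeometry.angle a b c ∈ S := ⟨a, ha, b, hb, c, hc, hab, hbc, hac, rfl⟩
  have hc_mem : EuclideanGeometry.angle b c a ∈ S :=
    ⟨b, hb, c, hc, a, ha, hbc, hac.symm, hab.symm, rfl⟩
  have ha_mem : EuclideanGeometry.angle c a b ∈ S :=
    ⟨c, hc, a, ha, b, hb, hac.symm, hab, hbc.symm, rfl⟩
  have hle : ∀ θ ∈ S, θ ≤ maxAngle K := fun θ => le_csSup hfin.bddAbove
  have hsum := EuclideanGeometry.angle_add_angle_add_angle_eq_pi (p₁ := a) (p₂ := b) c hab.symm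
  obtain ⟨p, hp, q, hq, r, hr, hpq, hqr, -, hangle⟩ :=
    show maxAngle K ∈ S from Set.Nonempty.csSup_mem ⟨_, ha_mem⟩ hfin
  exact ⟨p, hp, q, hq, r, hr, hpq, hqr.symm, hangle.symm,
    by linarith [hle _ ha_mem, hle _ hb_mem, hle _ hc_mem]⟩

section EdgeStable

variable {E : Type*} [NormedAddCommGroup E] [InnerProductSpace ℝ E]

/-- The norm of a vector is at most `c` times its largest component along an edge joining two
points of `K`. -/
def IsEdgeStable (K : Finset E) (c : ℝ) : Prop :=
  ∀ (d : E) (e : ℝ), (∀ p ∈ K, ∀ q ∈ K, |inner ℝ d (q - p)| ≤ e * dist p q) → ‖d‖ ≤ c * e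

theorem IsEdgeStable.norm_sub_affGrad_le [FiniteDimensional ℝ E] {K : Finset E} {c : ℝ}
    (hK : IsEdgeStable K c) {S : Set E} {v : E → ℝ} {G : E → E} {L h : ℝ} (hv : IsJet S v G L)
    (hL : 0 ≤ L) (hKS : convexHull ℝ (K : Set E) ⊆ S)
    (hh : ∀ x ∈ convexHull ℝ (K : Set E), ∀ y ∈ convexHull ℝ (K : Set E), dist x y ≤ h)
    {A : E →ᵃ[ℝ] ℝ} (hA : ∀ p ∈ K, A p = v p) {x : E} (hx : x ∈ convexHull ℝ (K : Set E)) :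
    ‖G x - affGrad A‖ ≤ c * (2 * L * h) := by
  rw [norm_sub_rev]
  refine hK _ _ fun p hp q hq => ?_
  have hp' := subset_convexHull ℝ _ hp
  have hq' := subset_convexHull ℝ _ hq
  have hsplit : inner ℝ (affGrad A - G x) (q - p) =
      (v q - v p - inner ℝ (G p) (q - p)) + inner ℝ (G p - G x) (q - p) := by
    rw [inner_sub_left, ← affine_sub_eq, hA p hp, hA q hq, inner_sub_left]; ring
  rw [hsplit]
  calc _ ≤ L * dist p q ^ 2 + L * dist x p * dist p q := by
        refine (abs_add_le _ _).trans (add_le_add (hv.taylor p (hKS hp') q (hKS hq')) ?_)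
        rw [dist_comm p q, dist_eq_norm q p]
        exact (abs_real_inner_le_norm _ _).trans
          (mul_le_mul_of_nonneg_right (hv.lipschitz x (hKS hx) p (hKS hp')) (norm_nonneg _))
    _ ≤ L * (h * dist p q) + L * h * dist p q := by
        rw [sq]
        gcongr
        · exact hh p hp' q hq'
        · exact hh x hx p hp'
    _ = 2 * L * h * dist p q := by ring

end EdgeStable

open scoped EuclideanSpace in
theorem exists_isEdgeStable {α₀ : ℝ} (hα₀ : α₀ < Real.pi) :
    ∃ c : ℝ, 0 < c ∧ ∀ K : Finset Plane, K.card = 3 → maxAngle K ≤ α₀ → IsEdgeStable K c := by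
  have hsin_pos : ∀ θ ∈ Icc (Real.pi / 3) α₀, 0 < Real.sin θ := fun θ hθ =>
    Real.sin_pos_of_pos_of_lt_pi ((div_pos Real.pi_pos three_pos).trans_le hθ.1)
      (hθ.2.trans_lt hα₀)
  obtain ⟨s, hs, hsin⟩ :=
    isCompact_Icc.exists_forall_le' Real.continuous_sin.continuousOn hsin_pos
  refine ⟨2 / s, by positivity, fun K hK hmax d e hd => ?_⟩
  obtain ⟨p, hp, q, hq, r, hr, hpq, hrq, hangle, hπ⟩ := exists_angle_eq_maxAngle hK
  have hedge : ∀ z ∈ K, |inner ℝ d (z -ᵥ q)| ≤ e * ‖z -ᵥ q‖ := fun z hz => by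
    simpa only [vsub_eq_sub, ← dist_eq_norm, dist_comm z q] using hd q hq z hz
  rw [div_mul_eq_mul_div, le_div_iff₀ hs]
  calc ‖d‖ * s ≤ ‖d‖ * Real.sin (EuclideanGeometry.angle p q r) := by
        gcongr
        exact hangle ▸ hsin _ ⟨hπ, hmax⟩
    _ ≤ 2 * e := norm_mul_sin_angle_le (EuclideanSpace.basisFun (Fin 2) ℝ).toBasis.orientation
        (vsub_ne_zero.2 hpq) (vsub_ne_zero.2 hrq) (hedge p hp) (hedge r hr)

/-! ### Cutoffs of jets -/

section JetAlgebra

variable {E : Type*} [NormedAddCommGroup E] [InnerProductSpace ℝ E] {S : Set E} {f g : E → ℝ}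
  {F G : E → E} {L M : ℝ}

theorem IsJet.mono_const (h : IsJet S f F L) (hL : L ≤ M) : IsJet S f F M where
  taylor x hx y hy := (h.taylor x hx y hy).trans (by gcongr)
  lipschitz x hx y hy := (h.lipschitz x hx y hy).trans (by gcongr)

theorem IsJet.abs_sub_le (h : IsJet S f F L) {x y : E} (hx : x ∈ S) (hy : y ∈ S) :
    |f y - f x| ≤ (‖F x‖ + L * dist x y) * dist x y := by
  calc |f y - f x| = |(f y - f x - inner ℝ (F x) (y - x)) + inner ℝ (F x) (y - x)| := by ring_nf
    _ ≤ L * dist x y ^ 2 + ‖F x‖ * dist x y := by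
        refine (abs_add_le _ _).trans (add_le_add (h.taylor x hx y hy) ?_)
        rw [dist_comm, dist_eq_norm]
        exact abs_real_inner_le_norm _ _
    _ = _ := by ring

theorem IsJet.norm_le_add (h : IsJet S f F L) {x y : E} (hx : x ∈ S) (hy : y ∈ S) :
    ‖F y‖ ≤ ‖F x‖ + L * dist x y :=
  norm_le_norm_add_norm_sub (F x) (F y) |>.trans
    (add_le_add_right ((norm_sub_rev _ _).le.trans (h.lipschitz x hx y hy)) _)

theorem IsJet.sub (hf : IsJet S f F L) (hg : IsJet S g G M) :
    IsJet S (fun x => f x - g x) (fun x => F x - G x) (L + M) where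
  taylor x hx y hy := by
    have hsplit : f y - g y - (f x - g x) - inner ℝ (F x - G x) (y - x) =
        (f y - f x - inner ℝ (F x) (y - x)) - (g y - g x - inner ℝ (G x) (y - x)) := by
      rw [inner_sub_left]; ring
    rw [hsplit, add_mul]
    exact (abs_sub _ _).trans (add_le_add (hf.taylor x hx y hy) (hg.taylor x hx y hy))
  lipschitz x hx y hy := by
    rw [sub_sub_sub_comm, add_mul]
    exact (norm_sub_le _ _).trans (add_le_add (hf.lipschitz x hx y hy) (hg.lipschitz x hx y hy))

theorem IsJet.sub_affine [FiniteDimensional ℝ E] (hf : IsJet S f F L) (A : E →ᵃ[ℝ] ℝ) :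
    IsJet S (fun x => f x - A x) (fun x => F x - affGrad A) L := by
  have hA : IsJet S A (fun _ => affGrad A) 0 :=
    ⟨fun x _ y _ => by rw [affine_sub_eq]; simp, fun x _ y _ => by simp⟩
  simpa only [add_zero] using hf.sub hA

theorem IsJet.mul (hf : IsJet S f F L) (hg : IsJet S g G M) {a b p q : ℝ}
    (hfa : ∀ x ∈ S, |f x| ≤ a) (hgb : ∀ x ∈ S, |g x| ≤ b)
    (hFp : ∀ x ∈ S, ‖F x‖ ≤ p) (hGq : ∀ x ∈ S, ‖G x‖ ≤ q)
    (hfp : ∀ x ∈ S, ∀ y ∈ S, |f y - f x| ≤ p * dist x y)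
    (hgq : ∀ x ∈ S, ∀ y ∈ S, |g y - g x| ≤ q * dist x y) :
    IsJet S (fun x => f x * g x) (fun x => f x • G x + g x • F x)
      (a * M + b * L + 2 * (p * q)) := by
  refine ⟨fun x hx y hy => ?_, fun x hx y hy => ?_⟩ <;>
    have ha : 0 ≤ a := (abs_nonneg _).trans (hfa x hx) <;>
    have hb : 0 ≤ b := (abs_nonneg _).trans (hgb x hx) <;>
    have hp : 0 ≤ p := (norm_nonneg _).trans (hFp x hx) <;>
    have hq : 0 ≤ q := (norm_nonneg _).trans (hGq x hx)
  · have hsplit : f y * g y - f x * g x - inner ℝ (f x • G x + g x • F x) (y - x) =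
        f x * (g y - g x - inner ℝ (G x) (y - x)) + g x * (f y - f x - inner ℝ (F x) (y - x)) +
          (f y - f x) * (g y - g x) := by
      rw [inner_add_left, real_inner_smul_left, real_inner_smul_left]; ring
    rw [hsplit]
    calc _ ≤ a * (M * dist x y ^ 2) + b * (L * dist x y ^ 2) +
          (p * dist x y) * (q * dist x y) := by
          refine (abs_add_three _ _ _).trans ?_
          rw [abs_mul, abs_mul, abs_mul]
          gcongr
          exacts [hfa x hx, hg.taylor x hx y hy, hgb x hx, hf.taylor x hx y hy, hfp x hx y hy,
            hgq x hx y hy]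
      _ ≤ _ := by
          have : 0 ≤ p * q * dist x y ^ 2 := by positivity
          linarith
  · have hsplit : f y • G y + g y • F y - (f x • G x + g x • F x) =
        (f y • (G y - G x) + g y • (F y - F x)) + ((f y - f x) • G x + (g y - g x) • F x) := by
      module
    rw [hsplit]
    calc _ ≤ (a * (M * dist x y) + b * (L * dist x y)) +
          (p * dist x y * q + q * dist x y * p) := by
          refine (norm_add_le _ _).trans
            (add_le_add (norm_add_le _ _) (norm_add_le _ _) |>.trans ?_)
          rw [norm_smul, norm_smul, norm_smul, norm_smul]
          gcongr
          exacts [hfa y hy, hg.lipschitz x hx y hy, hgb y hy, hf.lipschitz x hx y hy,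
            hfp x hx y hy, hGq x hx, hgq x hx y hy, hFp x hx]
      _ = _ := by ring

theorem IsJet.of_eq_zero_of_notMem {U : Set E} (h : IsJet (S ∩ U) f F L) (hL : 0 ≤ L)
    (hf : ∀ x ∉ U, f x = 0) (hF : ∀ x ∉ U, F x = 0)
    (hf_le : ∀ x ∈ S ∩ U, ∀ y ∉ U, |f x| ≤ L / 2 * dist x y ^ 2)
    (hF_le : ∀ x ∈ S ∩ U, ∀ y ∉ U, ‖F x‖ ≤ L / 2 * dist x y) : IsJet S f F L where
  taylor x hx y hy := by
    by_cases hxU : x ∈ U <;> by_cases hyU : y ∈ U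
    · exact h.taylor x ⟨hx, hxU⟩ y ⟨hy, hyU⟩
    · rw [hf y hyU, zero_sub, ← neg_add', abs_neg]
      calc _ ≤ L / 2 * dist x y ^ 2 + L / 2 * dist x y * dist x y := by
            refine (abs_add_le _ _).trans (add_le_add (hf_le x ⟨hx, hxU⟩ y hyU) ?_)
            refine (abs_real_inner_le_norm _ _).trans ?_
            rw [← dist_eq_norm y x, dist_comm y x]
            gcongr
            exact hF_le x ⟨hx, hxU⟩ y hyU
        _ = _ := by ring
    · rw [hf x hxU, hF x hxU, inner_zero_left, sub_zero, sub_zero, dist_comm]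
      refine (hf_le y ⟨hy, hyU⟩ x hxU).trans ?_
      gcongr
      exact half_le_self hL
    · rw [hf x hxU, hF x hxU, hf y hyU, inner_zero_left, sub_zero, sub_zero, abs_zero]
      positivity
  lipschitz x hx y hy := by
    have hhalf : L / 2 * dist x y ≤ L * dist x y := by gcongr; exact half_le_self hL
    by_cases hxU : x ∈ U <;> by_cases hyU : y ∈ U
    · exact h.lipschitz x ⟨hx, hxU⟩ y ⟨hy, hyU⟩
    · rw [hF y hyU, zero_sub, norm_neg]
      exact (hF_le x ⟨hx, hxU⟩ y hyU).trans hhalf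
    · rw [hF x hxU, sub_zero, dist_comm]
      exact (hF_le y ⟨hy, hyU⟩ x hxU).trans (dist_comm x y ▸ hhalf)
    · rw [hF x hxU, hF y hyU, sub_zero, norm_zero]
      positivity

theorem sum_le_two_mul_of_pairwise_disjoint {ι α : Type*} [Fintype ι] {S : ι → Set α}
    (hS : Pairwise fun i j => Disjoint (S i) (S j)) (x y : α) {b : ℝ} (hb : 0 ≤ b) {t : ι → ℝ}
    (ht : ∀ i, t i ≤ b) (ht₀ : ∀ i, x ∉ S i → y ∉ S i → t i ≤ 0) : ∑ i, t i ≤ 2 * b := by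
  classical
  have hcard (z : α) : (Finset.univ.filter fun i => z ∈ S i).card ≤ 1 :=
    Finset.card_le_one.2 fun i hi j hj => by
      by_contra hij
      exact Set.disjoint_left.1 (hS hij) (Finset.mem_filter.1 hi).2 (Finset.mem_filter.1 hj).2
  have hcard₂ : (Finset.univ.filter fun i => x ∈ S i ∨ y ∈ S i).card ≤ 2 := by
    rw [Finset.filter_or]
    exact (Finset.card_union_le _ _).trans (add_le_add (hcard x) (hcard y))
  calc ∑ i, t i ≤ ∑ i with x ∈ S i ∨ y ∈ S i, b := by
        rw [Finset.sum_filter]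
        refine Finset.sum_le_sum fun i _ => ?_
        split_ifs with hi
        · exact ht i
        · exact ht₀ i (fun h => hi (.inl h)) fun h => hi (.inr h)
    _ ≤ 2 * b := by
        rw [Finset.sum_const, nsmul_eq_mul]
        gcongr
        exact_mod_cast hcard₂

theorem IsJet.sum {ι : Type*} [Fintype ι] {U : ι → Set E}
    (hU : Pairwise fun i j => Disjoint (U i) (U j)) {f : ι → E → ℝ} {F : ι → E → E} (hL : 0 ≤ L)
    (h : ∀ i, IsJet S (f i) (F i) L) (hf : ∀ i, ∀ x ∉ U i, f i x = 0)
    (hF : ∀ i, ∀ x ∉ U i, F i x = 0) :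
    IsJet S (fun x => ∑ i, f i x) (fun x => ∑ i, F i x) (2 * L) where
  taylor x hx y hy := by
    have hsplit : ∑ i, f i y - ∑ i, f i x - inner ℝ (∑ i, F i x) (y - x) =
        ∑ i, (f i y - f i x - inner ℝ (F i x) (y - x)) := by
      rw [sum_inner, Finset.sum_sub_distrib, Finset.sum_sub_distrib]
    rw [hsplit, mul_assoc]
    refine (Finset.abs_sum_le_sum_abs _ _).trans (sum_le_two_mul_of_pairwise_disjoint hU x y
      (by positivity) (fun i => (h i).taylor x hx y hy) fun i hxi hyi => ?_)
    rw [hf i x hxi, hf i y hyi, hF i x hxi, inner_zero_left, sub_zero, sub_zero, abs_zero]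
  lipschitz x hx y hy := by
    rw [← Finset.sum_sub_distrib, mul_assoc]
    refine (norm_sum_le _ _).trans (sum_le_two_mul_of_pairwise_disjoint hU x y (by positivity)
      (fun i => (h i).lipschitz x hx y hy) fun i hxi hyi => ?_)
    rw [hF i x hxi, hF i y hyi, sub_zero, norm_zero]

end JetAlgebra

section Cutoff

variable {E : Type*} [NormedAddCommGroup E] [InnerProductSpace ℝ E] {η : E → ℝ} {H : E → E} {c : E}
  {r κ : ℝ}

/-- A cutoff function `η` with gradient `H`, equal to `1` on the ball of radius `r` about `c` and
vanishing outside the concentric ball of radius `2 * r`; `κ` measures its derivatives at scale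
`r`. -/
structure IsCutoff (η : E → ℝ) (H : E → E) (c : E) (r κ : ℝ) : Prop where
  abs_le_one : ∀ x, |η x| ≤ 1
  eq_one : ∀ x ∈ Metric.closedBall c r, η x = 1
  eq_zero : ∀ x ∉ Metric.ball c (2 * r), η x = 0
  grad_eq_zero : ∀ x ∉ Metric.ball c (2 * r), H x = 0
  norm_grad_le : ∀ x, ‖H x‖ ≤ κ / r
  abs_sub_le : ∀ x y, |η y - η x| ≤ κ / r * dist x y
  isJet : IsJet univ η H (κ / r ^ 2)

theorem IsCutoff.comp_smul_sub (hη : IsCutoff η H 0 1 κ) (c : E) (hr : 0 < r) :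
    IsCutoff (fun x => η (r⁻¹ • (x - c))) (fun x => r⁻¹ • H (r⁻¹ • (x - c))) c r κ := by
  have hdist (x y : E) : dist (r⁻¹ • (x - c)) (r⁻¹ • (y - c)) = dist x y / r := by
    rw [dist_smul₀, dist_sub_right, Real.norm_of_nonneg (inv_nonneg.2 hr.le), inv_mul_eq_div]
  have hdist_zero (x : E) : dist (r⁻¹ • (x - c)) 0 = dist x c / r := by
    simpa only [sub_self, smul_zero] using hdist x c
  have hout {x : E} (hx : x ∉ Metric.ball c (2 * r)) :
      r⁻¹ • (x - c) ∉ Metric.ball (0 : E) (2 * 1) := by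
    rwa [Metric.mem_ball, hdist_zero, div_lt_iff₀ hr, mul_one]
  refine ⟨fun x => hη.abs_le_one _, fun x hx => hη.eq_one _ ?_, fun x hx => hη.eq_zero _ (hout hx),
    fun x hx => ?_, fun x => ?_, fun x y => ?_, fun x _ y _ => ?_, fun x _ y _ => ?_⟩
  · rwa [Metric.mem_closedBall, hdist_zero, div_le_one hr]
  · rw [hη.grad_eq_zero _ (hout hx), smul_zero]
  · rw [norm_smul, Real.norm_of_nonneg (inv_nonneg.2 hr.le), inv_mul_eq_div]
    gcongr
    simpa only [div_one] using hη.norm_grad_le (r⁻¹ • (x - c))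
  · refine (hη.abs_sub_le _ _).trans_eq ?_
    rw [hdist]; ring
  · have h := hη.isJet.taylor (r⁻¹ • (x - c)) trivial (r⁻¹ • (y - c)) trivial
    rw [hdist, ← smul_sub, sub_sub_sub_cancel_right, real_inner_smul_right] at h
    rw [real_inner_smul_left]
    refine h.trans_eq ?_
    ring
  · rw [← smul_sub, norm_smul, Real.norm_of_nonneg (inv_nonneg.2 hr.le)]
    calc r⁻¹ * _ ≤ r⁻¹ * (κ / 1 ^ 2 * (dist x y / r)) := by
          rw [← hdist]
          gcongr
          exact hη.isJet.lipschitz _ trivial _ trivial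
      _ = _ := by ring

theorem exists_isCutoff (E : Type*) [NormedAddCommGroup E] [InnerProductSpace ℝ E]
    [FiniteDimensional ℝ E] : ∃ κ : ℝ, 0 < κ ∧ ∀ (c : E) (r : ℝ), 0 < r →
      ∃ η H, IsCutoff η H c r κ := by
  let b : ContDiffBump (0 : E) := ⟨1, 2, one_pos, one_lt_two⟩
  obtain ⟨K₁, hK₁⟩ := ContDiff.lipschitzWith_of_hasCompactSupport b.hasCompactSupport
    b.contDiff (n := 1) one_ne_zero
  obtain ⟨K₂, hK₂⟩ := ContDiff.lipschitzWith_of_hasCompactSupport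
    (b.hasCompactSupport.fderiv (𝕜 := ℝ)) (b.contDiff.fderiv_right (m := 1) (n := 2) le_rfl)
    one_ne_zero
  have hgrad : LipschitzWith K₂ (gradient b) :=
    one_mul K₂ ▸ (InnerProductSpace.toDual ℝ E).symm.lipschitz.comp hK₂
  have hzero : ∀ x ∉ Metric.ball (0 : E) (2 * 1), b x = 0 := fun x hx =>
    b.zero_of_le_dist (by simpa using hx)
  set κ : ℝ := K₁ + K₂ + 1 with hκ
  have hK₁κ : (K₁ : ℝ) ≤ κ := by linarith [K₂.2, hκ]
  have hK₂κ : (K₂ : ℝ) ≤ κ := by linarith [K₁.2, hκ]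
  refine ⟨κ, by positivity, fun c r hr => ⟨_, _, IsCutoff.comp_smul_sub (η := b) (H := gradient b)
    ⟨fun x => ?_, fun x hx => b.one_of_mem_closedBall hx, hzero, fun x hx => ?_, fun x => ?_,
      fun x y => ?_, isJet_of_hasGradientAt convex_univ (by positivity) (fun x _ => ?_)
      fun x _ y _ => ?_⟩ c hr⟩⟩
  · exact (abs_of_nonneg b.nonneg).trans_le b.le_one
  · have hmin : IsLocalMin b x := Eventually.of_forall fun y => hzero x hx ▸ b.nonneg
    rw [gradient, hmin.fderiv_eq_zero, map_zero]
  · rw [div_one]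
    exact (norm_gradient_le_of_lipschitz hK₁ x).trans hK₁κ
  · rw [div_one, dist_comm, ← Real.dist_eq]
    exact (hK₁.dist_le_mul y x).trans (by gcongr)
  · exact (b.contDiff.differentiable (n := 1) one_ne_zero x).hasGradientAt
  · rw [one_pow, div_one, dist_comm, ← dist_eq_norm]
    exact (hgrad.dist_le_mul y x).trans (by gcongr)

variable {S : Set E} {w : E → ℝ} {F : E → E} {B : ℝ}

theorem IsCutoff.isJet_mul_inter_ball (hη : IsCutoff η H c r κ) (hr : 0 < r) (hB : 0 ≤ B)
    (hw : IsJet S w F B) (hwB : ∀ x ∈ S ∩ Metric.ball c (2 * r), |w x| ≤ B * r ^ 2)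
    (hFB : ∀ x ∈ S ∩ Metric.ball c (2 * r), ‖F x‖ ≤ B * r) :
    IsJet (S ∩ Metric.ball c (2 * r)) (fun x => η x * w x) (fun x => η x • F x + w x • H x)
      ((1 + 11 * κ) * B) := by
  have hBr : 0 ≤ B * r := by positivity
  have hinc : ∀ x ∈ S ∩ Metric.ball c (2 * r), ∀ y ∈ S ∩ Metric.ball c (2 * r),
      |w y - w x| ≤ 5 * (B * r) * dist x y := fun x hx y hy => by
    have hxy : dist x y ≤ 4 * r := by
      linarith [dist_triangle_right x y c, Metric.mem_ball.1 hx.2, Metric.mem_ball.1 hy.2]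
    calc |w y - w x| ≤ (‖F x‖ + B * dist x y) * dist x y := hw.abs_sub_le hx.1 hy.1
      _ ≤ (B * r + B * (4 * r)) * dist x y := by
          gcongr
          exact hFB x hx
      _ = _ := by ring
  refine (IsJet.mul (p := κ / r) (q := 5 * (B * r)) ⟨fun x _ y _ => hη.isJet.taylor x trivial y
    trivial, fun x _ y _ => hη.isJet.lipschitz x trivial y trivial⟩ ⟨fun x hx y hy =>
    hw.taylor x hx.1 y hy.1, fun x hx y hy => hw.lipschitz x hx.1 y hy.1⟩
    (fun x _ => hη.abs_le_one x) hwB (fun x _ => hη.norm_grad_le x)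
    (fun x hx => (hFB x hx).trans (by linarith)) (fun x _ y _ => hη.abs_sub_le x y)
    hinc).mono_const (le_of_eq ?_)
  field

theorem IsCutoff.isJet_mul (hη : IsCutoff η H c r κ) (hr : 0 < r) (hκ : 0 ≤ κ) (hB : 0 ≤ B)
    (hw : IsJet S w F B) (hwB : ∀ x ∈ S ∩ Metric.ball c (2 * r), |w x| ≤ B * r ^ 2)
    (hFB : ∀ x ∈ S ∩ Metric.ball c (2 * r), ‖F x‖ ≤ B * r) :
    IsJet S (fun x => η x * w x) (fun x => η x • F x + w x • H x) ((1 + 11 * κ) * B) := by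
  refine (hη.isJet_mul_inter_ball hr hB hw hwB hFB).of_eq_zero_of_notMem (by positivity)
    (fun x hx => ?_) (fun x hx => ?_) (fun x hx y hy => ?_) fun x hx y hy => ?_
  · rw [hη.eq_zero x hx, zero_mul]
  · rw [hη.eq_zero x hx, hη.grad_eq_zero x hx, zero_smul, smul_zero, add_zero]
  · have hη_le : |η x| ≤ κ / r ^ 2 * dist x y ^ 2 := by
      simpa [hη.eq_zero y hy, hη.grad_eq_zero y hy, dist_comm y x] using
        hη.isJet.taylor y trivial x trivial
    calc |η x * w x| ≤ κ / r ^ 2 * dist x y ^ 2 * (B * r ^ 2) := by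
          rw [abs_mul]
          gcongr
          exact hwB x hx
      _ = 2 * κ * B / 2 * dist x y ^ 2 := by field
      _ ≤ _ := by gcongr; linarith
  · have hη_le : |η x| ≤ κ / r * dist x y := by
      simpa [hη.eq_zero y hy, dist_comm y x] using hη.abs_sub_le y x
    have hH_le : ‖H x‖ ≤ κ / r ^ 2 * dist x y := by
      simpa [hη.grad_eq_zero y hy, dist_comm y x] using hη.isJet.lipschitz y trivial x trivial
    calc ‖η x • F x + w x • H x‖ ≤
          κ / r * dist x y * (B * r) + B * r ^ 2 * (κ / r ^ 2 * dist x y) := by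
          refine (norm_add_le _ _).trans ?_
          rw [norm_smul, norm_smul, Real.norm_eq_abs, Real.norm_eq_abs]
          gcongr
          · exact hFB x hx
          · exact hwB x hx
      _ = 4 * κ * B / 2 * dist x y := by field
      _ ≤ _ := by gcongr; linarith

end Cutoff

/-! ### Functions vanishing on a polygonal boundary -/

section Frontier

variable {E : Type*} [NormedAddCommGroup E] [NormedSpace ℝ E]

theorem preperfect_frontier (hE : 1 < Module.rank ℝ E) {S : Set E} (hS : IsOpen S)
    (hcl : interior (closure S) ⊆ S) : Preperfect (frontier S) := by
  refine fun x hx => by_contra fun hacc => ?_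
  rw [hS.frontier_eq] at hx
  obtain ⟨ε, hε, hball⟩ := Metric.eventually_nhds_iff_ball.1
    (not_frequently.1 (accPt_iff_frequently.not.1 hacc))
  have hpunctured : OpenPartialHomeomorph.univBall x ε '' {0}ᶜ = Metric.ball x ε \ {x} := by
    have hinj : InjOn (OpenPartialHomeomorph.univBall x ε) univ := by
      simpa only [OpenPartialHomeomorph.univBall_source] using
        (OpenPartialHomeomorph.univBall x ε).injOn
    rw [compl_eq_univ_sdiff, image_sdiff (injOn_univ.1 hinj), image_singleton,
      OpenPartialHomeomorph.univBall_apply_zero, ← OpenPartialHomeomorph.univBall_target x hε,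
      ← OpenPartialHomeomorph.image_source_eq_target, OpenPartialHomeomorph.univBall_source]
  have hconn : IsPreconnected (Metric.ball x ε \ {x}) := hpunctured ▸
    (isConnected_compl_singleton_of_one_lt_rank hE 0).isPreconnected.image _
      (OpenPartialHomeomorph.continuous_univBall x ε).continuousOn
  obtain ⟨y, hyS, hyx⟩ := Metric.mem_closure_iff.1 hx.1 ε hε
  have hmem : y ∈ Metric.ball x ε \ {x} :=
    ⟨Metric.mem_ball'.2 hyx, fun h => hx.2 (mem_singleton_iff.1 h ▸ hyS)⟩
  have hsub : Metric.ball x ε \ {x} ⊆ S := fun z hz => by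
    by_contra hzS
    obtain ⟨w, hw, hwf⟩ := exists_mem_frontier_of_isPreconnected hconn hmem hyS hz hzS
    exact hball w hw.1 ⟨hw.2, hwf⟩
  refine hx.2 (hcl (mem_interior.2
    ⟨Metric.ball x ε, fun z hz => ?_, Metric.isOpen_ball, Metric.mem_ball_self hε⟩))
  rcases eq_or_ne z x with rfl | hzx
  · exact hx.1
  · exact subset_closure (hsub ⟨hz, hzx⟩)

theorem exists_nondegenerate_segment {S : Finset (E × E)} {x : E}
    (hx : AccPt x (𝓟 (⋃ e ∈ S, segment ℝ e.1 e.2))) :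
    ∃ e ∈ S, e.1 ≠ e.2 ∧ x ∈ segment ℝ e.1 e.2 := by
  obtain ⟨e, he, hacc⟩ : ∃ e ∈ S, AccPt x (𝓟 (segment ℝ e.1 e.2)) := by
    simp only [accPt_iff_frequently] at hx ⊢
    by_contra! hno
    refine hx (((eventually_all_finset S).2 hno).mono fun y hy hyS => ?_)
    obtain ⟨e, he, hye⟩ := mem_iUnion₂.1 hyS.2
    exact hy e he hyS.1 hye
  refine ⟨e, he, fun hdeg => ?_, isClosed_iff_accPt.1 ?_ x hacc⟩
  · rw [hdeg, segment_same] at hacc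
    exact Set.Infinite.of_accPt hacc (finite_singleton _)
  · rw [← convexHull_pair]
    exact ((toFinite _).isCompact_convexHull ℝ).isClosed

theorem exists_add_smul_mem_frontier {S : Set E} (hS : Bornology.IsBounded S) {x d : E}
    (hx : x ∈ S) (hd : d ≠ 0) : ∃ t : ℝ, 0 ≤ t ∧ x + t • d ∈ frontier S := by
  have hd' : 0 < ‖d‖ := norm_pos_iff.2 hd
  set τ := (Metric.diam S + 1) / ‖d‖ with hτ
  have hτ₀ : 0 ≤ τ := div_nonneg (add_nonneg Metric.diam_nonneg zero_le_one) hd'.le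
  have hout : x + τ • d ∉ S := fun h => by
    have hdist := Metric.dist_le_diam_of_mem hS h hx
    rw [dist_self_add_left, norm_smul, Real.norm_of_nonneg hτ₀, hτ,
      div_mul_cancel₀ _ hd'.ne'] at hdist
    linarith
  obtain ⟨z, hz, hzf⟩ := exists_mem_segment_frontier hx hout
  obtain ⟨s, hs, rfl⟩ := (segment_eq_image' ℝ x _ ▸ hz :)
  refine ⟨s * τ, mul_nonneg hs.1 hτ₀, ?_⟩
  simpa only [add_sub_cancel_left, smul_smul] using hzf

end Frontier

section Vanishing

variable {E : Type*} [NormedAddCommGroup E] [InnerProductSpace ℝ E] {S : Set E} {f : E → ℝ}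
  {G : E → E} {L : ℝ}

theorem IsJet.inner_sub_eq_zero (h : IsJet S f G L) {x y : E} (hxy : segment ℝ x y ⊆ S)
    (h0 : ∀ z ∈ segment ℝ x y, f z = 0) : inner ℝ (G x) (y - x) = 0 := by
  have hx := left_mem_segment ℝ x y
  have hle : ∀ s ∈ Ioc (0 : ℝ) 1, |inner ℝ (G x) (y - x)| ≤ s * (L * ‖y - x‖ ^ 2) := by
    intro s hs
    have hz : x + s • (y - x) ∈ segment ℝ x y :=
      segment_eq_image' ℝ x y ▸ ⟨s, ⟨hs.1.le, hs.2⟩, rfl⟩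
    have htaylor := h.taylor x (hxy hx) _ (hxy hz)
    rw [h0 _ hz, h0 _ hx, add_sub_cancel_left, inner_smul_right, sub_self, zero_sub, abs_neg,
      abs_mul, dist_self_add_right, norm_smul, Real.norm_eq_abs, abs_of_pos hs.1] at htaylor
    exact le_of_mul_le_mul_left (htaylor.trans_eq (by ring)) hs.1
  have hlim : Tendsto (fun s => s * (L * ‖y - x‖ ^ 2)) (𝓝[>] 0) (𝓝 0) := by
    simpa only [zero_mul] using
      ((continuous_mul_const (L * ‖y - x‖ ^ 2)).tendsto 0).mono_left nhdsWithin_le_nhds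
  exact abs_nonpos_iff.1 (ge_of_tendsto hlim
    (mem_of_superset (Ioc_mem_nhdsGT one_pos) hle))

theorem IsJet.inner_eq_zero_of_mem_segment (h : IsJet S f G L) {a b x : E}
    (hab : segment ℝ a b ⊆ S) (h0 : ∀ y ∈ segment ℝ a b, f y = 0) (hx : x ∈ segment ℝ a b) :
    inner ℝ (G x) (b - a) = 0 := by
  have hend : ∀ y ∈ segment ℝ a b, inner ℝ (G x) (y - x) = 0 := fun y hy => by
    have hsub := (convex_segment a b).segment_subset hx hy
    exact h.inner_sub_eq_zero (hsub.trans hab) fun z hz => h0 z (hsub hz)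
  rw [← sub_sub_sub_cancel_right b a x, inner_sub_right, hend b (right_mem_segment ℝ a b),
    hend a (left_mem_segment ℝ a b), sub_zero]

theorem IsJet.norm_le_of_eq_zero_frontier (ho : IsOpen S) (hb : Bornology.IsBounded S)
    (hL : 0 ≤ L) (h : IsJet (closure S) f G L) (h0 : ∀ x ∈ frontier S, f x = 0) {x : E}
    (hx : x ∈ closure S) : ‖G x‖ ≤ 2 * Metric.diam (closure S) * L := by
  set D := Metric.diam (closure S)
  have hD : ∀ y ∈ closure S, ∀ z ∈ closure S, dist y z ≤ D := fun y hy z hz =>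
    Metric.dist_le_diam_of_mem hb.closure hy hz
  obtain ⟨z, hz⟩ := closure_nonempty_iff.1 ⟨x, hx⟩
  have hzc := subset_closure hz
  suffices hGz : ‖G z‖ ≤ L * D by
    calc ‖G x‖ ≤ ‖G z‖ + L * dist z x := h.norm_le_add hzc hx
      _ ≤ L * D + L * D := by gcongr; exact hD z hzc x hx
      _ = 2 * D * L := by ring
  rcases eq_or_ne (G z) 0 with hGz | hGz
  · rw [hGz, norm_zero]
    exact mul_nonneg hL Metric.diam_nonneg
  obtain ⟨s, hs, hp⟩ := exists_add_smul_mem_frontier hb hz hGz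
  obtain ⟨t, ht, hq⟩ := exists_add_smul_mem_frontier hb hz (neg_ne_zero.2 hGz)
  have hs' : 0 < s := hs.lt_of_ne <| by
    rintro rfl
    rw [zero_smul, add_zero, ho.frontier_eq] at hp
    exact hp.2 hz
  have hg := norm_pos_iff.2 hGz
  have hpc := frontier_subset_closure hp
  have hqc := frontier_subset_closure hq
  -- Taylor's formula at `z` for two boundary points on the line through `z` along `G z`.
  have hfp := h.taylor z hzc _ hpc
  have hfq := h.taylor z hzc _ hqc
  rw [h0 _ hp, add_sub_cancel_left, dist_self_add_right, norm_smul, real_inner_smul_right,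
    real_inner_self_eq_norm_sq, Real.norm_of_nonneg hs] at hfp
  rw [h0 _ hq, add_sub_cancel_left, dist_self_add_right, norm_smul, real_inner_smul_right,
    inner_neg_right, real_inner_self_eq_norm_sq, norm_neg, Real.norm_of_nonneg ht] at hfq
  refine le_of_mul_le_mul_left ?_ (mul_pos (add_pos_of_pos_of_nonneg hs' ht) hg)
  calc (s + t) * ‖G z‖ * ‖G z‖ ≤ L * (s * ‖G z‖) ^ 2 + L * (t * ‖G z‖) ^ 2 := by
        linarith [(abs_le.1 hfp).1, (abs_le.1 hfq).2]
    _ ≤ (s + t) * ‖G z‖ * (L * ((s + t) * ‖G z‖)) := by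
        have : 0 ≤ 2 * L * (s * t) * ‖G z‖ ^ 2 := by positivity
        linarith
    _ ≤ (s + t) * ‖G z‖ * (L * D) := by
        gcongr
        refine le_of_eq_of_le ?_ (hD _ hpc _ hqc)
        rw [dist_add_left, dist_eq_norm, smul_neg, sub_neg_eq_add, ← add_smul, norm_smul,
          Real.norm_of_nonneg (add_nonneg hs ht)]

end Vanishing

section Polygon

open Module

variable {E : Type*} [NormedAddCommGroup E] [InnerProductSpace ℝ E] [Fact (finrank ℝ E = 2)]
  (o : Orientation ℝ E (Fin 2))

theorem inner_eq_zero_of_areaForm_eq_zero {g d w : E} (hd : d ≠ 0) (h : o.areaForm d w = 0)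
    (hg : inner ℝ g d = 0) : inner ℝ g w = 0 := by
  have hid := o.inner_mul_inner_add_areaForm_mul_areaForm d g w
  rw [h, real_inner_comm, hg, zero_mul, mul_zero, add_zero, eq_comm, mul_eq_zero] at hid
  exact hid.resolve_left (pow_ne_zero 2 (norm_ne_zero_iff.2 hd))

theorem norm_le_mul_norm_sub_of_inner_eq_zero {g g' d d' : E} (hω : o.areaForm d d' ≠ 0)
    (hg : inner ℝ g d = 0) (hg' : inner ℝ g' d' = 0) :
    ‖g‖ ≤ ‖d‖ * ‖d'‖ / |o.areaForm d d'| * ‖g - g'‖ := by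
  rw [div_mul_eq_mul_div, le_div_iff₀ (abs_pos.2 hω)]
  calc ‖g‖ * |o.areaForm d d'| ≤ |inner ℝ g d| * ‖d'‖ + |inner ℝ g d'| * ‖d‖ :=
        norm_mul_abs_areaForm_le o g d d'
    _ = |inner ℝ (g - g') d'| * ‖d‖ := by
        rw [hg, abs_zero, zero_mul, zero_add, inner_sub_left, hg', sub_zero]
    _ ≤ ‖g - g'‖ * ‖d'‖ * ‖d‖ := by gcongr; exact abs_real_inner_le_norm _ _
    _ = ‖d‖ * ‖d'‖ * ‖g - g'‖ := by ring

theorem areaForm_eq_of_mem_segment {d a b x : E} (h : o.areaForm d (b - a) = 0)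
    (hx : x ∈ segment ℝ a b) : o.areaForm d x = o.areaForm d a := by
  obtain ⟨t, -, rfl⟩ := (segment_eq_image' ℝ a b ▸ hx :)
  simp only [map_add, map_smul, h, smul_zero, add_zero]

variable {Ω : Set E}

theorem exists_norm_le_of_segments (ho : IsOpen Ω) (hb : Bornology.IsBounded Ω) {a b a' b' : E}
    (hab : segment ℝ a b ⊆ frontier Ω) (hab' : segment ℝ a' b' ⊆ frontier Ω) :
    ∃ C : ℝ, 0 ≤ C ∧ ∀ (u : E → ℝ) (G : E → E) (L : ℝ), 0 ≤ L → IsJet (closure Ω) u G L →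
      (∀ x ∈ frontier Ω, u x = 0) → ∀ x ∈ segment ℝ a b, ∀ y ∈ segment ℝ a' b',
        o.areaForm (b - a) (y - x) ≠ 0 → ‖G x‖ ≤ C * L * dist x y := by
  have hsub := frontier_subset_closure (s := Ω)
  by_cases hpar : o.areaForm (b - a) (b' - a') = 0
  · set m := |o.areaForm (b - a) (a' - a)| / ‖b - a‖ with hm
    refine ⟨2 * Metric.diam (closure Ω) / m, by positivity, fun u G L hL hu h0 x hx y hy hω => ?_⟩
    have hd : 0 < ‖b - a‖ := norm_pos_iff.2 fun h => hω (by rw [h, map_zero, LinearMap.zero_apply])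
    have heq : o.areaForm (b - a) (y - x) = o.areaForm (b - a) (a' - a) := by
      rw [map_sub (o.areaForm (b - a)), map_sub (o.areaForm (b - a)),
        areaForm_eq_of_mem_segment o hpar hy,
        areaForm_eq_of_mem_segment o (o.areaForm_apply_self _) hx]
    have hm₀ : 0 < m := div_pos (abs_pos.2 (heq ▸ hω)) hd
    have hdist : m ≤ dist x y := by
      rw [hm, div_le_iff₀' hd, ← heq, dist_comm, dist_eq_norm]
      exact o.abs_areaForm_le _ _
    calc ‖G x‖ ≤ 2 * Metric.diam (closure Ω) * L :=
          hu.norm_le_of_eq_zero_frontier ho hb hL h0 (hsub (hab hx))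
      _ = 2 * Metric.diam (closure Ω) / m * L * m := by field_simp
      _ ≤ _ := by gcongr
  · refine ⟨‖b - a‖ * ‖b' - a'‖ / |o.areaForm (b - a) (b' - a')|, by positivity,
      fun u G L _ hu h0 x hx y hy _ => ?_⟩
    have htangent : ∀ {p q z : E}, segment ℝ p q ⊆ frontier Ω → z ∈ segment ℝ p q →
        inner ℝ (G z) (q - p) = 0 := fun hpq hz =>
      hu.inner_eq_zero_of_mem_segment (hpq.trans hsub) (fun w hw => h0 w (hpq hw)) hz
    rw [mul_assoc]
    refine (norm_le_mul_norm_sub_of_inner_eq_zero o hpar (htangent hab hx)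
      (htangent hab' hy)).trans ?_
    gcongr
    rw [dist_comm]
    exact hu.lipschitz y (hsub (hab' hy)) x (hsub (hab hx))

theorem exists_norm_le_of_areaForm_ne_zero (ho : IsOpen Ω) (hb : Bornology.IsBounded Ω)
    {S : Finset (E × E)} (hS : frontier Ω = ⋃ e ∈ S, segment ℝ e.1 e.2) :
    ∃ C : ℝ, 0 ≤ C ∧ ∀ (u : E → ℝ) (G : E → E) (L : ℝ), 0 ≤ L → IsJet (closure Ω) u G L →
      (∀ x ∈ frontier Ω, u x = 0) → ∀ e ∈ S, ∀ x ∈ segment ℝ e.1 e.2, ∀ y ∈ frontier Ω,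
        o.areaForm (e.2 - e.1) (y - x) ≠ 0 → ‖G x‖ ≤ C * L * dist x y := by
  have hseg : ∀ e ∈ S, segment ℝ e.1 e.2 ⊆ frontier Ω := fun e he =>
    hS ▸ subset_biUnion_of_mem (u := fun e : E × E => segment ℝ e.1 e.2) he
  choose! C hC₀ hC using fun e (he : e ∈ S) e' (he' : e' ∈ S) =>
    exists_norm_le_of_segments o ho hb (hseg e he) (hseg e' he')
  have hterm : ∀ p ∈ S ×ˢ S, 0 ≤ C p.1 p.2 := fun p hp =>
    hC₀ _ (Finset.mem_product.1 hp).1 _ (Finset.mem_product.1 hp).2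
  refine ⟨∑ p ∈ S ×ˢ S, C p.1 p.2, Finset.sum_nonneg hterm,
    fun u G L hL hu h0 e he x hx y hy hω => ?_⟩
  obtain ⟨e', he', hye⟩ := mem_iUnion₂.1 (hS ▸ hy)
  refine (hC e he e' he' u G L hL hu h0 x hx y hye hω).trans ?_
  gcongr
  exact Finset.single_le_sum hterm (Finset.mk_mem_product he he')

end Polygon

/-! ### Local approximation by affine functions -/

section AffineApprox

variable {E : Type*} [NormedAddCommGroup E] [InnerProductSpace ℝ E]

/-- The affine function with value `a` and gradient `g` at `x`. -/
noncomputable def affineOf (a : ℝ) (g x : E) : E →ᵃ[ℝ] ℝ :=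
  (innerₛₗ ℝ g).toAffineMap + AffineMap.const ℝ E (a - inner ℝ g x)

theorem affineOf_apply (a : ℝ) (g x y : E) : affineOf a g x y = a + inner ℝ g (y - x) := by
  simp only [affineOf, AffineMap.coe_add, Pi.add_apply, LinearMap.coe_toAffineMap,
    innerₛₗ_apply_apply, AffineMap.const_apply, inner_sub_right]
  ring

variable [FiniteDimensional ℝ E]

theorem affGrad_affineOf (a : ℝ) (g x : E) : affGrad (affineOf a g x) = g := by
  refine ext_inner_right ℝ fun y => ?_
  have h := affine_sub_eq (affineOf a g x) 0 y
  rw [affineOf_apply, affineOf_apply, sub_zero, zero_sub, inner_sub_right, inner_neg_right] at h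
  linarith

/-- The affine function `A` approximates `u` to second order, and its gradient approximates `G` to
first order, at the scale `r` near `x`. -/
structure IsAffineApprox (S : Set E) (u : E → ℝ) (G : E → E) (A : E →ᵃ[ℝ] ℝ) (x : E) (r B : ℝ) :
    Prop where
  abs_sub_le : ∀ y ∈ S ∩ Metric.ball x (2 * r), |u y - A y| ≤ B * r ^ 2
  norm_sub_affGrad_le : ∀ y ∈ S ∩ Metric.ball x (2 * r), ‖G y - affGrad A‖ ≤ B * r

variable {S : Set E} {u : E → ℝ} {G : E → E} {L B r : ℝ} {x z : E}

theorem IsJet.isAffineApprox (h : IsJet S u G L) (hL : 0 ≤ L)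
    (hz : z ∈ S ∩ Metric.ball x (2 * r)) :
    IsAffineApprox S u G (affineOf (u z) (G z) z) x r (16 * L) := by
  have hdist : ∀ y ∈ S ∩ Metric.ball x (2 * r), dist z y ≤ 4 * r := fun y hy => by
    linarith [dist_triangle_right z y x, Metric.mem_ball.1 hz.2, Metric.mem_ball.1 hy.2]
  refine ⟨fun y hy => ?_, fun y hy => ?_⟩
  · rw [affineOf_apply, ← sub_sub]
    calc _ ≤ L * dist z y ^ 2 := h.taylor z hz.1 y hy.1
      _ ≤ L * (4 * r) ^ 2 := by gcongr; exact hdist y hy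
      _ = _ := by ring
  · rw [affGrad_affineOf]
    have hr : 0 ≤ r := by linarith [hdist z hz, dist_self z]
    calc _ ≤ L * dist z y := h.lipschitz z hz.1 y hy.1
      _ ≤ L * (4 * r) := by gcongr; exact hdist y hy
      _ ≤ 16 * L * r := by linarith [mul_nonneg hL hr]

theorem IsAffineApprox.mono {A : E →ᵃ[ℝ] ℝ} (h : IsAffineApprox S u G A x r B) (hr : 0 ≤ r)
    {B' : ℝ} (hB : B ≤ B') : IsAffineApprox S u G A x r B' :=
  ⟨fun y hy => (h.abs_sub_le y hy).trans (mul_le_mul_of_nonneg_right hB (sq_nonneg r)),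
    fun y hy => (h.norm_sub_affGrad_le y hy).trans (mul_le_mul_of_nonneg_right hB hr)⟩

theorem IsAffineApprox.affineOf_zero (h : IsAffineApprox S u G (affineOf 0 (G z) z) x r B)
    (hz : z ∈ Metric.ball x (2 * r)) {C : ℝ} (hG : ‖G z‖ ≤ C * r) :
    IsAffineApprox S u G (affineOf 0 0 z) x r (B + 4 * C) := by
  have hCr : 0 ≤ C * r := (norm_nonneg _).trans hG
  refine ⟨fun y hy => ?_, fun y hy => ?_⟩
  · have hdist : ‖y - z‖ ≤ 4 * r := by
      rw [← dist_eq_norm]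
      linarith [dist_triangle_right y z x, Metric.mem_ball.1 hz, Metric.mem_ball.1 hy.2]
    have hA : |inner ℝ (G z) (y - z)| ≤ C * r * (4 * r) :=
      (abs_real_inner_le_norm _ _).trans (mul_le_mul hG hdist (norm_nonneg _) hCr)
    have hu := h.abs_sub_le y hy
    rw [affineOf_apply, zero_add] at hu
    rw [affineOf_apply, inner_zero_left, add_zero, sub_zero,
      ← sub_add_cancel (u y) (inner ℝ (G z) (y - z))]
    exact (abs_add_le _ _).trans ((add_le_add hu hA).trans_eq (by ring))
  · have hG' := h.norm_sub_affGrad_le y hy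
    rw [affGrad_affineOf] at hG'
    rw [affGrad_affineOf, sub_zero, ← sub_add_cancel (G y) (G z)]
    exact (norm_add_le _ _).trans ((add_le_add hG' hG).trans (by linarith))

end AffineApprox

section Polygon

open Module

variable {E : Type*} [NormedAddCommGroup E] [InnerProductSpace ℝ E] [FiniteDimensional ℝ E]
  [Fact (finrank ℝ E = 2)] {Ω : Set E}

theorem exists_isAffineApprox_of_frontier_eq_zero (o : Orientation ℝ E (Fin 2)) (ho : IsOpen Ω)
    (hb : Bornology.IsBounded Ω) (hcl : interior (closure Ω) ⊆ Ω) {S : Finset (E × E)}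
    (hS : frontier Ω = ⋃ e ∈ S, segment ℝ e.1 e.2) :
    ∃ C : ℝ, 1 ≤ C ∧ ∀ (u : E → ℝ) (G : E → E) (L : ℝ), 0 ≤ L → IsJet (closure Ω) u G L →
      (∀ y ∈ frontier Ω, u y = 0) → ∀ (x : E) (r : ℝ), ∀ z ∈ frontier Ω ∩ Metric.ball x (2 * r),
        ∃ A, IsAffineApprox (closure Ω) u G A x r (16 * C * L) ∧
          ∀ y ∈ frontier Ω ∩ Metric.ball x (2 * r), A y = 0 := by
  obtain ⟨c, hc, hbound⟩ := exists_norm_le_of_areaForm_ne_zero o ho hb hS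
  refine ⟨c + 1, by linarith, fun u G L hL hu h0 x r z ⟨hzf, hzx⟩ => ?_⟩
  have hzc := frontier_subset_closure hzf
  have htaylor := hu.isAffineApprox hL ⟨hzc, hzx⟩
  rw [h0 z hzf] at htaylor
  have hrank : 1 < Module.rank ℝ E := by
    rw [← finrank_eq_rank, Fact.out (p := finrank ℝ E = 2)]; exact_mod_cast one_lt_two
  obtain ⟨e, he, hne, hze⟩ := exists_nondegenerate_segment
    (hS ▸ preperfect_frontier hrank ho hcl _ hzf)
  have hseg : segment ℝ e.1 e.2 ⊆ frontier Ω :=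
    hS ▸ subset_biUnion_of_mem (u := fun e : E × E => segment ℝ e.1 e.2) he
  by_cases hline : ∀ y ∈ frontier Ω ∩ Metric.ball x (2 * r), o.areaForm (e.2 - e.1) (y - z) = 0
  · have hr : 0 ≤ r := by linarith [Metric.pos_of_mem_ball hzx]
    refine ⟨_, htaylor.mono hr (by linarith [mul_nonneg hc hL]), fun y hy => ?_⟩
    rw [affineOf_apply, zero_add]
    exact inner_eq_zero_of_areaForm_eq_zero o (sub_ne_zero.2 hne.symm) (hline y hy)
      (hu.inner_eq_zero_of_mem_segment (hseg.trans frontier_subset_closure)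
        (fun y hy => h0 y (hseg hy)) hze)
  · -- Two nearby boundary segments that are not on a line force `G z` to be small.
    push Not at hline
    obtain ⟨y, hy, hω⟩ := hline
    have hzy : dist z y ≤ 4 * r := by
      linarith [dist_triangle_right z y x, Metric.mem_ball.1 hzx, Metric.mem_ball.1 hy.2]
    have hG : ‖G z‖ ≤ 4 * (c * L) * r :=
      calc ‖G z‖ ≤ c * L * dist z y := hbound u G L hL hu h0 e he z hze y hy.1 hω
        _ ≤ c * L * (4 * r) := by gcongr
        _ = 4 * (c * L) * r := by ring
    refine ⟨affineOf 0 0 z, ?_, fun _ _ => by rw [affineOf_apply, inner_zero_left, add_zero]⟩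
    convert htaylor.affineOf_zero hzx hG using 1
    ring

theorem exists_isAffineApprox (o : Orientation ℝ E (Fin 2)) (ho : IsOpen Ω)
    (hb : Bornology.IsBounded Ω) (hcl : interior (closure Ω) ⊆ Ω) {S : Finset (E × E)}
    (hS : frontier Ω = ⋃ e ∈ S, segment ℝ e.1 e.2) :
    ∃ C : ℝ, 1 ≤ C ∧ ∀ (u : E → ℝ) (G : E → E) (L : ℝ), 0 ≤ L → IsJet (closure Ω) u G L →
      ∀ x ∈ closure Ω, ∀ r : ℝ, 0 < r → ∃ A, IsAffineApprox (closure Ω) u G A x r (C * L) ∧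
        ((∀ y ∈ frontier Ω, u y = 0) → ∀ y ∈ frontier Ω ∩ Metric.ball x (2 * r), A y = 0) := by
  obtain ⟨C, hC, hzero⟩ := exists_isAffineApprox_of_frontier_eq_zero o ho hb hcl hS
  refine ⟨16 * C, by linarith, fun u G L hL hu x hx r hr => ?_⟩
  have htaylor : IsAffineApprox (closure Ω) u G (affineOf (u x) (G x) x) x r (16 * C * L) :=
    (hu.isAffineApprox hL ⟨hx, Metric.mem_ball_self (by positivity)⟩).mono hr.le
      (by linarith [mul_le_mul_of_nonneg_right hC hL])
  by_cases h0 : ∀ y ∈ frontier Ω, u y = 0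
  · rcases (frontier Ω ∩ Metric.ball x (2 * r)).eq_empty_or_nonempty with hempty | ⟨z, hz⟩
    · exact ⟨_, htaylor, fun _ y hy => absurd hy (hempty ▸ notMem_empty y)⟩
    · obtain ⟨A, hA, hA0⟩ := hzero u G L hL hu h0 x r z hz
      exact ⟨A, hA, fun _ => hA0⟩
  · exact ⟨_, htaylor, fun h => absurd h h0⟩

end Polygon

/-! ### Ritz projection -/

section Galerkin

variable {Ω : Set Plane} {T : Geometry.SimplicialComplex ℝ Plane} {u U v w g z : H1 Ω}

theorem integrable_inner_of_memLp {α E : Type*} [MeasurableSpace α] {μ : Measure α}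
    [NormedAddCommGroup E] [InnerProductSpace ℝ E] {f g : α → E} (hf : MemLp f 2 μ)
    (hg : MemLp g 2 μ) : Integrable (fun x => inner ℝ (f x) (g x)) μ :=
  (hf.norm.integrable_mul hg.norm).mono' (hf.1.inner hg.1)
    (Eventually.of_forall fun x => norm_inner_le_norm (f x) (g x))

theorem semiDistH1_le_of_bilin_eq (hz : ∀ x, U.grad x = w.grad x + z.grad x)
    (h : bilin u z = bilin U z) : semiDistH1 u U ≤ semiDistH1 u w := by
  have he : MemLp (fun x => u.grad x - U.grad x) 2 (volume.restrict Ω) :=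
    u.memLp_grad.sub U.memLp_grad
  have he_sq := he.integrable_norm_pow (p := 2) two_ne_zero
  have hz_sq := z.memLp_grad.integrable_norm_pow (p := 2) two_ne_zero
  have hez := (integrable_inner_of_memLp he z.memLp_grad).const_mul 2
  have horth : ∫ x in Ω, inner ℝ (u.grad x - U.grad x) (z.grad x) = 0 := by
    simp only [inner_sub_left]
    rw [integral_sub (integrable_inner_of_memLp u.memLp_grad z.memLp_grad)
      (integrable_inner_of_memLp U.memLp_grad z.memLp_grad)]
    exact sub_eq_zero.2 h
  have hexpand : ∀ x, ‖u.grad x - w.grad x‖ ^ 2 = ‖u.grad x - U.grad x‖ ^ 2 +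
      2 * inner ℝ (u.grad x - U.grad x) (z.grad x) + ‖z.grad x‖ ^ 2 := fun x => by
    rw [← norm_add_sq_real, hz x]
    congr 2
    abel
  have hpythagoras : ∫ x in Ω, ‖u.grad x - w.grad x‖ ^ 2 =
      (∫ x in Ω, ‖u.grad x - U.grad x‖ ^ 2) + ∫ x in Ω, ‖z.grad x‖ ^ 2 := by
    simp only [hexpand]
    rw [integral_add (by exact he_sq.add hez) hz_sq, integral_add he_sq hez, integral_const_mul,
      horth, mul_zero, add_zero]
  refine Real.sqrt_le_sqrt ?_
  rw [hpythagoras]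
  exact le_add_of_nonneg_right (integral_nonneg fun x => sq_nonneg _)

theorem IsWeakGradient.sub {v w : Plane → ℝ} {G H : Plane → Plane} (hv : IsWeakGradient Ω v G)
    (hw : IsWeakGradient Ω w H) : IsWeakGradient Ω (fun x => v x - w x) (fun x => G x - H x) where
  locallyIntegrableOn := hv.locallyIntegrableOn.sub hw.locallyIntegrableOn
  locallyIntegrableOn_grad := hv.locallyIntegrableOn_grad.sub hw.locallyIntegrableOn_grad
  integral_eq φ hφ := by
    simp only [sub_smul, smul_sub]
    rw [integral_sub (integrableOn_smul_gradient hv.locallyIntegrableOn hφ)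
        (integrableOn_smul_gradient hw.locallyIntegrableOn hφ),
      integral_sub (integrableOn_smul_of_isTestFunction hv.locallyIntegrableOn_grad hφ)
        (integrableOn_smul_of_isTestFunction hw.locallyIntegrableOn_grad hφ),
      hv.integral_eq φ hφ, hw.integral_eq φ hφ, neg_sub_neg, neg_sub]

instance (Ω : Set Plane) : Sub (H1 Ω) where
  sub v w :=
    { toFun := fun x => v x - w x
      grad := fun x => v.grad x - w.grad x
      memLp := v.memLp.sub w.memLp
      memLp_grad := v.memLp_grad.sub w.memLp_grad
      isWeakGradient := v.isWeakGradient.sub w.isWeakGradient }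

theorem H1.grad_add (v w : H1 Ω) (x : Plane) : (v + w).grad x = v.grad x + w.grad x := rfl

theorem H1.sub_apply (v w : H1 Ω) (x : Plane) : (v - w) x = v x - w x := rfl

theorem H1.grad_sub (v w : H1 Ω) (x : Plane) : (v - w).grad x = v.grad x - w.grad x := rfl

theorem IsTestFunction.sub {φ ψ : Plane → ℝ} (hφ : IsTestFunction Ω φ)
    (hψ : IsTestFunction Ω ψ) : IsTestFunction Ω fun x => φ x - ψ x where
  contDiff := hφ.contDiff.sub hψ.contDiff
  hasCompactSupport := hφ.hasCompactSupport.sub hψ.hasCompactSupport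
  tsupport_subset := (tsupport_sub φ ψ).trans (union_subset hφ.tsupport_subset hψ.tsupport_subset)

theorem tendsto_eLpNorm_sub_zero {α F : Type*} [MeasurableSpace α] {μ : Measure α}
    [NormedAddCommGroup F] {p : ℝ≥0∞} (hp : 1 ≤ p) {f g : ℕ → α → F}
    (hf : ∀ n, AEStronglyMeasurable (f n) μ) (hg : ∀ n, AEStronglyMeasurable (g n) μ)
    (hf0 : Tendsto (fun n => eLpNorm (f n) p μ) atTop (𝓝 0))
    (hg0 : Tendsto (fun n => eLpNorm (g n) p μ) atTop (𝓝 0)) :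
    Tendsto (fun n => eLpNorm (fun x => f n x - g n x) p μ) atTop (𝓝 0) :=
  tendsto_of_tendsto_of_tendsto_of_le_of_le tendsto_const_nhds
    (by simpa only [add_zero] using hf0.add hg0) (fun _ => zero_le)
    fun n => eLpNorm_sub_le (hf n) (hg n) hp

theorem IsH10.sub (hv : IsH10 v) (hw : IsH10 w) : IsH10 (v - w) := by
  obtain ⟨φ, hφ, hφ_fun, hφ_grad⟩ := hv
  obtain ⟨ψ, hψ, hψ_fun, hψ_grad⟩ := hw
  refine ⟨fun n x => φ n x - ψ n x, fun n => (hφ n).sub (hψ n), ?_, ?_⟩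
  · refine (tendsto_eLpNorm_sub_zero one_le_two
      (fun n => (hφ n).contDiff.continuous.aestronglyMeasurable.sub v.memLp.1)
      (fun n => (hψ n).contDiff.continuous.aestronglyMeasurable.sub w.memLp.1)
      hφ_fun hψ_fun).congr fun n => congrArg (eLpNorm · 2 _) (funext fun x => ?_)
    exact sub_sub_sub_comm _ _ _ _
  · refine (tendsto_eLpNorm_sub_zero one_le_two
      (fun n => (stronglyMeasurable_gradient (φ n)).aestronglyMeasurable.sub v.memLp_grad.1)
      (fun n => (stronglyMeasurable_gradient (ψ n)).aestronglyMeasurable.sub w.memLp_grad.1)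
      hφ_grad hψ_grad).congr fun n => congrArg (eLpNorm · 2 _) (funext fun x => ?_)
    have hgrad : gradient (fun x => φ n x - ψ n x) x = gradient (φ n) x - gradient (ψ n) x := by
      simp only [gradient]
      rw [← map_sub, fderiv_fun_sub ((hφ n).contDiff.differentiable (by simp) x)
        ((hψ n).contDiff.differentiable (by simp) x)]
    rw [hgrad]
    exact sub_sub_sub_comm _ _ _ _

theorem IsFEFunction.sub (hv : IsFEFunction T v) (hw : IsFEFunction T w) :
    IsFEFunction T (v - w) where
  continuousOn := hv.continuousOn.sub hw.continuousOn
  affine K hK := by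
    obtain ⟨A, hA⟩ := hv.affine K hK
    obtain ⟨B, hB⟩ := hw.affine K hK
    exact ⟨A - B, fun x hx => by
      rw [H1.sub_apply, hA x hx, hB x hx, AffineMap.coe_sub, Pi.sub_apply]⟩

theorem IsFEFunction0.sub (hv : IsFEFunction0 T v) (hw : IsFEFunction0 T w) :
    IsFEFunction0 T (v - w) :=
  ⟨hv.1.sub hw.1, hv.2.sub hw.2⟩

/-- `U = U₀ + g` with `U₀ ∈ V_h` is the Ritz projection of `u` with discrete Dirichlet lift `g`:
`a(U, v) = a(u, v)` for all `v ∈ V_h`. -/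
def IsRitzProjection (T : Geometry.SimplicialComplex ℝ Plane) (u g U : H1 Ω) : Prop :=
  (∃ U₀ : H1 Ω, IsFEFunction0 T U₀ ∧ U = U₀ + g) ∧
    ∀ v : H1 Ω, IsFEFunction0 T v → bilin U v = bilin u v

theorem IsFEMSolution.isRitzProjection {f : Plane → ℝ} (hU : IsFEMSolution T f g U)
    (hu : IsWeakSolution f u) : IsRitzProjection T u g U :=
  ⟨hU.1, fun v hv => (hU.2 v hv).trans (hu v hv.2).symm⟩

theorem IsRitzProjection.semiDistH1_le (hU : IsRitzProjection T u g U)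
    (hw : IsFEFunction0 T (w - g)) : semiDistH1 u U ≤ semiDistH1 u w := by
  obtain ⟨⟨U₀, hU₀, rfl⟩, horth⟩ := hU
  refine semiDistH1_le_of_bilin_eq (z := U₀ - (w - g)) (fun x => ?_)
    (horth _ (hU₀.sub hw)).symm
  simp only [H1.grad_add, H1.grad_sub]
  abel

end Galerkin

/-! ### Replacing a function by affine functions near disjoint patches -/

section Blend

variable {ι E : Type*} [NormedAddCommGroup E] [InnerProductSpace ℝ E]

/-- The function that is `A i` where the cutoff `η i` is `1`, and `u` where all cutoffs vanish. -/
def blend [Fintype ι] (u : E → ℝ) (η : ι → E → ℝ) (A : ι → E →ᵃ[ℝ] ℝ) (x : E) : ℝ :=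
  u x - ∑ i, η i x * (u x - A i x)

variable [FiniteDimensional ℝ E]

/-- The gradient of `blend u η A` when `G` and `H i` are the gradients of `u` and `η i`. -/
noncomputable def blendGrad [Fintype ι] (u : E → ℝ) (G : E → E) (η : ι → E → ℝ)
    (H : ι → E → E) (A : ι → E →ᵃ[ℝ] ℝ) (x : E) : E :=
  G x - ∑ i, (η i x • (G x - affGrad (A i)) + (u x - A i x) • H i x)

/-- Disjoint balls of radii `2 * r i`, with cutoffs `η i` and affine approximations `A i` of `u`. -/
structure IsBlending (S : Set E) (u : E → ℝ) (G : E → E) (c : ι → E) (r : ι → ℝ) (η : ι → E → ℝ)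
    (H : ι → E → E) (A : ι → E →ᵃ[ℝ] ℝ) (κ B : ℝ) : Prop where
  radius_pos : ∀ i, 0 < r i
  disjoint : Pairwise fun i j =>
    Disjoint (Metric.ball (c i) (2 * r i)) (Metric.ball (c j) (2 * r j))
  isCutoff : ∀ i, IsCutoff (η i) (H i) (c i) (r i) κ
  isAffineApprox : ∀ i, IsAffineApprox S u G (A i) (c i) (r i) B

variable {S : Set E} {u : E → ℝ} {G : E → E} {c : ι → E} {r : ι → ℝ} {η : ι → E → ℝ}
  {H : ι → E → E} {A : ι → E →ᵃ[ℝ] ℝ} {κ B L R : ℝ} {x : E}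

namespace IsBlending

theorem term_eq_zero (h : IsBlending S u G c r η H A κ B) (i : ι)
    (hx : x ∉ Metric.ball (c i) (2 * r i)) : η i x * (u x - A i x) = 0 := by
  rw [(h.isCutoff i).eq_zero x hx, zero_mul]

theorem termGrad_eq_zero (h : IsBlending S u G c r η H A κ B) (i : ι)
    (hx : x ∉ Metric.ball (c i) (2 * r i)) :
    η i x • (G x - affGrad (A i)) + (u x - A i x) • H i x = 0 := by
  rw [(h.isCutoff i).eq_zero x hx, (h.isCutoff i).grad_eq_zero x hx, zero_smul, smul_zero,
    add_zero]

theorem notMem_ball_of_ne (h : IsBlending S u G c r η H A κ B) {i j : ι} (hij : j ≠ i)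
    (hx : x ∈ Metric.ball (c i) (2 * r i)) : x ∉ Metric.ball (c j) (2 * r j) :=
  disjoint_right.1 (h.disjoint hij) hx

theorem closedBall_subset_ball (h : IsBlending S u G c r η H A κ B) (i : ι) :
    Metric.closedBall (c i) (r i) ⊆ Metric.ball (c i) (2 * r i) :=
  Metric.closedBall_subset_ball (by linarith [h.radius_pos i])

variable [Fintype ι]

theorem blend_of_mem_ball (h : IsBlending S u G c r η H A κ B) {i : ι}
    (hx : x ∈ Metric.ball (c i) (2 * r i)) : blend u η A x = u x - η i x * (u x - A i x) :=
  congrArg (u x - ·) (Fintype.sum_eq_single i fun j hj =>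
    h.term_eq_zero j (h.notMem_ball_of_ne hj hx))

theorem blendGrad_of_mem_ball (h : IsBlending S u G c r η H A κ B) {i : ι}
    (hx : x ∈ Metric.ball (c i) (2 * r i)) :
    blendGrad u G η H A x = G x - (η i x • (G x - affGrad (A i)) + (u x - A i x) • H i x) :=
  congrArg (G x - ·) (Fintype.sum_eq_single i fun j hj =>
    h.termGrad_eq_zero j (h.notMem_ball_of_ne hj hx))

theorem blend_of_notMem (h : IsBlending S u G c r η H A κ B)
    (hx : ∀ i, x ∉ Metric.ball (c i) (2 * r i)) : blend u η A x = u x := by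
  rw [blend, Finset.sum_eq_zero fun i _ => h.term_eq_zero i (hx i), sub_zero]

theorem blendGrad_of_notMem (h : IsBlending S u G c r η H A κ B)
    (hx : ∀ i, x ∉ Metric.ball (c i) (2 * r i)) : blendGrad u G η H A x = G x := by
  rw [blendGrad, Finset.sum_eq_zero fun i _ => h.termGrad_eq_zero i (hx i), sub_zero]

theorem blend_of_mem_closedBall (h : IsBlending S u G c r η H A κ B) {i : ι}
    (hx : x ∈ Metric.closedBall (c i) (r i)) : blend u η A x = A i x := by
  rw [h.blend_of_mem_ball (h.closedBall_subset_ball i hx), (h.isCutoff i).eq_one x hx, one_mul,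
    sub_sub_cancel]

theorem blend_eq_zero (h : IsBlending S u G c r η H A κ B) (hu : u x = 0)
    (hA : ∀ i, x ∈ Metric.ball (c i) (2 * r i) → A i x = 0) : blend u η A x = 0 := by
  by_cases hex : ∃ i, x ∈ Metric.ball (c i) (2 * r i)
  · obtain ⟨i, hi⟩ := hex
    rw [h.blend_of_mem_ball hi, hA i hi, hu, sub_zero, mul_zero, sub_zero]
  · rw [h.blend_of_notMem (not_exists.1 hex), hu]

theorem abs_blend_sub_le (h : IsBlending S u G c r η H A κ B) (hB : 0 ≤ B) (hx : x ∈ S)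
    (hR : ∑ i, r i ^ 2 ≤ R) : |blend u η A x - u x| ≤ B * R := by
  have hR0 : 0 ≤ R := (Finset.sum_nonneg fun i _ => sq_nonneg (r i)).trans hR
  by_cases hex : ∃ i, x ∈ Metric.ball (c i) (2 * r i)
  · obtain ⟨i, hi⟩ := hex
    have hri : r i ^ 2 ≤ R := (Finset.single_le_sum (f := fun j => r j ^ 2)
      (fun j _ => sq_nonneg (r j)) (Finset.mem_univ i)).trans hR
    rw [h.blend_of_mem_ball hi, sub_sub_cancel_left, abs_neg, abs_mul]
    calc |η i x| * |u x - A i x| ≤ 1 * (B * r i ^ 2) :=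
          mul_le_mul ((h.isCutoff i).abs_le_one x) ((h.isAffineApprox i).abs_sub_le x ⟨hx, hi⟩)
            (abs_nonneg _) zero_le_one
      _ ≤ B * R := by rw [one_mul]; exact mul_le_mul_of_nonneg_left hri hB
  · rw [h.blend_of_notMem (not_exists.1 hex), sub_self, abs_zero]
    exact mul_nonneg hB hR0

theorem norm_sub_blendGrad_le (h : IsBlending S u G c r η H A κ B) {i : ι}
    (hx : x ∈ S ∩ Metric.ball (c i) (2 * r i)) :
    ‖G x - blendGrad u G η H A x‖ ≤ (1 + κ) * B * r i := by
  have hu := (h.isAffineApprox i).abs_sub_le x hx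
  have hG := (h.isAffineApprox i).norm_sub_affGrad_le x hx
  have hr := (h.radius_pos i).ne'
  rw [h.blendGrad_of_mem_ball hx.2, sub_sub_cancel]
  calc _ ≤ |η i x| * ‖G x - affGrad (A i)‖ + |u x - A i x| * ‖H i x‖ := by
        refine (norm_add_le _ _).trans_eq ?_
        rw [norm_smul, norm_smul, Real.norm_eq_abs, Real.norm_eq_abs]
    _ ≤ 1 * (B * r i) + B * r i ^ 2 * (κ / r i) :=
        add_le_add (mul_le_mul ((h.isCutoff i).abs_le_one x) hG (norm_nonneg _) zero_le_one)
          (mul_le_mul hu ((h.isCutoff i).norm_grad_le x) (norm_nonneg _)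
            ((abs_nonneg _).trans hu))
    _ = (1 + κ) * B * r i := by field

theorem isJet (h : IsBlending S u G c r η H A κ B) (hκ : 0 ≤ κ) (hB : 0 ≤ B) (hLB : L ≤ B)
    (hu : IsJet S u G L) :
    IsJet S (blend u η A) (blendGrad u G η H A) (L + 2 * ((1 + 11 * κ) * B)) :=
  hu.sub <| IsJet.sum h.disjoint (by positivity)
    (fun i => (h.isCutoff i).isJet_mul (h.radius_pos i) hκ hB
      ((hu.sub_affine (A i)).mono_const hLB) (h.isAffineApprox i).abs_sub_le
      (h.isAffineApprox i).norm_sub_affGrad_le)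
    (fun i _ hx => h.term_eq_zero i hx) fun i _ hx => h.termGrad_eq_zero i hx

end IsBlending

end Blend

section PatchWeight

variable {ι E : Type*} [Fintype ι] [NormedAddCommGroup E] {c : ι → E} {r : ι → ℝ} {x : E}

/-- The sum of the squared radii of the balls with centres `c i` and radii `2 * r i` that contain
`x`; it majorises the squared gradient error caused by the patches. -/
noncomputable def patchWeight (c : ι → E) (r : ι → ℝ) (x : E) : ℝ :=
  ∑ i, (Metric.ball (c i) (2 * r i)).indicator (fun _ => r i ^ 2) x

theorem patchWeight_nonneg (c : ι → E) (r : ι → ℝ) (x : E) : 0 ≤ patchWeight c r x :=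
  Finset.sum_nonneg fun i _ => indicator_nonneg (fun _ _ => sq_nonneg (r i)) x

theorem sq_le_patchWeight {i : ι} (hx : x ∈ Metric.ball (c i) (2 * r i)) :
    r i ^ 2 ≤ patchWeight c r x := by
  refine (indicator_of_mem hx fun _ => r i ^ 2).ge.trans ?_
  exact Finset.single_le_sum
    (f := fun j => (Metric.ball (c j) (2 * r j)).indicator (fun _ => r j ^ 2) x)
    (fun j _ => indicator_nonneg (fun _ _ => sq_nonneg (r j)) x) (Finset.mem_univ i)

theorem integrable_patchWeight [MeasurableSpace E] [BorelSpace E] {μ : Measure E}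
    [IsFiniteMeasure μ] (c : ι → E) (r : ι → ℝ) : Integrable (patchWeight c r) μ :=
  integrable_finsetSum _ fun i _ => (integrable_const (r i ^ 2)).indicator measurableSet_ball

theorem volume_real_ball {c : Plane} {r : ℝ} (hr : 0 ≤ r) :
    volume.real (Metric.ball c r) = Real.pi * r ^ 2 := by
  rw [Measure.real, EuclideanSpace.volume_ball_fin_two, ENNReal.toReal_mul, ENNReal.toReal_pow,
    ENNReal.toReal_ofReal hr, ENNReal.toReal_ofReal Real.pi_pos.le, mul_comm]

theorem setIntegral_patchWeight_le {Ω : Set Plane} (hb : Bornology.IsBounded Ω) {c : ι → Plane}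
    (hr : ∀ i, 0 ≤ r i) {R : ℝ} (hR : ∑ i, r i ^ 2 ≤ R) :
    ∫ x in Ω, patchWeight c r x ≤ 4 * Real.pi * R ^ 2 := by
  have := isFiniteMeasure_restrict_of_isBounded hb
  have hR0 : 0 ≤ R := (Finset.sum_nonneg fun i _ => sq_nonneg (r i)).trans hR
  have hball : ∀ i, ∫ x in Ω, (Metric.ball (c i) (2 * r i)).indicator (fun _ => r i ^ 2) x ≤
      r i ^ 2 * (4 * Real.pi * R) := fun i => by
    have hi : r i ^ 2 ≤ R := (Finset.single_le_sum (f := fun j => r j ^ 2)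
      (fun j _ => sq_nonneg (r j)) (Finset.mem_univ i)).trans hR
    rw [integral_indicator_const _ measurableSet_ball, smul_eq_mul, mul_comm]
    refine mul_le_mul_of_nonneg_left ?_ (sq_nonneg _)
    calc _ ≤ volume.real (Metric.ball (c i) (2 * r i)) :=
          ENNReal.toReal_mono measure_ball_lt_top.ne (Measure.restrict_apply_le _ _)
      _ = 4 * Real.pi * r i ^ 2 := by
          rw [volume_real_ball (mul_nonneg zero_le_two (hr i))]; ring
      _ ≤ 4 * Real.pi * R := mul_le_mul_of_nonneg_left hi (by positivity)
  calc _ = ∑ i, ∫ x in Ω, (Metric.ball (c i) (2 * r i)).indicator (fun _ => r i ^ 2) x :=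
        integral_finsetSum _ fun i _ => (integrable_const _).indicator measurableSet_ball
    _ ≤ ∑ i, r i ^ 2 * (4 * Real.pi * R) := Finset.sum_le_sum fun i _ => hball i
    _ = (∑ i, r i ^ 2) * (4 * Real.pi * R) := (Finset.sum_mul ..).symm
    _ ≤ R * (4 * Real.pi * R) := mul_le_mul_of_nonneg_right hR (by positivity)
    _ = 4 * Real.pi * R ^ 2 := by ring

end PatchWeight

section BlendError

variable {ι E : Type*} [Fintype ι] [NormedAddCommGroup E] [InnerProductSpace ℝ E]
  [FiniteDimensional ℝ E] {S : Set E} {u : E → ℝ} {G : E → E} {c : ι → E} {r : ι → ℝ}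
  {η : ι → E → ℝ} {H : ι → E → E} {A : ι → E →ᵃ[ℝ] ℝ} {κ B L s d : ℝ} {x : E} {K : Finset E}

theorem IsBlending.norm_sub_blendGrad_sq_le (h : IsBlending S u G c r η H A κ B) (hx : x ∈ S) :
    ‖G x - blendGrad u G η H A x‖ ^ 2 ≤ ((1 + κ) * B) ^ 2 * patchWeight c r x := by
  by_cases hex : ∃ i, x ∈ Metric.ball (c i) (2 * r i)
  · obtain ⟨i, hi⟩ := hex
    calc _ ≤ ((1 + κ) * B * r i) ^ 2 :=
          pow_le_pow_left₀ (norm_nonneg _) (h.norm_sub_blendGrad_le ⟨hx, hi⟩) 2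
      _ = ((1 + κ) * B) ^ 2 * r i ^ 2 := mul_pow _ _ _
      _ ≤ _ := mul_le_mul_of_nonneg_left (sq_le_patchWeight hi) (sq_nonneg _)
  · rw [h.blendGrad_of_notMem (not_exists.1 hex), sub_self, norm_zero, zero_pow two_ne_zero]
    exact mul_nonneg (sq_nonneg _) (patchWeight_nonneg c r x)

theorem IsBlending.norm_sub_affGrad_sq_le_of_subset (h : IsBlending S u G c r η H A κ B)
    (hκ : 0 ≤ κ) (hB : 0 ≤ B) (hK : IsFullSimplex K) {i : ι}
    (hKi : convexHull ℝ (K : Set E) ⊆ Metric.closedBall (c i) (r i)) (hx : x ∈ S)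
    (hxK : x ∈ convexHull ℝ (K : Set E)) :
    ‖G x - affGrad (nodalAffine K (blend u η A))‖ ^ 2 ≤
      ((1 + κ) * B) ^ 2 * patchWeight c r x := by
  have hxi := h.closedBall_subset_ball i (hKi hxK)
  have hA : A i = nodalAffine K (blend u η A) := hK.eq_nodalAffine fun p hp =>
    (h.blend_of_mem_closedBall (hKi (subset_convexHull ℝ _ hp))).symm
  rw [← hA]
  have hri := h.radius_pos i
  calc ‖G x - affGrad (A i)‖ ^ 2 ≤ (B * r i) ^ 2 := pow_le_pow_left₀ (norm_nonneg _)
        ((h.isAffineApprox i).norm_sub_affGrad_le x ⟨hx, hxi⟩) 2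
    _ ≤ ((1 + κ) * B * r i) ^ 2 := by
        gcongr
        exact le_mul_of_one_le_left hB (le_add_of_nonneg_right hκ)
    _ = ((1 + κ) * B) ^ 2 * r i ^ 2 := mul_pow _ _ _
    _ ≤ _ := mul_le_mul_of_nonneg_left (sq_le_patchWeight hxi) (sq_nonneg _)

theorem IsBlending.norm_sub_affGrad_sq_le (h : IsBlending S u G c r η H A κ B) (hκ : 0 ≤ κ)
    (hB : 0 ≤ B) (hLB : L ≤ B) (hL : 0 ≤ L) (hu : IsJet S u G L) (hK : IsFullSimplex K)
    (hK' : IsEdgeStable K s ∨ ∃ i, convexHull ℝ (K : Set E) ⊆ Metric.closedBall (c i) (r i))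
    (hKS : convexHull ℝ (K : Set E) ⊆ S)
    (hd : ∀ x ∈ convexHull ℝ (K : Set E), ∀ y ∈ convexHull ℝ (K : Set E), dist x y ≤ d)
    (hx : x ∈ convexHull ℝ (K : Set E)) :
    ‖G x - affGrad (nodalAffine K (blend u η A))‖ ^ 2 ≤
      2 * (s * (2 * (L + 2 * ((1 + 11 * κ) * B)) * d)) ^ 2 +
        2 * ((1 + κ) * B) ^ 2 * patchWeight c r x := by
  have hweight : 0 ≤ ((1 + κ) * B) ^ 2 * patchWeight c r x :=
    mul_nonneg (sq_nonneg _) (patchWeight_nonneg c r x)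
  rcases hK' with hstable | ⟨i, hi⟩
  · have hblend := h.norm_sub_blendGrad_sq_le (hKS hx)
    have hinterp := hstable.norm_sub_affGrad_le (h.isJet hκ hB hLB hu) (by positivity) hKS hd
      (fun p hp => hK.nodalAffine_vertex (blend u η A) hp) hx
    calc _ ≤ (‖G x - blendGrad u G η H A x‖ +
          ‖blendGrad u G η H A x - affGrad (nodalAffine K (blend u η A))‖) ^ 2 :=
          pow_le_pow_left₀ (norm_nonneg _) (norm_sub_le_norm_sub_add_norm_sub ..) 2
      _ ≤ 2 * (‖G x - blendGrad u G η H A x‖ ^ 2 +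
          ‖blendGrad u G η H A x - affGrad (nodalAffine K (blend u η A))‖ ^ 2) := add_sq_le
      _ ≤ _ := by linarith [pow_le_pow_left₀ (norm_nonneg _) hinterp 2]
  · have hpatch := h.norm_sub_affGrad_sq_le_of_subset hκ hB hK hi (hKS hx) hx
    linarith [sq_nonneg (s * (2 * (L + 2 * ((1 + 11 * κ) * B)) * d))]

end BlendError

/-! ### Quasi-interpolation on clustered triangulations -/

section MeshSize

variable {Ω : Set Plane} {T : Geometry.SimplicialComplex ℝ Plane}

theorem IsTriangulation.dist_le_meshSize (hT : IsTriangulation Ω T) {K : Finset Plane}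
    (hK : K ∈ elements T) {x y : Plane} (hx : x ∈ tri K) (hy : y ∈ tri K) :
    dist x y ≤ meshSize T :=
  (Metric.dist_le_diam_of_mem (K.finite_toSet.isCompact_convexHull ℝ).isBounded hx hy).trans
    (le_csSup (hT.finite_elements.image _).bddAbove (mem_image_of_mem _ hK))

theorem meshSize_nonneg (T : Geometry.SimplicialComplex ℝ Plane) : 0 ≤ meshSize T :=
  Real.sSup_nonneg (forall_mem_image.2 fun _ _ => Metric.diam_nonneg)

theorem IsBlending.semiDistH1_le {ι : Type*} [Fintype ι] {u w : H1 Ω} {G : Plane → Plane}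
    {c : ι → Plane} {r : ι → ℝ} {η : ι → Plane → ℝ} {H : ι → Plane → Plane}
    {A : ι → Plane →ᵃ[ℝ] ℝ} {κ B L R s : ℝ} (h : IsBlending (closure Ω) u G c r η H A κ B)
    (hκ : 0 ≤ κ) (hL : 0 ≤ L) (hLB : L ≤ B) (hb : Bornology.IsBounded Ω)
    (hT : IsTriangulation Ω T) (hu : IsJet (closure Ω) u G L)
    (hG : ∀ᵐ x ∂volume.restrict Ω, u.grad x = G x)
    (hw : IsNodalInterpolant T (blend u η A) w)
    (hcover : ∀ K ∈ elements T, IsEdgeStable K s ∨ ∃ i, tri K ⊆ Metric.closedBall (c i) (r i))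
    (hR : ∑ i, r i ^ 2 ≤ R) :
    semiDistH1 u w ≤ √(2 * (s * (2 * (L + 2 * ((1 + 11 * κ) * B)) * meshSize T)) ^ 2 *
      volume.real Ω + 8 * Real.pi * ((1 + κ) * B) ^ 2 * R ^ 2) := by
  have := isFiniteMeasure_restrict_of_isBounded hb
  set a := 2 * (s * (2 * (L + 2 * ((1 + 11 * κ) * B)) * meshSize T)) ^ 2
  set b := 2 * ((1 + κ) * B) ^ 2
  have herror : ∀ᵐ x ∂volume.restrict Ω,
      ‖u.grad x - w.grad x‖ ^ 2 ≤ a + b * patchWeight c r x := by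
    filter_upwards [hG, hT.ae_mem_interior_tri] with x hxG ⟨K, hK, hxK⟩
    rw [hxG, hw.grad_eq K hK x hxK]
    exact h.norm_sub_affGrad_sq_le hκ (hL.trans hLB) hLB hL hu (isFullSimplex_of_mem_elements hK)
      (hcover K hK) (hT.tri_subset hK) (fun x hx y hy => hT.dist_le_meshSize hK hx hy)
      (interior_subset hxK)
  have hweight : Integrable (fun x => b * patchWeight c r x) (volume.restrict Ω) :=
    (integrable_patchWeight c r).const_mul b
  refine Real.sqrt_le_sqrt ?_
  calc ∫ x in Ω, ‖u.grad x - w.grad x‖ ^ 2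
      ≤ ∫ x in Ω, (a + b * patchWeight c r x) :=
        integral_mono_of_nonneg (Eventually.of_forall fun x => sq_nonneg _)
          ((integrable_const a).add hweight) herror
    _ = a * volume.real Ω + b * ∫ x in Ω, patchWeight c r x := by
        rw [integral_add (integrable_const a) hweight, integral_const, smul_eq_mul,
          measureReal_restrict_apply_univ, integral_const_mul, mul_comm a]
    _ ≤ a * volume.real Ω + b * (4 * Real.pi * R ^ 2) := by
        gcongr
        exact setIntegral_patchWeight_le hb (fun i => (h.radius_pos i).le) hR
    _ = _ := by ring

end MeshSize

section PatchFamily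

/-- A weakening of `IsClusterFamily`: the patches `𝒞 i` are nonempty sets of elements, not
necessarily with a simply connected union. -/
structure IsPatchFamily (T : Geometry.SimplicialComplex ℝ Plane) (α₀ C₁ : ℝ) {ι : Type*}
    [Fintype ι] (𝒞 : ι → Set (Finset Plane)) : Prop where
  subset : ∀ i, 𝒞 i ⊆ elements T
  nonempty : ∀ i, (𝒞 i).Nonempty
  cover : ∀ K ∈ badElements T α₀, ∃ i, K ∈ 𝒞 i
  sum_le : ∑ i, clusterDiam (𝒞 i) ^ 2 ≤ C₁ * meshSize T
  separated : ∀ i j, i ≠ j → ∀ x ∈ region (𝒞 i), ∀ y ∈ region (𝒞 j),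
    2 * (clusterDiam (𝒞 i) + clusterDiam (𝒞 j)) ≤ dist x y

variable {Ω : Set Plane} {T : Geometry.SimplicialComplex ℝ Plane} {α₀ C₁ : ℝ}

theorem IsClusterFamily.isPatchFamily {N : ℕ} {𝒞 : Fin N → Set (Finset Plane)}
    (h : IsClusterFamily T α₀ C₁ 𝒞) : IsPatchFamily T α₀ C₁ 𝒞 where
  subset i := (h.isCluster i).subset
  nonempty i := (h.isCluster i).exists_bad.imp fun _ hK => hK.1
  cover := h.cover
  sum_le := h.sum_le
  separated := h.separated

theorem tri_subset_region {𝒞 : Set (Finset Plane)} {K : Finset Plane} (hK : K ∈ 𝒞) :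
    tri K ⊆ region 𝒞 :=
  subset_biUnion_of_mem (u := tri) hK

theorem IsTriangulation.region_subset (hT : IsTriangulation Ω T) {𝒞 : Set (Finset Plane)}
    (h𝒞 : 𝒞 ⊆ elements T) : region 𝒞 ⊆ closure Ω :=
  iUnion₂_subset fun _ hK => hT.tri_subset (h𝒞 hK)

theorem IsTriangulation.exists_region_subset_closedBall (hT : IsTriangulation Ω T)
    (hb : Bornology.IsBounded Ω) {𝒞 : Set (Finset Plane)} (h𝒞 : 𝒞 ⊆ elements T)
    (hne : 𝒞.Nonempty) :
    0 < clusterDiam 𝒞 ∧ ∃ c ∈ region 𝒞, region 𝒞 ⊆ Metric.closedBall c (clusterDiam 𝒞) := by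
  have hbounded : Bornology.IsBounded (region 𝒞) := hb.closure.subset (hT.region_subset h𝒞)
  obtain ⟨K, hK⟩ := hne
  obtain ⟨p, hp, q, hq, hpq⟩ : ∃ p ∈ K, ∃ q ∈ K, p ≠ q :=
    Finset.one_lt_card.1 (by rw [(h𝒞 hK).2]; norm_num)
  have hmem : ∀ p ∈ K, p ∈ region 𝒞 := fun p hp => tri_subset_region hK (vertex_mem_tri hp)
  exact ⟨(dist_pos.2 hpq).trans_le (Metric.dist_le_diam_of_mem hbounded (hmem p hp) (hmem q hq)),
    p, hmem p hp, fun x hx => Metric.dist_le_diam_of_mem hbounded hx (hmem p hp)⟩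

variable {ι : Type*} [Fintype ι] {𝒞 : ι → Set (Finset Plane)}

theorem IsPatchFamily.disjoint_ball (h𝒞 : IsPatchFamily T α₀ C₁ 𝒞) {c : ι → Plane}
    (hc : ∀ i, c i ∈ region (𝒞 i)) : Pairwise fun i j =>
      Disjoint (Metric.ball (c i) (2 * clusterDiam (𝒞 i)))
        (Metric.ball (c j) (2 * clusterDiam (𝒞 j))) := fun i j hij =>
  Metric.ball_disjoint_ball (by linarith [h𝒞.separated i j hij _ (hc i) _ (hc j)])

theorem IsPatchFamily.isEdgeStable_or_subset (h𝒞 : IsPatchFamily T α₀ C₁ 𝒞) {s : ℝ}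
    (hs : ∀ K : Finset Plane, K.card = 3 → maxAngle K ≤ α₀ → IsEdgeStable K s)
    {K : Finset Plane} (hK : K ∈ elements T) :
    IsEdgeStable K s ∨ ∃ i, tri K ⊆ region (𝒞 i) := by
  by_cases hbad : α₀ < maxAngle K
  · obtain ⟨i, hi⟩ := h𝒞.cover K ⟨hK, hbad⟩
    exact .inr ⟨i, tri_subset_region hi⟩
  · exact .inl (hs K hK.2 (not_lt.1 hbad))

/-- `w ∈ X_h` approximates `u` to accuracy `ε` in the `H¹` seminorm and at the boundary vertices;
it interpolates `u` at the boundary vertices away from the patches, and preserves homogeneous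
boundary values. -/
structure IsQuasiInterpolant (T : Geometry.SimplicialComplex ℝ Plane)
    (𝒞 : ι → Set (Finset Plane)) (u : H1 Ω) (ε : ℝ) (w : H1 Ω) : Prop where
  isFEFunction : IsFEFunction T w
  nodal_le : ∀ p ∈ T.vertices, p ∈ frontier Ω → |w p - u p| ≤ ε
  nodal_eq : ∀ p ∈ T.vertices, p ∈ frontier Ω →
    (∀ i, ∀ x ∈ region (𝒞 i), 2 * clusterDiam (𝒞 i) ≤ dist p x) → w p = u p
  isH10 : (∀ x ∈ frontier Ω, u x = 0) → IsH10 w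
  semiDistH1_le : semiDistH1 u w ≤ ε

end PatchFamily

section QuasiInterpolation

variable {Ω : Set Plane} {T : Geometry.SimplicialComplex ℝ Plane} {α₀ C₁ : ℝ}

theorem IsPatchFamily.exists_isBlending {ι : Type*} [Fintype ι] {𝒞 : ι → Set (Finset Plane)}
    (h𝒞 : IsPatchFamily T α₀ C₁ 𝒞) (hT : IsTriangulation Ω T) (hb : Bornology.IsBounded Ω)
    {u : Plane → ℝ} {G : Plane → Plane} {κ B : ℝ}
    (hcut : ∀ (x : Plane) (r : ℝ), 0 < r → ∃ η H, IsCutoff η H x r κ)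
    (happ : ∀ x ∈ closure Ω, ∀ r : ℝ, 0 < r → ∃ A, IsAffineApprox (closure Ω) u G A x r B ∧
      ((∀ y ∈ frontier Ω, u y = 0) → ∀ y ∈ frontier Ω ∩ Metric.ball x (2 * r), A y = 0)) :
    ∃ c η H A, IsBlending (closure Ω) u G c (fun i => clusterDiam (𝒞 i)) η H A κ B ∧
      (∀ i, c i ∈ region (𝒞 i)) ∧
      (∀ i, region (𝒞 i) ⊆ Metric.closedBall (c i) (clusterDiam (𝒞 i))) ∧
      ((∀ y ∈ frontier Ω, u y = 0) → ∀ y ∈ frontier Ω, blend u η A y = 0) := by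
  choose hr c hc hcr using fun i =>
    hT.exists_region_subset_closedBall hb (h𝒞.subset i) (h𝒞.nonempty i)
  choose η H hη using fun i => hcut (c i) _ (hr i)
  choose A hA hA0 using fun i =>
    happ (c i) (hT.region_subset (h𝒞.subset i) (hc i)) _ (hr i)
  have hblend : IsBlending (closure Ω) u G c (fun i => clusterDiam (𝒞 i)) η H A κ B :=
    ⟨hr, h𝒞.disjoint_ball hc, hη, hA⟩
  exact ⟨c, η, H, A, hblend, hc, hcr, fun h0 y hy =>
    hblend.blend_eq_zero (h0 y hy) fun i hi => hA0 i h0 y ⟨hy, hi⟩⟩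

theorem IsPatchFamily.exists_isQuasiInterpolant {ι : Type*} [Fintype ι]
    {𝒞 : ι → Set (Finset Plane)} (h𝒞 : IsPatchFamily T α₀ C₁ 𝒞) (hT : IsTriangulation Ω T)
    (hΩ : IsPolygonalDomain Ω) {u : H1 Ω} {G : Plane → Plane} {κ B L s : ℝ} (hκ : 0 ≤ κ)
    (hL : 0 ≤ L) (hLB : L ≤ B) (hu : IsJet (closure Ω) u G L)
    (hG : ∀ᵐ x ∂volume.restrict Ω, u.grad x = G x)
    (hs : ∀ K : Finset Plane, K.card = 3 → maxAngle K ≤ α₀ → IsEdgeStable K s)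
    (hcut : ∀ (x : Plane) (r : ℝ), 0 < r → ∃ η H, IsCutoff η H x r κ)
    (happ : ∀ x ∈ closure Ω, ∀ r : ℝ, 0 < r → ∃ A, IsAffineApprox (closure Ω) u G A x r B ∧
      ((∀ y ∈ frontier Ω, u y = 0) → ∀ y ∈ frontier Ω ∩ Metric.ball x (2 * r), A y = 0)) :
    ∃ w, IsQuasiInterpolant T 𝒞 u (B * (C₁ * meshSize T) +
      √(2 * (s * (2 * (L + 2 * ((1 + 11 * κ) * B)) * meshSize T)) ^ 2 * volume.real Ω +
        8 * Real.pi * ((1 + κ) * B) ^ 2 * (C₁ * meshSize T) ^ 2)) w := by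
  obtain ⟨c, η, H, A, hblend, hc, hcr, hblend0⟩ := h𝒞.exists_isBlending hT hΩ.isBounded hcut happ
  obtain ⟨C, hC0, hC⟩ := hΩ.exists_isQuasiconvex
  lift C to ℝ≥0 using hC0
  obtain ⟨w, hw, hw0⟩ := exists_isNodalInterpolant hΩ.isOpen hΩ.isBounded hΩ.lipschitz hC hT
    (blend u η A)
  have hB : 0 ≤ B := hL.trans hLB
  have hR : 0 ≤ C₁ * meshSize T := (Finset.sum_nonneg fun i _ => sq_nonneg _).trans h𝒞.sum_le
  refine ⟨w, hw.isFEFunction, fun p hp hpf => ?_, fun p hp _ hpd => ?_,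
    fun h0 => hw0 fun p _ hpf => hblend0 h0 p hpf, ?_⟩
  · rw [hw.apply_vertex hT hp]
    exact (hblend.abs_blend_sub_le hB (frontier_subset_closure hpf) h𝒞.sum_le).trans
      (le_add_of_nonneg_right (Real.sqrt_nonneg _))
  · rw [hw.apply_vertex hT hp]
    exact hblend.blend_of_notMem fun i hi => (Metric.mem_ball.1 hi).not_ge (hpd i _ (hc i))
  · have hcover : ∀ K ∈ elements T, IsEdgeStable K s ∨
        ∃ i, tri K ⊆ Metric.closedBall (c i) (clusterDiam (𝒞 i)) := fun K hK =>
      (h𝒞.isEdgeStable_or_subset hs hK).imp_right fun ⟨i, hi⟩ => ⟨i, hi.trans (hcr i)⟩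
    exact (hblend.semiDistH1_le hκ hL hLB hΩ.isBounded hT hu hG hw hcover h𝒞.sum_le).trans
      (le_add_of_nonneg_left (mul_nonneg hB hR))

open scoped EuclideanSpace in
theorem IsPolygonalDomain.exists_isQuasiInterpolant (hΩ : IsPolygonalDomain Ω)
    (hα₀ : α₀ < Real.pi) (C₁ : ℝ) :
    ∃ C : ℝ, ∀ T : Geometry.SimplicialComplex ℝ Plane, IsTriangulation Ω T →
      ∀ (N : ℕ) (𝒞 : Fin N → Set (Finset Plane)), IsPatchFamily T α₀ C₁ 𝒞 →
      ∀ (u : H1 Ω) (D2 : Fin 2 → Plane → Plane), IsW2Inf u D2 →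
      ∃ w, IsQuasiInterpolant T 𝒞 u (C * semiNormW2Inf Ω D2 * meshSize T) w := by
  obtain ⟨Cq, -, hquasi⟩ := hΩ.exists_isQuasiconvex
  obtain ⟨s, -, hs⟩ := exists_isEdgeStable hα₀
  obtain ⟨κ, hκ, hcut⟩ := exists_isCutoff Plane
  obtain ⟨S, hS⟩ := hΩ.polygonal
  obtain ⟨Ca, hCa, happ⟩ := exists_isAffineApprox
    (EuclideanSpace.basisFun (Fin 2) ℝ).toBasis.orientation hΩ.isOpen hΩ.isBounded
    (interior_closure_subset hΩ.lipschitz) hS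
  set Cj := (|Cq| + Cq ^ 2) * 4
  set Q := 2 * (s * (2 * (Cj + 2 * ((1 + 11 * κ) * (Ca * Cj))))) ^ 2 * volume.real Ω +
    8 * Real.pi * ((1 + κ) * (Ca * Cj)) ^ 2 * C₁ ^ 2
  have hCj : 0 ≤ Cj := by positivity
  have hQ : 0 ≤ Q := by positivity
  refine ⟨Ca * Cj * C₁ + √Q, fun T hT N 𝒞 h𝒞 u D2 hu => ?_⟩
  obtain ⟨G, hG, hjet⟩ := hu.exists_isJet hΩ.isOpen hΩ.isBounded hquasi
  have hM : 0 ≤ semiNormW2Inf Ω D2 := semiNormW2Inf_nonneg Ω D2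
  rw [← mul_assoc] at hjet
  have hL : 0 ≤ Cj * semiNormW2Inf Ω D2 := mul_nonneg hCj hM
  convert h𝒞.exists_isQuasiInterpolant hT hΩ hκ.le hL (le_mul_of_one_le_left hL hCa) hjet hG hs
    hcut (happ u G _ hL hjet) using 3
  have hscale : √Q * (semiNormW2Inf Ω D2 * meshSize T) =
      √(Q * (semiNormW2Inf Ω D2 * meshSize T) ^ 2) := by
    rw [Real.sqrt_mul hQ, Real.sqrt_sq (mul_nonneg hM (meshSize_nonneg T))]
  rw [add_mul, add_mul, mul_assoc (√Q), hscale]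
  congr 1
  · ring
  · congr 1
    ring

theorem IsQuasiInterpolant.exists_isBoundaryApprox {N : ℕ} {𝒞 : Fin N → Set (Finset Plane)}
    {u w : H1 Ω} {ε : ℝ} (hw : IsQuasiInterpolant T 𝒞 u ε w) (ho : IsOpen Ω)
    (hb : Bornology.IsBounded Ω) :
    ∃ g, IsBoundaryApprox T 𝒞 u ε g ∧ IsFEFunction0 T (w - g) := by
  set z : H1 Ω := H1.ofLipschitz ho hb (LipschitzWith.const 0)
  have hz : IsFEFunction0 T z :=
    ⟨⟨continuousOn_const, fun _ _ => ⟨0, fun _ _ => rfl⟩⟩, isH10_ofLipschitz ho hb _ fun _ _ => rfl⟩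
  by_cases h0 : ∀ x ∈ frontier Ω, u x = 0
  · have hε : 0 ≤ ε := (Real.sqrt_nonneg _).trans hw.semiDistH1_le
    refine ⟨z, ⟨hz.1, fun p _ hp => ?_, fun p _ hp _ => (h0 p hp).symm, fun _ _ _ => rfl⟩,
      IsFEFunction0.sub ⟨hw.isFEFunction, hw.isH10 h0⟩ hz⟩
    rw [h0 p hp, sub_zero]
    exact abs_zero.trans_le hε
  · refine ⟨w, ⟨hw.isFEFunction, hw.nodal_le, hw.nodal_eq, fun h => absurd h h0⟩,
      hw.isFEFunction.sub hw.isFEFunction, ?_⟩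
    refine hz.2.congr (.of_forall fun x => (sub_self (w x)).symm) (.of_forall fun x => ?_)
    exact (gradient_const x (0 : ℝ)).trans (sub_self (w.grad x)).symm

end QuasiInterpolation

end ClusterFEM

open ClusterFEM in
theorem theorem3p4_general {Ω : Set Plane} (hΩ : IsPolygonalDomain Ω) {α₀ : ℝ}
    (hα₀ : α₀ < Real.pi) (C₁ : ℝ) :
    ∃ C : ℝ, ∀ T : Geometry.SimplicialComplex ℝ Plane, IsTriangulation Ω T →
      ∀ (N : ℕ) (𝒞 : Fin N → Set (Finset Plane)), IsPatchFamily T α₀ C₁ 𝒞 →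
      ∀ (u : H1 Ω) (D2 : Fin 2 → Plane → Plane), IsW2Inf u D2 →
      ∃ g : H1 Ω, IsBoundaryApprox T 𝒞 u (C * semiNormW2Inf Ω D2 * meshSize T) g ∧
        ∀ U : H1 Ω, IsRitzProjection T u g U →
          semiDistH1 u U ≤ C * semiNormW2Inf Ω D2 * meshSize T := by
  obtain ⟨C, hC⟩ := hΩ.exists_isQuasiInterpolant hα₀ C₁
  refine ⟨C, fun T hT N 𝒞 h𝒞 u D2 hu => ?_⟩
  obtain ⟨w, hw⟩ := hC T hT N 𝒞 h𝒞 u D2 hu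
  obtain ⟨g, hg, hwg⟩ := hw.exists_isBoundaryApprox hΩ.isOpen hΩ.isBounded
  exact ⟨g, hg, fun U hU => (hU.semiDistH1_le hwg).trans hw.semiDistH1_le⟩

open ClusterFEM in
/-- `O(h)` convergence of the finite element method for `u ∈ W^{2,∞}(Ω)` on triangulations whose
elements violating the maximum angle condition are grouped into clusters. The constant `C` depends
only on `Ω`, `α₀`, `C₁`, so the bound is uniform over every family of such triangulations. -/
theorem theorem3p4 (Ω : Set Plane) (hΩ : IsPolygonalDomain Ω)
    (α₀ : ℝ) (hα₀ : α₀ < Real.pi) (C₁ : ℝ) :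
    ∃ C : ℝ, ∀ (T : Geometry.SimplicialComplex ℝ Plane), IsTriangulation Ω T →
      ∀ (N : ℕ) (𝒞 : Fin N → Set (Finset Plane)), IsClusterFamily T α₀ C₁ 𝒞 →
      ∀ (u : H1 Ω) (D2 : Fin 2 → Plane → Plane), IsW2Inf u D2 →
      ∃ g : H1 Ω, IsBoundaryApprox T 𝒞 u (C * semiNormW2Inf Ω D2 * meshSize T) g ∧
        ∀ f : Plane → ℝ, MemLp f 2 (volume.restrict Ω) → IsWeakSolution f u →
          ∀ U : H1 Ω, IsFEMSolution T f g U →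
            semiDistH1 u U ≤ C * semiNormW2Inf Ω D2 * meshSize T := by
  obtain ⟨C, hC⟩ := theorem3p4_general hΩ hα₀ C₁
  refine ⟨C, fun T hT N 𝒞 h𝒞 u D2 hu => ?_⟩
  obtain ⟨g, hg, hU⟩ := hC T hT N 𝒞 h𝒞.isPatchFamily u D2 hu
  exact ⟨g, hg, fun f _ hf U hUf => hU U (hUf.isRitzProjection hf)⟩
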